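/- **Setting.** All manifolds are smooth, finite-dimensional, Hausdorff, second countable and without boundary; submanifolds are embedded. A quadratic Lie algebra $\mathfrak d$ is a finite-dimensional real Lie algebra with a nondegenerate symmetric invariant bilinear form. A subalgebra $\mathfrak c\subseteq\mathfrak d$ is coisotropic if $\mathfrak c^\perp\subseteq\mathfrak c$, and Lagrangian if $\mathfrak c^\perp=\mathfrak c$; for coisotropic $\mathfrak c$ put $\mathfrak d_{\mathfrak c}=\mathfrak c/\mathfrak c^\perp$ with the induced metric, and let $R_{\mathfrak c}:\mathfrak d\dashrightarrow\mathfrak d_{\mathfrak c}$ be the relation $\xi\sim\xi+\mathfrak c^\perp$ ($\xi\in\mathfrak c$). If $\mathfrak d$ acts on $N$ with coisotropic stabilizers, $\mathfrak d\times N$ denotes the action Courant algebroid. $\mathbb TM=TM\oplus T^*M$ is the standard Courant algebroid, and $\overline{\mathbb TM}$ is the same with the opposite metric. For a Lagrangian subalgebra $\mathfrak h\subseteq\mathfrak d$, a *morphism of Manin pairs* $R:(\mathbb T,T)M\dashrightarrow(\mathfrak d,\mathfrak h)\times N$ is a Dirac structure $R\subseteq(\mathfrak d\times N)\times\overline{\mathbb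 TM}$ (a smooth, Lagrangian, involutive subbundle) supported on the graph of a smooth map $\mu:M\to N$ such that $v\sim_R\xi$ with $v\in TM$ implies $\xi\in\mathfrak h$, and $v\sim_R0$ with $v\in TM$ implies $v=0$. Each $\xi\in\mathfrak h$ then generates the vector field $\rho_R(\xi)$ on $M$ determined by $\rho_R(\xi)\sim_R\xi$. *Reductive data* $(\mathfrak c,S)$ for $R$ consist of a coisotropic subalgebra $\mathfrak c\subseteq\mathfrak d$ and a submanifold $S\subseteq N$ to which the vector fields of $\mathfrak c$ are tangent, such that the $\mathfrak c^\perp$-orbits in $S$ are the fibres of a surjective submersion $q_N:S\to N_{\mathfrak c,S}$ onto a manifold, $\mathrm{gr}(\mu)$ intersects $S\times M$ cleanly, and the $\mathfrak h\cap\mathfrak c^\perp$-orbits in $\mu^{-1}(S)$ are the fibres of a surjective submersion $q_M:\mu^{-1}(S)\to M_{\mathfrak c,S}$ onto a manifold. (An orbit in $S$ is a class of points joined by finitely many pieces of integral curves lying in $S$.) With $i_N,i_M$ the inclusions of $S$ and $\mu^{-1}(S)$, and $R_f$ the standard lift of a map $f$ (that is, $v+f^*\beta\sim_{R_f}df(v)+\beta$),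 the *reduction* is $$R_{\mathfrak c,S}=\big(R_{\mathfrak c}\times(\mathrm{gr}(q_N)\circ\mathrm{gr}(i_N)^\top)\big)\circ R\circ\big(R_{q_M}\circ R_{i_M}^\top\big)^\top:(\mathbb T,T)M_{\mathfrak c,S}\dashrightarrow(\mathfrak d_{\mathfrak c},\mathfrak h_{\mathfrak c})\times N_{\mathfrak c,S},\qquad \mathfrak h_{\mathfrak c}=R_{\mathfrak c}\circ\mathfrak h,$$ where $\mathfrak d_{\mathfrak c}$ acts on $N_{\mathfrak c,S}$ by the induced action. **Proposition (commutativity of reductions).** Let $R:(\mathbb T,T)M\dashrightarrow(\mathfrak d,\mathfrak h)\times N$ be a morphism of Manin pairs and let $S_1,S_2\subseteq N$ intersect cleanly. Suppose that $(\mathfrak c_1,S_1)$, $(\mathfrak c_2,S_2)$ and $(\mathfrak c_1\cap\mathfrak c_2,S_1\cap S_2)$ are reductive data for $R$, and that $S_1\cap S_2$ is a union of $\mathfrak c_1^\perp$-orbits in $S_1$ and a union of $\mathfrak c_2^\perp$-orbits in $S_2$. Put $\mathfrak c_{2,1}=R_{\mathfrak c_1}\circ\mathfrak c_2\subseteq\mathfrak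 d_{\mathfrak c_1}$, let $S_{2,1}$ be the image of $S_1\cap S_2$ in $N_{\mathfrak c_1,S_1}$, and define $(\mathfrak c_{1,2},S_{1,2})$ by exchanging the roles of $1$ and $2$. Suppose that $(\mathfrak c_{2,1},S_{2,1})$ and $(\mathfrak c_{1,2},S_{1,2})$ are reductive data for $R_{\mathfrak c_1,S_1}$ and $R_{\mathfrak c_2,S_2}$ respectively. Then $$(R_{\mathfrak c_1,S_1})_{\mathfrak c_{2,1},S_{2,1}}=R_{\mathfrak c_1\cap\mathfrak c_2,S_1\cap S_2}=(R_{\mathfrak c_2,S_2})_{\mathfrak c_{1,2},S_{1,2}}.$$ Here equality means: the identity maps of $\mathfrak c_1\cap\mathfrak c_2$, of $S_1\cap S_2$ and of $\mu^{-1}(S_1\cap S_2)$ descend to an isomorphism of quadratic Lie algebras matching the reduced Lagrangian subalgebras, a diffeomorphism of the reduced base manifolds matching the reduced actions, and a diffeomorphism of the reduced spaces $M$, which together identify the relations. **Corollary (reductions of distinct factors commute).** Let $\mathfrak d\times N$, $\mathfrak d'\times N'$, $\mathfrak d''\times N''$ be action Courant algebroids, let $R:(\mathbb T,T)M\dashrightarrow(\mathfrak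 d\oplus\mathfrak d'\oplus\mathfrak d'',\mathfrak h)\times(N\times N'\times N'')$ be a morphism of Manin pairs, and suppose that $(\mathfrak c\oplus\mathfrak d'\oplus\mathfrak d'',S\times N'\times N'')$, $(\mathfrak d\oplus\mathfrak c'\oplus\mathfrak d'',N\times S'\times N'')$ and $(\mathfrak c\oplus\mathfrak c'\oplus\mathfrak d'',S\times S'\times N'')$ are reductive data for $R$. Then the data induced by each of the first two on the reduction by the other one (that is, $(\mathfrak d_{\mathfrak c}\oplus\mathfrak c'\oplus\mathfrak d'',N_{\mathfrak c,S}\times S'\times N'')$ and $(\mathfrak c\oplus\mathfrak d'_{\mathfrak c'}\oplus\mathfrak d'',S\times N'_{\mathfrak c',S'}\times N'')$, formed as $(\mathfrak c_{2,1},S_{2,1})$ and $(\mathfrak c_{1,2},S_{1,2})$ above) are again reductive data, and reducing in stages in either order gives, in the same sense of equality, the reduction by $(\mathfrak c\oplus\mathfrak c'\oplus\mathfrak d'',S\times S'\times N'')$. **In particular, sewings commute.** Let $G$ and $G'$ be Lie groups with invariant metrics on their Lie algebras $\mathfrak g,\mathfrak g'$, let $\overline{\mathfrak g}\oplus\mathfrak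 g$ act on $G$ by $(\xi,\eta)\mapsto-\xi^R+\eta^L$, and likewise for $G'$. Let $\mathfrak l_{sew}=\{((\xi,\eta),(\eta,\xi))\}\subseteq(\overline{\mathfrak g}\oplus\mathfrak g)^2$ and $G_\Delta^\natural=\{(g,g^{-1})\}\subseteq G^2$. Then the corollary holds with $\mathfrak d\times N=(\overline{\mathfrak g}\oplus\mathfrak g)^2\times G^2$, $(\mathfrak c,S)=(\mathfrak l_{sew},G_\Delta^\natural)$, and with $\mathfrak d'\times N'$, $(\mathfrak c',S')$ given in the same way by $G'$. -/

import Mathlib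

open scoped Manifold ContDiff Topology SetRel

universe u

noncomputable section

/-! ### Quadratic Lie algebras and coisotropic reduction -/

/-- A finite-dimensional real Lie algebra with an invariant metric (a nondegenerate symmetric
invariant bilinear form, of any signature). -/
structure QuadLieAlg : Type (u + 1) where
  carrier : Type u
  [lieRing : LieRing carrier]
  [lieAlgebra : LieAlgebra ℝ carrier]
  [finDim : FiniteDimensional ℝ carrier]
  form : LinearMap.BilinForm ℝ carrier
  form_symm : ∀ x y, form x y = form y x
  form_nondeg : ∀ x, (∀ y, form x y = 0) → x = 0
  form_inv : ∀ x y z, form ⁅x, y⁆ z = form x ⁅y, z⁆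

namespace QuadLieAlg

instance : CoeSort QuadLieAlg.{u} (Type u) := ⟨QuadLieAlg.carrier⟩

attribute [instance] lieRing lieAlgebra finDim

variable (d : QuadLieAlg.{u})

/-- The orthogonal `c^⊥` of a subalgebra. -/
def perp (c : LieSubalgebra ℝ d) : Submodule ℝ d where
  carrier := {x | ∀ y ∈ c, d.form x y = 0}
  add_mem' := by
    intro a b ha hb y hy
    simp [ha y hy, hb y hy]
  zero_mem' := by
    intro y _
    simp
  smul_mem' := by
    intro r a ha y hy
    simp [ha y hy]

/-- `c` is coisotropic: `c^⊥ ⊆ c`. -/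
def IsCoisotropic (c : LieSubalgebra ℝ d) : Prop := d.perp c ≤ c.toSubmodule

/-- `h` is Lagrangian: `h^⊥ = h`. -/
def IsLagrangian (h : LieSubalgebra ℝ d) : Prop := d.perp h = h.toSubmodule

/-- The ideal `c ∩ c^⊥` of `c`. It is `c^⊥` itself when `c` is coisotropic. -/
def radical (c : LieSubalgebra ℝ d) : LieIdeal ℝ c where
  toSubmodule := (d.perp c).comap c.toSubmodule.subtype
  lie_mem := by
    intro x m hm y hy
    have h1 : d.form (m : d) ⁅(x : d), y⁆ = 0 := hm _ (c.lie_mem x.2 hy)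
    have h2 : d.form ⁅(m : d), (x : d)⁆ y = 0 := by rw [d.form_inv]; exact h1
    change d.form ⁅(x : d), (m : d)⁆ y = 0
    rw [← lie_skew, map_neg, LinearMap.neg_apply, h2, neg_zero]

/-- The metric of `d`, restricted to `c` and descended to `c / (c ∩ c^⊥)`. -/
def reducedForm (c : LieSubalgebra ℝ d) : LinearMap.BilinForm ℝ (c ⧸ d.radical c) :=
  (d.radical c).toSubmodule.liftQ
    { toFun := fun x => (d.radical c).toSubmodule.liftQ
        ((d.form (x : d)).comp c.toSubmodule.subtype)
        (by
          intro y hy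
          have h : d.form (y : d) (x : d) = 0 := hy _ x.2
          change d.form (x : d) (y : d) = 0
          rw [d.form_symm]; exact h)
      map_add' := by
        intro x y
        apply Submodule.linearMap_qext
        ext z
        simp
      map_smul' := by
        intro r x
        apply Submodule.linearMap_qext
        ext z
        simp }
    (by
      intro x hx
      apply Submodule.linearMap_qext
      ext z
      exact hx _ z.2)

/-- The reduced quadratic Lie algebra `d_c = c / c^⊥` (for coisotropic `c`). -/
def reduce (c : LieSubalgebra ℝ d) : QuadLieAlg.{u} where
  carrier := c ⧸ d.radical c
  finDim := inferInstanceAs (FiniteDimensional ℝ (c ⧸ (d.radical c).toSubmodule))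
  form := d.reducedForm c
  form_symm := by
    intro x y
    induction x using Submodule.Quotient.induction_on with | _ x
    induction y using Submodule.Quotient.induction_on with | _ y
    exact d.form_symm _ _
  form_nondeg := by
    intro x hx
    induction x using Submodule.Quotient.induction_on with | _ x
    refine (Submodule.Quotient.mk_eq_zero _).2 ?_
    intro y hy
    exact hx (Submodule.Quotient.mk ⟨y, hy⟩)
  form_inv := by
    intro x y z
    induction x using Submodule.Quotient.induction_on with | _ x
    induction y using Submodule.Quotient.induction_on with | _ y
    induction z using Submodule.Quotient.induction_on with | _ z
    exact d.form_inv _ _ _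

/-- The quotient map `c → d_c`. -/
def toReduce (c : LieSubalgebra ℝ d) : c →ₗ⁅ℝ⁆ d.reduce c :=
  { (d.radical c).toSubmodule.mkQ with
    map_lie' := by intro x y; rfl }

/-- `R_c ∘ a ⊆ d_c`, the image of `a ∩ c` in `d_c`. -/
def image (c a : LieSubalgebra ℝ d) : LieSubalgebra ℝ (d.reduce c) :=
  (a.comap c.incl).map (d.toReduce c)

/-- The direct sum of quadratic Lie algebras. -/
def prod (d d' : QuadLieAlg.{u}) : QuadLieAlg.{u} where
  carrier := d × d'
  form := LinearMap.BilinForm.comp d.form (LinearMap.fst ℝ d d') (LinearMap.fst ℝ d d') +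
    LinearMap.BilinForm.comp d'.form (LinearMap.snd ℝ d d') (LinearMap.snd ℝ d d')
  form_symm := by
    intro x y
    simp [d.form_symm x.1 y.1, d'.form_symm x.2 y.2]
  form_nondeg := by
    intro x hx
    ext
    · exact d.form_nondeg _ fun y => by simpa using hx (y, 0)
    · exact d'.form_nondeg _ fun y => by simpa using hx (0, y)
  form_inv := by
    intro x y z
    simp [d.form_inv, d'.form_inv]

/-- The same Lie algebra with the opposite metric. -/
def neg : QuadLieAlg.{u} where
  carrier := d
  form := -d.form
  form_symm := by
    intro x y
    simp [d.form_symm x y]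
  form_nondeg := by
    intro x hx
    exact d.form_nondeg x fun y => by simpa using hx y
  form_inv := by
    intro x y z
    simp [d.form_inv]

/-- The subalgebra `c ⊕ c'` of `d ⊕ d'`. -/
def sumAlg {d d' : QuadLieAlg.{u}} (c : LieSubalgebra ℝ d) (c' : LieSubalgebra ℝ d') :
    LieSubalgebra ℝ (d.prod d') :=
  c.comap (LieHom.fst ℝ d d') ⊓ c'.comap (LieHom.snd ℝ d d')

end QuadLieAlg

/-! ### Manifolds, submanifolds, regular quotients -/

/-- A finite-dimensional smooth manifold: Hausdorff, second countable, without boundary. -/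
structure Mfd : Type (u + 1) where
  pt : Type u
  E : Type u
  H : Type u
  [normedE : NormedAddCommGroup E]
  [spaceE : NormedSpace ℝ E]
  [finDimE : FiniteDimensional ℝ E]
  [topH : TopologicalSpace H]
  I : ModelWithCorners ℝ E H
  [boundaryless : I.Boundaryless]
  [top : TopologicalSpace pt]
  [charted : ChartedSpace H pt]
  [smooth : IsManifold I ∞ pt]
  [t2 : T2Space pt]
  [secondCountable : SecondCountableTopology pt]

namespace Mfd

instance : CoeSort Mfd.{u} (Type u) := ⟨Mfd.pt⟩

attribute [instance] normedE spaceE finDimE topH boundaryless top charted smooth t2 secondCountable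

/-- The product manifold. -/
def prod (N M : Mfd.{u}) : Mfd.{u} where
  pt := N × M
  E := N.E × M.E
  H := ModelProd N.H M.H
  I := N.I.prod M.I

variable {N Q : Mfd.{u}}

/-- `S ⊆ N` is an embedded submanifold: around each of its points there is a smooth chart of `N`
in which `S` is an open piece of a linear subspace through that point. -/
def IsSubmanifold (S : Set N) : Prop :=
  ∀ x ∈ S, ∃ φ ∈ IsManifold.maximalAtlas N.I ∞ N, x ∈ φ.source ∧
    ∃ F : Submodule ℝ N.E, ∀ y ∈ φ.source,
      (y ∈ S ↔ φ.extend N.I y - φ.extend N.I x ∈ F)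

/-- The tangent bundle `TS ⊆ TN` of a submanifold `S ⊆ N`: all velocities of smooth curves
in `S`. -/
def tangentSet (S : Set N) : Set (TangentBundle N.I N) :=
  {p | ∃ γ : ℝ → N, ContMDiffAt 𝓘(ℝ, ℝ) N.I ∞ γ 0 ∧ (∀ᶠ t in 𝓝 0, γ t ∈ S) ∧
    tangentMap 𝓘(ℝ, ℝ) N.I γ ⟨0, (1 : ℝ)⟩ = p}

/-- `A` and `B` intersect cleanly in the sense of Bott:
`A ∩ B` is a submanifold and `T(A ∩ B) = TA ∩ TB`. -/
def CleanInter (A B : Set N) : Prop :=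
  IsSubmanifold (A ∩ B) ∧ tangentSet (A ∩ B) = tangentSet A ∩ tangentSet B

/-- `f` is a smooth extension to a neighbourhood of `x` in `N` of the map `q : S → Q`. -/
def IsLocalExt (S : Set N) (q : S → Q) (x : S) (f : N → Q) : Prop :=
  ContMDiffAt N.I Q.I ∞ f (x : N) ∧ ∀ᶠ y in 𝓝 (x : N), ∀ h : y ∈ S, f y = q ⟨y, h⟩

/-- A map on `S ⊆ N` is smooth if it extends locally to smooth maps on open subsets of `N`. -/
def SmoothOnSub (S : Set N) (q : S → Q) : Prop := ∀ x : S, ∃ f : N → Q, IsLocalExt S q x f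

/-- The differential `dq : TS → TQ` of a smooth map `q : S → Q`, as a relation: for `p ∈ TS`,
`IsDiff S q p r` says that `r = dq(p)`. -/
def IsDiff (S : Set N) (q : S → Q) (p : TangentBundle N.I N) (r : TangentBundle Q.I Q) : Prop :=
  ∃ (h : p.1 ∈ S) (f : N → Q), IsLocalExt S q ⟨p.1, h⟩ f ∧ tangentMap N.I Q.I f p = r

/-- `x` and `y` are joined inside `S` by a piece of an integral curve of the vector field `V`
(given by its set of values). -/
def FlowStep (V : Set (TangentBundle N.I N)) (S : Set N) (x y : S) : Prop :=
  ∃ (γ : ℝ → N) (a b : ℝ), a ≤ b ∧ γ a = x ∧ γ b = y ∧ ∀ t ∈ Set.Icc a b,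
    γ t ∈ S ∧ MDifferentiableAt 𝓘(ℝ, ℝ) N.I γ t ∧ tangentMap 𝓘(ℝ, ℝ) N.I γ ⟨t, (1 : ℝ)⟩ ∈ V

/-- `x` and `y` lie in the same orbit in `S` of the vector fields `V ξ`, `ξ ∈ k`. -/
def SameOrbit {d : QuadLieAlg.{u}} (V : d → Set (TangentBundle N.I N)) (k : Submodule ℝ d)
    (S : Set N) : S → S → Prop :=
  Relation.EqvGen fun x y => ∃ ξ ∈ k, FlowStep (V ξ) S x y

/-- `q : S → Q` exhibits the manifold `Q` as the space of classes of `r`: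
it is a surjective submersion whose fibres are the classes. -/
structure IsRegularQuotient (S : Set N) (r : S → S → Prop) (q : S → Q) : Prop where
  surjective : Function.Surjective q
  smooth : SmoothOnSub S q
  submersion : ∀ (x : S) (w : TangentSpace Q.I (q x)),
    ∃ v : TangentSpace N.I (x : N), (⟨x, v⟩ : TangentBundle N.I N) ∈ tangentSet S ∧
      IsDiff S q ⟨x, v⟩ ⟨q x, w⟩
  fibres : ∀ x y : S, q x = q y ↔ r x y

/-- The points `(m; v + α)` of `𝕋M = TM ⊕ T*M`. -/
def GTangent (M : Mfd.{u}) : Type u :=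
  Σ m : M, TangentSpace M.I m × (TangentSpace M.I m →L[ℝ] ℝ)

/-- The relation `R_q ∘ R_i^⊤ : 𝕋M ⇢ 𝕋Q` for a submanifold `i : P → M` and a map `q : P → Q`,
where `R_i`, `R_q` are the standard lifts:
`(m; v + α) ∼ (q m; w + β)` iff `m ∈ P`, `v ∈ T_m P`, `w = dq(v)` and `α|_{TP} = q^* β`. -/
def liftRel {M : Mfd.{u}} (P : Set M) (q : P → Q) : SetRel (GTangent M) (GTangent Q) :=
  {z | (⟨z.1.1, z.1.2.1⟩ : TangentBundle M.I M) ∈ tangentSet P ∧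
    IsDiff P q ⟨z.1.1, z.1.2.1⟩ ⟨z.2.1, z.2.2.1⟩ ∧
    ∀ (u : TangentSpace M.I z.1.1) (w : TangentSpace Q.I z.2.1),
      (⟨z.1.1, u⟩ : TangentBundle M.I M) ∈ tangentSet P →
      IsDiff P q ⟨z.1.1, u⟩ ⟨z.2.1, w⟩ → z.1.2.2 u = z.2.2.2 w}

end Mfd

open Mfd

/-! ### Action Courant algebroids -/

/-- The data underlying an action Courant algebroid `d × N`. -/
structure ActionSpace : Type (u + 1) where
  d : QuadLieAlg.{u}
  N : Mfd.{u}
  ρ : d → (x : N) → TangentSpace N.I x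

namespace ActionSpace

/-- `d × N` is an action Courant algebroid: `ρ` is a Lie algebra action on `N` by smooth vector
fields and all its stabilizers are coisotropic. -/
structure IsCourant (A : ActionSpace.{u}) : Prop where
  add : ∀ ξ η x, A.ρ (ξ + η) x = A.ρ ξ x + A.ρ η x
  smul : ∀ (r : ℝ) ξ x, A.ρ (r • ξ) x = r • A.ρ ξ x
  smooth : ∀ ξ, ContMDiff A.N.I A.N.I.tangent ∞
    fun x => (⟨x, A.ρ ξ x⟩ : TangentBundle A.N.I A.N)
  lie : ∀ ξ η x, A.ρ ⁅ξ, η⁆ x = VectorField.mlieBracket A.N.I (A.ρ ξ) (A.ρ η) x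
  stabilizer : ∀ x ξ, (∀ η, A.ρ η x = 0 → A.d.form ξ η = 0) → A.ρ ξ x = 0

/-- The set of values of the vector field `ρ(ξ)`. -/
def field (A : ActionSpace.{u}) (ξ : A.d) : Set (TangentBundle A.N.I A.N) :=
  {p | p.2 = A.ρ ξ p.1}

/-- The product of two actions. -/
def prod (A A' : ActionSpace.{u}) : ActionSpace.{u} where
  d := A.d.prod A'.d
  N := A.N.prod A'.N
  ρ := fun ξ x => ((A.ρ ξ.1 x.1, A'.ρ ξ.2 x.2) : A.N.E × A'.N.E)

/-- The subset `S × S'` of a product. -/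
def prodSet {A A' : ActionSpace.{u}} (S : Set A.N) (S' : Set A'.N) : Set (A.prod A').N :=
  {x | x.1 ∈ S ∧ x.2 ∈ S'}

end ActionSpace

/-- A (set-theoretic) section `(ξ, X + α)` of the bundle `(d × N) × 𝕋M` over `N × M`. -/
structure AmbSection (d : QuadLieAlg.{u}) (N M : Mfd.{u}) where
  ξ : N × M → d
  X : (p : N × M) → TangentSpace M.I p.2
  α : (p : N × M) → (TangentSpace M.I p.2 →L[ℝ] ℝ)

namespace AmbSection

variable {A : ActionSpace.{u}} {M : Mfd.{u}}

structure Smooth {d : QuadLieAlg.{u}} {N : Mfd.{u}} (e : AmbSection d N M) : Prop where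
  ξ : ∀ l : d →ₗ[ℝ] ℝ, ContMDiff (N.I.prod M.I) 𝓘(ℝ, ℝ) ∞ fun p => l (e.ξ p)
  X : ContMDiff (N.I.prod M.I) M.I.tangent ∞
    fun p => (⟨p.2, e.X p⟩ : TangentBundle M.I M)
  α : ContMDiff (N.I.prod M.I) (M.I.prod 𝓘(ℝ, M.E →L[ℝ] ℝ)) ∞
    fun p => Bundle.TotalSpace.mk' (M.E →L[ℝ] ℝ)
      (E := fun x : M => TangentSpace M.I x →L[ℝ] Bundle.Trivial M ℝ x) p.2 (e.α p)

/-- The anchor `(ρ(ξ), X)` of a section, a vector field on `N × M`. -/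
def anchor (e : AmbSection A.d A.N M) (p : A.N × M) : TangentSpace (A.N.I.prod M.I) p :=
  ((A.ρ (e.ξ p) p.1, e.X p) : A.N.E × M.E)

/-- The derivative at `p` of a function on `N × M` along the anchor of a section. -/
def der (e : AmbSection A.d A.N M) (f : A.N × M → ℝ) (p : A.N × M) : ℝ :=
  mfderiv (A.N.I.prod M.I) 𝓘(ℝ, ℝ) f p (e.anchor p)

/-- The `TM`-component of the Lie bracket of the anchors of two sections. -/
def brM (e e' : AmbSection A.d A.N M) (p : A.N × M) : TangentSpace M.I p.2 :=
  (VectorField.mlieBracket (A.N.I.prod M.I) e.anchor e'.anchor p : A.N.E × M.E).2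

/-- The fibre metric of `(d × N) × \overline{𝕋M}`. -/
def pairing (d : QuadLieAlg.{u}) {m : M}
    (a b : d × TangentSpace M.I m × (TangentSpace M.I m →L[ℝ] ℝ)) : ℝ :=
  d.form a.1 b.1 - (a.2.2 b.2.1 + b.2.2 a.2.1)

/-- The value of a section at a point. -/
def val {d : QuadLieAlg.{u}} {N : Mfd.{u}} (e : AmbSection d N M) (p : N × M) :
    d × TangentSpace M.I p.2 × (TangentSpace M.I p.2 →L[ℝ] ℝ) :=
  (e.ξ p, e.X p, e.α p)

/-- The function `⟨⟦e₁, e₂⟧, e₃⟩` for the Courant bracket of the product Courant algebroid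
`(d × N) × \overline{𝕋M}` over `N × M`, whose factors have the brackets
`⟦ξ₁, ξ₂⟧ = [ξ₁, ξ₂] + L_{ρ(ξ₁)} ξ₂ - L_{ρ(ξ₂)} ξ₁ + ρ^* ⟨dξ₁, ξ₂⟩` and
`⟦X + α, Y + β⟧ = [X, Y] + L_X β - ι_Y dα`. The second pair of lines is
`- ⟨[X₁, X₂] + L_{X₁} α₂ - ι_{X₂} dα₁, X₃ + α₃⟩` with all derivatives along the full anchors. -/
def bracketForm (e₁ e₂ e₃ : AmbSection A.d A.N M) (p : A.N × M) : ℝ :=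
  (A.d.form ⁅e₁.ξ p, e₂.ξ p⁆ (e₃.ξ p)
    + e₁.der (fun y => A.d.form (e₂.ξ y) (e₃.ξ p)) p
    - e₂.der (fun y => A.d.form (e₁.ξ y) (e₃.ξ p)) p
    + e₃.der (fun y => A.d.form (e₁.ξ y) (e₂.ξ p)) p)
  - (e₃.α p (brM e₁ e₂ p)
    + (e₁.der (fun y => e₂.α y (e₃.X y)) p - e₂.α p (brM e₁ e₃ p))
    - (e₂.der (fun y => e₁.α y (e₃.X y)) p - e₃.der (fun y => e₁.α y (e₂.X y)) p
        - e₁.α p (brM e₂ e₃ p)))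

/-- `b` is the value `⟦e₁, e₂⟧(p)` of the Courant bracket (determined through the
nondegenerate metric). -/
def IsBracketAt (e₁ e₂ : AmbSection A.d A.N M) (p : A.N × M)
    (b : A.d × TangentSpace M.I p.2 × (TangentSpace M.I p.2 →L[ℝ] ℝ)) : Prop :=
  ∀ e₃ : AmbSection A.d A.N M, e₃.Smooth → bracketForm e₁ e₂ e₃ p = pairing A.d b (e₃.val p)

end AmbSection

/-! ### Quasi-Hamiltonian spaces -/

/-- The data of a relation `R : (𝕋, T)M ⇢ (d, h) × N`. -/
structure QHam (A : ActionSpace.{u}) : Type (u + 1) where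
  h : LieSubalgebra ℝ A.d
  M : Mfd.{u}
  R : SetRel (GTangent M) (A.d × A.N)

namespace QHam

variable {A : ActionSpace.{u}}

/-- `(m; v + α) ∼_R (ξ, n)`. -/
def Rel (X : QHam A) (m : X.M)
    (z : A.d × TangentSpace X.M.I m × (TangentSpace X.M.I m →L[ℝ] ℝ)) (n : A.N) : Prop :=
  ((⟨m, (z.2.1, z.2.2)⟩ : GTangent X.M), (z.1, n)) ∈ X.R

/-- `R` is a Courant morphism `𝕋M ⇢ d × N` over `μ : M → N`: a smooth Lagrangian subbundle of
`(d × N) × \overline{𝕋M}` along the graph of `μ` which is closed under the Courant bracket. -/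
structure IsCourantMorphism (X : QHam A) (μ : X.M → A.N) : Prop where
  smooth_map : ContMDiff X.M.I A.N.I ∞ μ
  support : ∀ m z n, X.Rel m z n → n = μ m
  lagrangian : ∀ m z, X.Rel m z (μ m) ↔
    ∀ z', X.Rel m z' (μ m) → AmbSection.pairing A.d z z' = 0
  subbundle : ∀ m z, X.Rel m z (μ m) → ∃ e : AmbSection A.d A.N X.M, e.Smooth ∧
    (∀ m', X.Rel m' (e.val (μ m', m')) (μ m')) ∧ e.val (μ m, m) = z
  involutive : ∀ e₁ e₂ : AmbSection A.d A.N X.M, e₁.Smooth → e₂.Smooth →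
    (∀ m, X.Rel m (e₁.val (μ m, m)) (μ m)) → (∀ m, X.Rel m (e₂.val (μ m, m)) (μ m)) →
    ∀ m b, AmbSection.IsBracketAt e₁ e₂ (μ m, m) b → X.Rel m b (μ m)

/-- `X` is a quasi-Hamiltonian `(d, h) × N`-manifold: `d × N` is an action Courant algebroid,
`h` is a Lagrangian subalgebra and `R : (𝕋, T)M ⇢ (d, h) × N` is a morphism of Manin pairs. -/
structure IsQuasiHamiltonian (X : QHam A) : Prop where
  action : A.IsCourant
  lagrangian : A.d.IsLagrangian X.h
  courant : ∃ μ : X.M → A.N, X.IsCourantMorphism μ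
  m1 : ∀ m ξ v n, X.Rel m (ξ, v, 0) n → ξ ∈ X.h
  m2 : ∀ m v n, X.Rel m (0, v, 0) n → v = 0

/-- The graph of the underlying map `μ : M → N` of `R`: the set of base points of `R`. -/
def graph (X : QHam A) : Set (A.N.prod X.M) := {p | ∃ z, X.Rel p.2 z p.1}

/-- The preimage `μ⁻¹(S)`. -/
def preim (X : QHam A) (S : Set A.N) : Set X.M := {m | ∃ n ∈ S, ((n, m) : A.N × X.M) ∈ X.graph}

/-- The vector field on `M` generated by `ξ ∈ h`, through its set of values: the vector
`ρ_R(ξ)_m ∈ T_m M` is characterized by `ρ_R(ξ)_m ∼_R ξ`. -/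
def field (X : QHam A) (ξ : A.d) : Set (TangentBundle X.M.I X.M) :=
  {p | ∃ n, X.Rel p.1 (ξ, p.2, 0) n}

/-- Reductive data `(c, S)`, together with the quotient manifolds `N_{c,S}` and `M_{c,S}` and the
quotient maps onto them. -/
structure ReductiveData (X : QHam A) (c : LieSubalgebra ℝ A.d) (S : Set A.N) :
    Type (u + 1) where
  coisotropic : A.d.IsCoisotropic c
  submanifold : IsSubmanifold S
  invariant : ∀ ξ ∈ c, ∀ x ∈ S, (⟨x, A.ρ ξ x⟩ : TangentBundle A.N.I A.N) ∈ tangentSet S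
  redN : Mfd.{u}
  qN : S → redN
  regularN : IsRegularQuotient S (SameOrbit A.field (A.d.perp c) S) qN
  clean : CleanInter X.graph {p : A.N.prod X.M | p.1 ∈ S}
  redM : Mfd.{u}
  qM : X.preim S → redM
  regularM : IsRegularQuotient (X.preim S)
    (SameOrbit X.field (X.h.toSubmodule ⊓ A.d.perp c) (X.preim S)) qM

namespace ReductiveData

variable {X : QHam A} {c : LieSubalgebra ℝ A.d} {S : Set A.N}

/-- `d_c × N_{c,S}` with the induced action `ρ_c(ξ + c^⊥)_{q(x)} = dq(ρ(ξ)_x)`, for `ξ ∈ c` and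
`x ∈ S`. -/
def redAction (D : X.ReductiveData c S) : ActionSpace.{u} where
  d := A.d.reduce c
  N := D.redN
  ρ := fun η y => Classical.epsilon fun w : TangentSpace D.redN.I y =>
    ∃ (x : S) (ξ : c), D.qN x = y ∧ A.d.toReduce c ξ = η ∧
      IsDiff S D.qN ⟨x, A.ρ ξ x⟩ ⟨y, w⟩

/-- The relation `R_2 = R_c × (gr(q_N) ∘ gr(i_N)^⊤) : d × N ⇢ d_c × N_{c,S}`. -/
def relTarget (D : X.ReductiveData c S) : SetRel (A.d × A.N) (A.d.reduce c × D.redN) :=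
  {z | (∃ h : z.1.1 ∈ c, A.d.toReduce c ⟨z.1.1, h⟩ = z.2.1) ∧
    ∃ h : z.1.2 ∈ S, D.qN ⟨z.1.2, h⟩ = z.2.2}

/-- The relation `R_1 = R_{q_M} ∘ R_{i_M}^⊤ : 𝕋M ⇢ 𝕋M_{c,S}`. -/
def relSource (D : X.ReductiveData c S) : SetRel (GTangent X.M) (GTangent D.redM) :=
  liftRel (X.preim S) D.qM

/-- The reduction `R_{c,S} = R_2 ∘ R ∘ R_1^⊤ : (𝕋, T)M_{c,S} ⇢ (d_c, h_c) × N_{c,S}`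
(the composition sign of relations is in diagrammatic order). -/
def reduction (D : X.ReductiveData c S) : QHam D.redAction where
  h := A.d.image c X.h
  M := D.redM
  R := D.relSource.inv ○ X.R ○ D.relTarget

/-- The subalgebra `R_c ∘ a` of `d_c` induced by a subalgebra `a` of `d`. -/
def inducedAlg (D : X.ReductiveData c S) (a : LieSubalgebra ℝ A.d) :
    LieSubalgebra ℝ D.redAction.d :=
  A.d.image c a

/-- The image of `T ∩ S` under `q_N : S → N_{c,S}`. -/
def inducedSet (D : X.ReductiveData c S) (T : Set A.N) : Set D.redAction.N :=
  {y | ∃ x : S, (x : A.N) ∈ T ∧ D.qN x = y}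

end ReductiveData

/-- An identification of two quasi-Hamiltonian spaces. -/
structure Iso {B : ActionSpace.{u}} (X : QHam A) (Y : QHam B) : Type u where
  alg : A.d ≃ₗ⁅ℝ⁆ B.d
  mapN : A.N ≃ₘ⟮A.N.I, B.N.I⟯ B.N
  mapM : X.M ≃ₘ⟮X.M.I, Y.M.I⟯ Y.M
  alg_form : ∀ ξ η, B.d.form (alg ξ) (alg η) = A.d.form ξ η
  alg_h : ∀ ξ, alg ξ ∈ Y.h ↔ ξ ∈ X.h
  map_ρ : ∀ ξ n, mfderiv A.N.I B.N.I mapN n (A.ρ ξ n) = B.ρ (alg ξ) (mapN n)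
  map_R : ∀ (m : X.M) (v : TangentSpace X.M.I m) (β : TangentSpace Y.M.I (mapM m) →L[ℝ] ℝ)
    (ξ : A.d) (n : A.N),
    X.Rel m (ξ, v, β.comp (mfderiv X.M.I Y.M.I mapM m)) n ↔
      Y.Rel (mapM m) (alg ξ, mfderiv X.M.I Y.M.I mapM m v, β) (mapN n)

/-- `(R_{c₁,S₁})_{c',S'} = R_{c,S}`: the identity of `c`, of `S` and of `μ⁻¹(S)` descends to
an identification of the two-step reduction with the one-step reduction. -/
def StagesEq {X : QHam A} {c₁ c : LieSubalgebra ℝ A.d} {S₁ S : Set A.N}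
    (D₁ : X.ReductiveData c₁ S₁) {c' : LieSubalgebra ℝ D₁.redAction.d} {S' : Set D₁.redAction.N}
    (D' : D₁.reduction.ReductiveData c' S') (D : X.ReductiveData c S) : Prop :=
  ∃ e : Iso D'.reduction D.reduction,
    (∀ (ξ : A.d) (h : ξ ∈ c), ∃ (h₁ : ξ ∈ c₁) (h' : A.d.toReduce c₁ ⟨ξ, h₁⟩ ∈ c'),
      e.alg (D₁.redAction.d.toReduce c' ⟨A.d.toReduce c₁ ⟨ξ, h₁⟩, h'⟩) =
        A.d.toReduce c ⟨ξ, h⟩) ∧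
    (∀ (x : A.N) (h : x ∈ S), ∃ (h₁ : x ∈ S₁) (h' : D₁.qN ⟨x, h₁⟩ ∈ S'),
      e.mapN (D'.qN ⟨D₁.qN ⟨x, h₁⟩, h'⟩) = D.qN ⟨x, h⟩) ∧
    (∀ (x : X.M) (h : x ∈ X.preim S), ∃ (h₁ : x ∈ X.preim S₁)
      (h' : D₁.qM ⟨x, h₁⟩ ∈ D₁.reduction.preim S'),
      e.mapM (D'.qM ⟨D₁.qM ⟨x, h₁⟩, h'⟩) = D.qM ⟨x, h⟩)

/-- The data `(R_{c₁} ∘ c₂, q_N(S₂ ∩ S₁))` induced by `(c₂, S₂)` are reductive data for the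
reduction by `(c₁, S₁)`. -/
def InducedReductive {X : QHam A} {c₁ : LieSubalgebra ℝ A.d} {S₁ : Set A.N}
    (D₁ : X.ReductiveData c₁ S₁) (c₂ : LieSubalgebra ℝ A.d) (S₂ : Set A.N) : Prop :=
  Nonempty (D₁.reduction.ReductiveData (D₁.inducedAlg c₂) (D₁.inducedSet S₂))

/-- `(R_{c₁,S₁})_{c₂₁,S₂₁} = R_{c,S} = (R_{c₂,S₂})_{c₁₂,S₁₂}`, for all choices of the quotient
manifolds. -/
def StagesCommute {X : QHam A} {c₁ c₂ c : LieSubalgebra ℝ A.d} {S₁ S₂ S : Set A.N}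
    (D₁ : X.ReductiveData c₁ S₁) (D₂ : X.ReductiveData c₂ S₂) (D : X.ReductiveData c S) : Prop :=
  ∀ (D₂₁ : D₁.reduction.ReductiveData (D₁.inducedAlg c₂) (D₁.inducedSet S₂))
    (D₁₂ : D₂.reduction.ReductiveData (D₂.inducedAlg c₁) (D₂.inducedSet S₁)),
    StagesEq D₁ D₂₁ D ∧ StagesEq D₂ D₁₂ D

end QHam

/-! ### Sewing -/

/-- A Lie group with an invariant metric on its Lie algebra. -/
structure MetricLieGroup : Type (u + 1) where
  mfd : Mfd.{u}
  [group : Group mfd]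
  [lieGroup : LieGroup mfd.I ∞ mfd]
  form : LinearMap.BilinForm ℝ (GroupLieAlgebra mfd.I mfd)
  form_symm : ∀ x y, form x y = form y x
  form_nondeg : ∀ x, (∀ y, form x y = 0) → x = 0
  form_inv : ∀ x y z, form ⁅x, y⁆ z = form x ⁅y, z⁆

namespace MetricLieGroup

attribute [instance] group lieGroup

variable (G : MetricLieGroup.{u})

instance : LieGroup G.mfd.I (minSmoothness ℝ 3) G.mfd :=
  LieGroup.of_le (n := ∞) (by
    rw [minSmoothness_of_isRCLikeNormedField]
    exact WithTop.coe_le_coe.2 le_top)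

/-- The quadratic Lie algebra `g` of `G`. -/
def quad : QuadLieAlg.{u} where
  carrier := GroupLieAlgebra G.mfd.I G.mfd
  finDim := inferInstanceAs (FiniteDimensional ℝ G.mfd.E)
  form := G.form
  form_symm := G.form_symm
  form_nondeg := G.form_nondeg
  form_inv := G.form_inv

/-- The right-invariant vector field `v^R`. -/
def rightField (v : GroupLieAlgebra G.mfd.I G.mfd) (g : G.mfd) : TangentSpace G.mfd.I g :=
  (mfderiv G.mfd.I G.mfd.I (fun x => x * g) (1 : G.mfd) v : G.mfd.E)

/-- The Cartan Courant algebroid `(\overline{g} ⊕ g) × G` with `ρ(ξ, η) = -ξ^R + η^L`. -/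
def cartan : ActionSpace.{u} where
  d := G.quad.neg.prod G.quad
  N := G.mfd
  ρ := fun ζ g => -G.rightField ζ.1 g + mulInvariantVectorField (I := G.mfd.I) ζ.2 g

/-- The Lagrangian subalgebra `l_sew = {((ξ, η), (η, ξ))}`. -/
def sewAlg : LieSubalgebra ℝ (G.cartan.prod G.cartan).d where
  carrier := {x | x.2.1 = x.1.2 ∧ x.2.2 = x.1.1}
  add_mem' := by
    rintro ⟨⟨a, b⟩, ⟨c, e⟩⟩ ⟨⟨a', b'⟩, ⟨c', e'⟩⟩ ⟨h1, h2⟩ ⟨h3, h4⟩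
    exact ⟨congrArg₂ (fun x y : G.quad => x + y) h1 h3, congrArg₂ (fun x y : G.quad => x + y) h2 h4⟩
  zero_mem' := ⟨rfl, rfl⟩
  smul_mem' := by
    rintro r ⟨⟨a, b⟩, ⟨c, e⟩⟩ ⟨h1, h2⟩
    exact ⟨congrArg (fun x : G.quad => r • x) h1, congrArg (fun x : G.quad => r • x) h2⟩
  lie_mem' := by
    rintro ⟨⟨a, b⟩, ⟨c, e⟩⟩ ⟨⟨a', b'⟩, ⟨c', e'⟩⟩ ⟨h1, h2⟩ ⟨h3, h4⟩
    exact ⟨congrArg₂ (fun x y : G.quad => ⁅x, y⁆) h1 h3,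
      congrArg₂ (fun x y : G.quad => ⁅x, y⁆) h2 h4⟩

/-- The sewing submanifold `{(g, g⁻¹)} ⊆ G × G`. -/
def sewSet : Set (G.cartan.prod G.cartan).N := 
  {x : G.mfd × G.mfd | x.2 = x.1⁻¹}

end MetricLieGroup

end

/-!
The reduction of a morphism of Manin pairs `R` by `(c₁, S₁)` and then by the data induced by
`(c₂, S₂)` is a quotient of the same objects as its reduction by `(c₁ ∩ c₂, S₁ ∩ S₂)`. Write
`c = c₁ ∩ c₂` and `P = S₁ ∩ S₂`. The structure `QHam.IsNested` records what is used of the second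
pair: these two equations, and that `P` is a union of `c₁^⊥`-orbits in `S₁`.

* Since `c₁^⊥ ⊆ c^⊥ ⊆ c`, the preimages in `c₁` of `c₂₁ = R_{c₁} ∘ c₂` and of `c₂₁^⊥` are `c` and
  `c^⊥`. So `(d_{c₁})_{c₂₁}` is `c / c^⊥`.
* The set `S₂₁ ⊆ N_{c₁,S₁}` is the image of the saturated submanifold `P`, and the `c^⊥`-orbits in
  `P` are the preimages of the `c₂₁^⊥`-orbits in `S₂₁` (`IsNested.qN_eq_iff`). So the two quotient
  maps on `P` are surjective submersions with the same fibres. The same holds on `M`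
  (`IsNested.qM_eq_iff`).
* On the level of relations the chain rule takes care of the vectors. A covector which on
  `T(μ⁻¹(P))` is pulled back from `M_{c,P}` is on `T(μ⁻¹(S₁))` pulled back from `M_{c₁,S₁}`, since
  the kernel of the differential of `μ⁻¹(S₁) → M_{c₁,S₁}` is tangent to `μ⁻¹(P)`
  (`IsNested.rel_iff`).

The comparison of orbits rests on facts about `R` itself. Involutivity, applied to multiples
`f • e` of sections by functions vanishing on the graph of `μ`, together with the condition that
`v ∼_R 0` only for `v = 0`, shows that `R` is compatible with the anchors
(`QHam.IsQuasiHamiltonian.mfderiv_eq`). As `R` is Lagrangian, every element of `h` generates a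
unique vector field on `M`, which is `C¹` (in fact smooth) and thus has integral curves inside the
submanifolds that it is tangent to. If `v + α ∼_R ξ` where `α` annihilates `T(μ⁻¹(S₁))`, then `α`
is `dμ^* β` with `β ∈ ann(TS₁)`, and `v ∼_R ξ - ρ^* β` with `ρ^* β ∈ c₁^⊥`
(`QHam.IsQuasiHamiltonian.exists_rel_of_annihilates`): the vector fields of the reduction come
from vector fields generated by `h` upstairs. The induced action on `N_{c₁,S₁}` is well defined
because `[c₁^⊥, c₁] ⊆ c₁^⊥`, so that the images of the vector fields of `c₁` do not change along
the flows of `c₁^⊥` (`isDiff_iff_of_flow`).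

Submanifolds are handled as local smooth retracts (`IsSubmanifold.exists_retraction` and
`isSubmanifold_of_exists_retraction`), and surjective submersions through local sections
(`exists_local_sections`). This gives that the image of a saturated submanifold is a submanifold,
and that maps descend smoothly.

For reductions in distinct factors, `(c ⊕ d' ⊕ d'')^⊥ = c^⊥ ⊕ 0 ⊕ 0`, and its flows do not move
the component in `N'`. So the reductions are nested, and the induced data are reductive with the
quotient manifolds of the one-step reduction (`IsNested.inducedReductive`). The sewings are a
special case.
-/

noncomputable section

open Mfd

/-! ### Tangent sets, local retractions and slices -/

namespace Mfd

variable {N Q M : Mfd.{u}}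

theorem tangentMap_congr_of_eventuallyEq {E H X E' H' X' : Type*} [NormedAddCommGroup E]
    [NormedSpace ℝ E] [TopologicalSpace H] {I : ModelWithCorners ℝ E H} [TopologicalSpace X]
    [ChartedSpace H X] [NormedAddCommGroup E']
    [NormedSpace ℝ E'] [TopologicalSpace H'] {I' : ModelWithCorners ℝ E' H'} [TopologicalSpace X']
    [ChartedSpace H' X'] {f g : X → X'} {p : TangentBundle I X} (h : f =ᶠ[𝓝 p.1] g) :
    tangentMap I I' f p = tangentMap I I' g p := by
  have h1 : f p.1 = g p.1 := h.self_of_nhds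
  have h2 := h.mfderiv_eq (I := I) (I' := I')
  unfold tangentMap
  rw [h2]
  congr 1

theorem contMDiffAt_extChartAt_symm_self (x : N) :
    ContMDiffAt 𝓘(ℝ, N.E) N.I ∞ (extChartAt N.I x).symm (extChartAt N.I x x) :=
  (contMDiffOn_extChartAt_symm x).contMDiffAt (extChartAt_target_mem_nhds x)

/-- Every tangent vector is the velocity of a smooth curve. -/
theorem exists_curve (p : TangentBundle N.I N) : ∃ γ : ℝ → N, ContMDiffAt 𝓘(ℝ, ℝ) N.I ∞ γ 0 ∧
    tangentMap 𝓘(ℝ, ℝ) N.I γ ⟨0, (1 : ℝ)⟩ = p := by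
  set e := extChartAt N.I p.1 with he
  set w : N.E := mfderiv N.I 𝓘(ℝ, N.E) e p.1 p.2 with hw
  set l : ℝ → N.E := fun t => e p.1 + t • w with hl
  have hl0 : l 0 = e p.1 := by simp [hl]
  have hls : ContMDiffAt 𝓘(ℝ, ℝ) 𝓘(ℝ, N.E) ∞ l 0 := by
    apply ContDiffAt.contMDiffAt
    fun_prop
  have hes : ContMDiffAt 𝓘(ℝ, N.E) N.I ∞ e.symm (l 0) := by
    rw [hl0]; exact contMDiffAt_extChartAt_symm_self p.1
  have hec : ContMDiffAt N.I 𝓘(ℝ, N.E) ∞ e p.1 := contMDiffAt_extChartAt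
  refine ⟨e.symm ∘ l, hes.comp _ hls, ?_⟩
  rw [tangentMap_comp_at (I' := 𝓘(ℝ, N.E)) _ (hes.mdifferentiableAt (by simp))
    (hls.mdifferentiableAt (by simp))]
  have h1 : tangentMap 𝓘(ℝ, ℝ) 𝓘(ℝ, N.E) l ⟨0, (1 : ℝ)⟩ = tangentMap N.I 𝓘(ℝ, N.E) e p := by
    have hd : HasDerivAt l w 0 := by
      have := ((hasDerivAt_id (0 : ℝ)).smul_const w).const_add (e p.1)
      rwa [one_smul] at this
    have : mfderiv 𝓘(ℝ, ℝ) 𝓘(ℝ, N.E) l 0 (1 : ℝ) = w := by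
      rw [mfderiv_eq_fderiv]
      exact hd.deriv
    unfold tangentMap
    rw [this]
    change (⟨l 0, w⟩ : TangentBundle 𝓘(ℝ, N.E) N.E) = ⟨e p.1, w⟩
    rw [hl0]
  rw [h1, ← tangentMap_comp_at (I' := 𝓘(ℝ, N.E)) _
    ((contMDiffAt_extChartAt_symm_self p.1).mdifferentiableAt (by simp))
    (hec.mdifferentiableAt (by simp))]
  rw [tangentMap_congr_of_eventuallyEq (g := id)]
  · rw [tangentMap_id]; rfl
  · filter_upwards [extChartAt_source_mem_nhds (I := N.I) p.1] with y hy
    exact e.left_inv hy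

/-- Smooth maps carrying `S` into `S'` near `p` carry `TS` into `TS'`. -/
theorem tangentMap_mem_tangentSet {S : Set N} {S' : Set Q} {g : N → Q} {p : TangentBundle N.I N}
    (hp : p ∈ tangentSet S) (hg : ContMDiffAt N.I Q.I ∞ g p.1)
    (h : ∀ᶠ y in 𝓝 p.1, y ∈ S → g y ∈ S') : tangentMap N.I Q.I g p ∈ tangentSet S' := by
  obtain ⟨γ, hγ, hS, rfl⟩ := hp
  refine ⟨g ∘ γ, ContMDiffAt.comp (0 : ℝ) hg hγ, ?_, ?_⟩
  · have hc : Filter.Tendsto γ (𝓝 0) (𝓝 (γ 0)) := hγ.continuousAt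
    filter_upwards [hS, hc.eventually h] with t h1 h2 using h2 h1
  · exact tangentMap_comp_at _ (hg.mdifferentiableAt (by simp)) (hγ.mdifferentiableAt (by simp))

theorem tangentSet_mono {S S' : Set N} (h : S ⊆ S') : tangentSet S ⊆ tangentSet S' := by
  rintro p ⟨γ, hγ, hS, rfl⟩
  exact ⟨γ, hγ, hS.mono fun t ht => h ht, rfl⟩

theorem mem_of_mem_tangentSet {S : Set N} {p : TangentBundle N.I N} (hp : p ∈ tangentSet S) :
    p.1 ∈ S := by
  obtain ⟨γ, hγ, hS, rfl⟩ := hp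
  exact hS.self_of_nhds

/-- The differentials of two maps agreeing on `S` agree on `TS`. -/
theorem tangentMap_eq_of_eqOn {E H X : Type*} [NormedAddCommGroup E]
    [NormedSpace ℝ E] [TopologicalSpace H] {I : ModelWithCorners ℝ E H} [TopologicalSpace X]
    [ChartedSpace H X] {S : Set N} {f g : N → X} {p : TangentBundle N.I N}
    (hp : p ∈ tangentSet S) (hf : MDifferentiableAt N.I I f p.1)
    (hg : MDifferentiableAt N.I I g p.1) (h : ∀ᶠ y in 𝓝 p.1, y ∈ S → f y = g y) :
    tangentMap N.I I f p = tangentMap N.I I g p := by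
  obtain ⟨γ, hγ, hS, rfl⟩ := hp
  have hγ' := hγ.mdifferentiableAt (by simp)
  rw [← tangentMap_comp_at _ hf hγ', ← tangentMap_comp_at _ hg hγ']
  apply tangentMap_congr_of_eventuallyEq
  have hc : Filter.Tendsto γ (𝓝 0) (𝓝 (γ 0)) := hγ.continuousAt
  filter_upwards [hS, hc.eventually h] with t h1 h2 using h2 h1

/-- `f` is smooth near `x`. For smoothness of class `C^∞`, being smooth at the points near `x` is
more than `ContMDiffAt` at `x`. -/
abbrev SmoothNear {E H X E' H' X' : Type*} [NormedAddCommGroup E]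
    [NormedSpace ℝ E] [TopologicalSpace H] (I : ModelWithCorners ℝ E H) [TopologicalSpace X]
    [ChartedSpace H X] [NormedAddCommGroup E']
    [NormedSpace ℝ E'] [TopologicalSpace H'] (I' : ModelWithCorners ℝ E' H') [TopologicalSpace X']
    [ChartedSpace H' X'] (f : X → X') (x : X) : Prop :=
  ∀ᶠ y in 𝓝 x, ContMDiffAt I I' ∞ f y

section SmoothNear

variable {E H X E' H' X' E'' H'' X'' : Type*} [NormedAddCommGroup E]
    [NormedSpace ℝ E] [TopologicalSpace H] {I : ModelWithCorners ℝ E H} [TopologicalSpace X]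
    [ChartedSpace H X] [NormedAddCommGroup E']
    [NormedSpace ℝ E'] [TopologicalSpace H'] {I' : ModelWithCorners ℝ E' H'} [TopologicalSpace X']
    [ChartedSpace H' X'] [NormedAddCommGroup E'']
    [NormedSpace ℝ E''] [TopologicalSpace H''] {I'' : ModelWithCorners ℝ E'' H''}
    [TopologicalSpace X''] [ChartedSpace H'' X'']

theorem SmoothNear.at {f : X → X'} {x : X} (h : SmoothNear I I' f x) : ContMDiffAt I I' ∞ f x :=
  h.self_of_nhds

theorem SmoothNear.tendsto {f : X → X'} {x : X} (h : SmoothNear I I' f x) :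
    Filter.Tendsto f (𝓝 x) (𝓝 (f x)) := h.at.continuousAt

theorem SmoothNear.mdiff {f : X → X'} {x : X} (h : SmoothNear I I' f x) :
    MDifferentiableAt I I' f x := h.at.mdifferentiableAt (by simp)

theorem SmoothNear.comp {g : X' → X''} {f : X → X'} {x : X} (hg : SmoothNear I' I'' g (f x))
    (hf : SmoothNear I I' f x) : SmoothNear I I'' (g ∘ f) x := by
  filter_upwards [hf, hf.tendsto.eventually hg] with y h1 h2
  exact ContMDiffAt.comp y h2 h1

theorem SmoothNear.comp_of_eq {g : X' → X''} {f : X → X'} {x : X} {y : X'}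
    (hg : SmoothNear I' I'' g y) (hf : SmoothNear I I' f x) (hy : f x = y) :
    SmoothNear I I'' (g ∘ f) x := by
  subst hy; exact hg.comp hf

theorem smoothNear_of_contMDiff {f : X → X'} (h : ContMDiff I I' ∞ f) (x : X) :
    SmoothNear I I' f x := Filter.Eventually.of_forall h

end SmoothNear

theorem smoothNear_extChartAt (x : N) : SmoothNear N.I 𝓘(ℝ, N.E) (extChartAt N.I x) x := by
  filter_upwards [chart_source_mem_nhds N.H x] with y hy
  exact contMDiffAt_extChartAt' hy

theorem smoothNear_extChartAt_symm (x : N) :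
    SmoothNear 𝓘(ℝ, N.E) N.I (extChartAt N.I x).symm (extChartAt N.I x x) := by
  filter_upwards [extChartAt_target_mem_nhds (I := N.I) x] with y hy
  exact (contMDiffOn_extChartAt_symm x).contMDiffAt
    ((isOpen_extChartAt_target (I := N.I) x).mem_nhds hy)

/-- `r` is a smooth retraction of a neighbourhood of `x` in `N` onto `S`. -/
structure IsLocalRetraction (S : Set N) (x : N) (r : N → N) : Prop where
  smooth : SmoothNear N.I N.I r x
  mem : ∀ᶠ y in 𝓝 x, r y ∈ S
  eq : ∀ᶠ y in 𝓝 x, y ∈ S → r y = y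

theorem IsLocalRetraction.apply_self {S : Set N} {x : N} {r : N → N} (hr : IsLocalRetraction S x r)
    (hx : x ∈ S) : r x = x := hr.eq.self_of_nhds hx

/-- The tangent set of a local retract consists of the vectors fixed by the differential of the
retraction. -/
theorem mem_tangentSet_iff {S : Set N} {r : N → N} {p : TangentBundle N.I N}
    (hr : IsLocalRetraction S p.1 r) : p ∈ tangentSet S ↔ tangentMap N.I N.I r p = p := by
  constructor
  · intro hp
    rw [tangentMap_eq_of_eqOn (g := id) hp hr.smooth.mdiff
      mdifferentiableAt_id hr.eq, tangentMap_id]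
    rfl
  · intro hp
    obtain ⟨γ, hγ, rfl⟩ := exists_curve p
    have h := tangentMap_mem_tangentSet (S := Set.univ) (S' := S) (g := r)
      ⟨γ, hγ, by simp, rfl⟩ hr.smooth.at (hr.mem.mono fun y h _ => h)
    rwa [hp] at h

theorem mem_tangentSet_iff_mfderiv {S : Set N} {x : N} {r : N → N}
    (hr : IsLocalRetraction S x r) (hx : x ∈ S) (v : TangentSpace N.I x) :
    (⟨x, v⟩ : TangentBundle N.I N) ∈ tangentSet S ↔ (mfderiv N.I N.I r x v : N.E) = v := by
  rw [mem_tangentSet_iff (p := ⟨x, v⟩) hr]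
  unfold tangentMap
  rw [Bundle.TotalSpace.mk.injEq]
  constructor
  · rintro ⟨h1, h2⟩
    exact eq_of_heq h2
  · intro h
    exact ⟨hr.apply_self hx, heq_of_eq h⟩

/-- Near each of its points a submanifold is an affine subspace in suitable coordinates `e`, with
inverse `e'`. -/
theorem IsSubmanifold.exists_slice {S : Set N} (hS : IsSubmanifold S) {x : N} (hx : x ∈ S) :
    ∃ (e : N → N.E) (e' : N.E → N) (F : Submodule ℝ N.E), SmoothNear N.I 𝓘(ℝ, N.E) e x ∧
      SmoothNear 𝓘(ℝ, N.E) N.I e' (e x) ∧ (∀ᶠ y in 𝓝 x, e' (e y) = y) ∧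
      (∀ᶠ u in 𝓝 (e x), e (e' u) = u) ∧ ∀ᶠ y in 𝓝 x, (y ∈ S ↔ e y - e x ∈ F) := by
  obtain ⟨φ, hφ, hxφ, F, hF⟩ := hS x hx
  have hsrc : ∀ᶠ y in 𝓝 x, y ∈ φ.source := φ.open_source.mem_nhds hxφ
  have hop : IsOpen (φ.extend N.I).target := φ.isOpen_extend_target
  have htar : (φ.extend N.I).target ∈ 𝓝 (φ.extend N.I x) :=
    hop.mem_nhds ((φ.extend N.I).map_source (by rw [φ.extend_source]; exact hxφ))
  refine ⟨φ.extend N.I, (φ.extend N.I).symm, F, ?_, ?_, ?_, ?_, ?_⟩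
  · filter_upwards [hsrc] with y hy
    exact φ.contMDiffAt_extend hφ hy
  · filter_upwards [htar] with y hy
    refine (contMDiffOn_extend_symm hφ).contMDiffAt ?_
    rw [← φ.extend_target']
    exact hop.mem_nhds hy
  · filter_upwards [hsrc] with y hy
    exact (φ.extend N.I).left_inv (by rw [φ.extend_source]; exact hy)
  · filter_upwards [htar] with u hu using (φ.extend N.I).right_inv hu
  · filter_upwards [hsrc] with y hy using hF y hy

/-- A submanifold is locally a smooth retract. -/
theorem IsSubmanifold.exists_retraction {S : Set N} (hS : IsSubmanifold S) {x : N} (hx : x ∈ S) :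
    ∃ r, IsLocalRetraction S x r := by
  obtain ⟨e, e', F, he, he', hee, hee', hF⟩ := hS.exists_slice hx
  obtain ⟨G, hG⟩ := F.exists_isCompl
  let P : N.E →L[ℝ] N.E := LinearMap.toContinuousLinearMap (F.projection G hG)
  have hPF : ∀ v, P v ∈ F := fun v => by
    simp [P]
  have hPid : ∀ v ∈ F, P v = v := fun v hv => (Submodule.projection_eq_self_iff hG v).2 hv
  let k : N → N.E := fun y => e x + P (e y - e x)
  have hk : SmoothNear N.I 𝓘(ℝ, N.E) k x := by
    have h1 : SmoothNear 𝓘(ℝ, N.E) 𝓘(ℝ, N.E) (fun z : N.E => e x + P (z - e x)) (e x) := by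
      refine Filter.Eventually.of_forall fun z => ContDiffAt.contMDiffAt ?_
      fun_prop
    exact h1.comp he
  have hkx : k x = e x := by simp [k]
  have hr : SmoothNear N.I N.I (e' ∘ k) x := he'.comp_of_eq hk hkx
  have hrx : (e' ∘ k) x = x := by rw [Function.comp_apply, hkx, hee.self_of_nhds]
  have hrT : Filter.Tendsto (e' ∘ k) (𝓝 x) (𝓝 x) := by
    have := hr.tendsto; rwa [hrx] at this
  have hkT : Filter.Tendsto k (𝓝 x) (𝓝 (e x)) := by
    have := hk.tendsto; rwa [hkx] at this
  refine ⟨e' ∘ k, hr, ?_, ?_⟩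
  · filter_upwards [hrT.eventually hF, hkT.eventually hee'] with y h1 h2
    refine h1.2 ?_
    rw [Function.comp_apply, h2]
    simp only [k, add_sub_cancel_left]
    exact hPF _
  · filter_upwards [hF, hee] with y h1 h2 hyS
    have : k y = e y := by
      simp only [k]; rw [hPid _ (h1.1 hyS)]; abel
    rw [Function.comp_apply, this, h2]

/-- The inverse function theorem, with smoothness on the domains. -/
theorem exists_openPartialHomeomorph {E E' : Type*} [NormedAddCommGroup E] [NormedSpace ℝ E]
    [NormedAddCommGroup E'] [NormedSpace ℝ E'] [CompleteSpace E] {f : E → E'} {a : E}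
    (hf : ∀ᶠ y in 𝓝 a, ContDiffAt ℝ ∞ f y) {f' : E ≃L[ℝ] E'}
    (h' : HasFDerivAt f (f' : E →L[ℝ] E') a) {W : Set E} (hW : ∀ᶠ y in 𝓝 a, y ∈ W) :
    ∃ Θ : OpenPartialHomeomorph E E', a ∈ Θ.source ∧ Θ.source ⊆ W ∧ (∀ y, Θ y = f y) ∧
      (∀ y ∈ Θ.source, ContDiffAt ℝ ∞ f y) ∧ ∀ y ∈ Θ.target, ContDiffAt ℝ ∞ Θ.symm y := by
  have ha := hf.self_of_nhds
  let Θ₀ := ha.toOpenPartialHomeomorph f h' (by simp)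
  have hΘ₀ : ∀ y, Θ₀ y = f y := fun y => rfl
  have h1 : ∀ᶠ y in 𝓝 a, ∃ g : E ≃L[ℝ] E', (g : E →L[ℝ] E') = fderiv ℝ f y := by
    have hc : ContinuousAt (fderiv ℝ f) a := (ha.fderiv_right (m := 0) (by simp)).continuousAt
    have h2 := ContinuousLinearEquiv.nhds f'
    rw [← h'.fderiv] at h2
    exact hc.tendsto h2
  obtain ⟨U, hU, hUo, haU⟩ := mem_nhds_iff.1 ((hf.and h1).and hW)
  refine ⟨Θ₀.restrOpen U hUo, ?_, ?_, hΘ₀, ?_, ?_⟩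
  · rw [Θ₀.restrOpen_source]
    exact ⟨ha.mem_toOpenPartialHomeomorph_source h' (by simp), haU⟩
  · intro y hy
    rw [Θ₀.restrOpen_source] at hy
    exact (hU hy.2).2
  · intro y hy
    rw [Θ₀.restrOpen_source] at hy
    exact (hU hy.2).1.1
  · intro y hy
    have hy' : (Θ₀.restrOpen U hUo).symm y ∈ (Θ₀.restrOpen U hUo).source :=
      (Θ₀.restrOpen U hUo).map_target hy
    rw [Θ₀.restrOpen_source] at hy'
    obtain ⟨⟨h3, g, hg⟩, -⟩ := hU hy'.2
    refine (Θ₀.restrOpen U hUo).contDiffAt_symm hy (f₀' := g) ?_ h3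
    rw [hg]
    exact (h3.differentiableAt (by simp)).hasFDerivAt

end Mfd

/-! ### Submanifolds as local retracts, and local sections of submersions -/

namespace Mfd

variable {N Q M : Mfd.{u}}

/-- A set which is locally a smooth retract is a submanifold. In a chart centred at a point of the
set the map `y ↦ Dr (r y) + (1 - Dr) (y - r y)` has derivative `1` and straightens the set. -/
theorem isSubmanifold_of_exists_retraction {S : Set N}
    (h : ∀ x ∈ S, ∃ r, IsLocalRetraction S x r) : IsSubmanifold S := by
  intro x hx
  obtain ⟨r, hr⟩ := h x hx
  have hrx := hr.apply_self hx
  set e := extChartAt N.I x with he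
  set a := e x with ha
  have hea : e.symm a = x := e.left_inv (mem_extChartAt_source x)
  let k : N.E → N.E := e ∘ r ∘ e.symm
  have hka : k a = a := by
    change e (r (e.symm a)) = a
    rw [hea, hrx]
  have hes := smoothNear_extChartAt x
  have hes' := smoothNear_extChartAt_symm x
  have hk : SmoothNear 𝓘(ℝ, N.E) 𝓘(ℝ, N.E) k a :=
    hes.comp_of_eq (hr.smooth.comp_of_eq hes' hea) (by
      change r (e.symm a) = x
      rw [hea, hrx])
  have hk' : ∀ᶠ y in 𝓝 a, ContDiffAt ℝ ∞ k y := hk.mono fun y hy => hy.contDiffAt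
  -- properties near `x`, transported to the chart
  have hT : Filter.Tendsto e.symm (𝓝 a) (𝓝 x) := by
    have := hes'.tendsto; rwa [← he, ← ha, hea] at this
  have hsrc : ∀ᶠ y in 𝓝 x, y ∈ e.source := extChartAt_source_mem_nhds (I := N.I) x
  have hrT : Filter.Tendsto r (𝓝 x) (𝓝 x) := by
    have := hr.smooth.tendsto; rwa [hrx] at this
  -- `k` is `r` in the chart; it is idempotent near `a`, and so is its derivative `D` at `a`
  have hkk : ∀ᶠ u in 𝓝 a, k (k u) = k u := by
    filter_upwards [hT.eventually hr.mem, hT.eventually (hrT.eventually hr.eq),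
      hT.eventually (hrT.eventually hsrc)] with u h1 h2 h3
    simp only [k, Function.comp_apply]
    rw [e.left_inv h3, h2 h1]
  set D := fderiv ℝ k a with hD
  have hkd : HasFDerivAt k D a := (hk'.self_of_nhds.differentiableAt (by simp)).hasFDerivAt
  have hDD : D.comp D = D := by
    have h1 : HasFDerivAt (k ∘ k) (D.comp D) a :=
      HasFDerivAt.comp a (by rw [hka]; exact hkd) hkd
    have h2 : HasFDerivAt (k ∘ k) D a := hkd.congr_of_eventuallyEq hkk
    exact h1.unique h2
  have hDD' : ∀ v, D (D v) = D v := fun v => congrArg (fun A : N.E →L[ℝ] N.E => A v) hDD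
  let f : N.E → N.E := fun u => D (k u - a) + ((u - k u) - D (u - k u))
  have hf : ∀ᶠ y in 𝓝 a, ContDiffAt ℝ ∞ f y := by
    filter_upwards [hk'] with y hy
    have h1 : ContDiffAt ℝ ∞ (fun u => k u - a) y := hy.sub contDiffAt_const
    have h2 : ContDiffAt ℝ ∞ (fun u => u - k u) y := contDiffAt_id.sub hy
    exact (D.contDiff.contDiffAt.comp y h1).add (h2.sub (D.contDiff.contDiffAt.comp y h2))
  have hf' : HasFDerivAt f
      ((ContinuousLinearEquiv.refl ℝ N.E : N.E ≃L[ℝ] N.E) : N.E →L[ℝ] N.E) a := by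
    have h1 : HasFDerivAt (fun u => k u - a) D a := hkd.sub_const a
    have h2 : HasFDerivAt (fun u => u - k u) (ContinuousLinearMap.id ℝ N.E - D) a :=
      (hasFDerivAt_id a).sub hkd
    have h3 := (D.hasFDerivAt.comp a h1).add (h2.sub (D.hasFDerivAt.comp a h2))
    refine h3.congr_fderiv ?_
    ext v
    simp [hDD']
  have hcond : ∀ᶠ u in 𝓝 a, (e.symm u ∈ S → r (e.symm u) = e.symm u) ∧
      r (e.symm u) ∈ S ∧ r (e.symm u) ∈ e.source ∧ k (k u) = k u ∧ u ∈ e.target := by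
    filter_upwards [hT.eventually hr.eq, hT.eventually hr.mem, hT.eventually (hrT.eventually hsrc),
      hkk, extChartAt_target_mem_nhds (I := N.I) x] with u h1 h2 h3 h4 h5
    exact ⟨h1, h2, h3, h4, h5⟩
  obtain ⟨Θ₀, h₀a, -, h₀f, -, -⟩ := exists_openPartialHomeomorph hf hf' (W := Set.univ) (by simp)
  have hkT : Filter.Tendsto k (𝓝 a) (𝓝 a) := by
    have := hk.tendsto; rwa [hka] at this
  have hinj : ∀ᶠ u in 𝓝 a, u ∈ Θ₀.source ∧ k u ∈ Θ₀.source :=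
    (show ∀ᶠ u in 𝓝 a, u ∈ Θ₀.source from Θ₀.open_source.mem_nhds h₀a).and
      (hkT.eventually (Θ₀.open_source.mem_nhds h₀a))
  obtain ⟨Θ, haΘ, hΘW, hΘf, hΘs, hΘs'⟩ := exists_openPartialHomeomorph hf hf' (hcond.and hinj)
  let J : OpenPartialHomeomorph N.H N.E := N.I.toHomeomorph.toOpenPartialHomeomorph
  let g : OpenPartialHomeomorph N.H N.H := (J.trans Θ).trans J.symm
  have hg : g ∈ contDiffGroupoid ∞ N.I := by
    rw [contDiffGroupoid, mem_groupoid_of_pregroupoid]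
    constructor
    · rintro y ⟨hy, -⟩
      have hy' : y ∈ Θ.source := by
        have : N.I (N.I.symm y) ∈ Θ.source := by simpa [g, J] using hy
        rwa [N.I.right_inv (by simp [N.I.range_eq_univ])] at this
      refine ((hΘs y hy').congr_of_eventuallyEq ?_).contDiffWithinAt
      filter_upwards with z
      change N.I (N.I.symm (Θ (N.I (N.I.symm z)))) = f z
      rw [N.I.right_inv (by simp [N.I.range_eq_univ]), N.I.right_inv (by simp [N.I.range_eq_univ]),
        hΘf]
    · rintro y ⟨hy, -⟩
      have hy' : y ∈ Θ.target := by
        have : N.I (N.I.symm y) ∈ Θ.target := by simpa [g, J] using hy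
        rwa [N.I.right_inv (by simp [N.I.range_eq_univ])] at this
      refine ((hΘs' y hy').congr_of_eventuallyEq ?_).contDiffWithinAt
      filter_upwards with z
      change N.I (N.I.symm (Θ.symm (N.I (N.I.symm z)))) = Θ.symm z
      rw [N.I.right_inv (by simp [N.I.range_eq_univ]), N.I.right_inv (by simp [N.I.range_eq_univ])]
  let φ : OpenPartialHomeomorph N N.H := (chartAt N.H x).trans g
  have hφ : φ ∈ IsManifold.maximalAtlas N.I ∞ N := by
    refine mem_maximalAtlas_iff.2 fun e' he' => ?_
    have h1 : (chartAt N.H x).symm.trans e' ∈ contDiffGroupoid ∞ N.I :=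
      HasGroupoid.compatible (chart_mem_atlas N.H x) he'
    have h2 : e'.symm.trans (chartAt N.H x) ∈ contDiffGroupoid ∞ N.I :=
      HasGroupoid.compatible he' (chart_mem_atlas N.H x)
    constructor
    · have := (contDiffGroupoid ∞ N.I).trans ((contDiffGroupoid ∞ N.I).symm hg) h1
      simpa only [φ, OpenPartialHomeomorph.trans_symm_eq_symm_trans_symm,
        OpenPartialHomeomorph.trans_assoc] using this
    · have := (contDiffGroupoid ∞ N.I).trans h2 hg
      simpa only [φ, OpenPartialHomeomorph.trans_assoc] using this
  have hφext : ∀ y, φ.extend N.I y = f (e y) := by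
    intro y
    change N.I (N.I.symm (Θ (N.I (chartAt N.H x y)))) = f (N.I (chartAt N.H x y))
    rw [N.I.right_inv (by simp [N.I.range_eq_univ]), hΘf]
  have hφsrc : ∀ y, y ∈ φ.source ↔ y ∈ e.source ∧ e y ∈ Θ.source := by
    intro y
    simp [φ, g, J, he]
  have hfa : f a = 0 := by simp [f, hka]
  refine ⟨φ, hφ, (hφsrc x).2 ⟨mem_extChartAt_source x, haΘ⟩, D.range, fun y hy => ?_⟩
  rw [hφext, hφext, ← ha, hfa, sub_zero]
  obtain ⟨hy1, hy2⟩ := (hφsrc y).1 hy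
  obtain ⟨⟨h1, h2, h3, h4, h5⟩, h6, h7⟩ := hΘW hy2
  rw [e.left_inv hy1] at h1 h2 h3
  have hky : k (e y) = e (r y) := by simp only [k, Function.comp_apply, e.left_inv hy1]
  constructor
  · intro hyS
    refine ⟨k (e y) - a, ?_⟩
    have : k (e y) = e y := by rw [hky, h1 hyS]
    simp [f, this]
  · rintro ⟨w, hw⟩
    set u := e y
    -- if `f u` lies in the range of `D`, then its component in the kernel of `D` vanishes; hence
    -- `f (k u) = f u`, and `u = k u` by injectivity
    have hz : u - k u - D (u - k u) = 0 := by
      have h8 : u - k u - D (u - k u) = D (w - (k u - a)) := by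
        change D w = f u at hw
        rw [map_sub D w, hw]; simp only [f]; abel
      have h9 := congrArg D h8
      rw [hDD', map_sub, hDD', sub_self] at h9
      rw [h8, ← h9]
    have h10 : f (k u) = f u := by
      simp only [f]
      rw [hz, h4]; simp
    have h11 : k u = u := Θ₀.injOn h7 h6 (by rw [h₀f, h₀f, h10])
    have h12 : r y = y := e.injOn h3 hy1 (by rw [← hky]; exact h11)
    rw [← h12]; exact h2

/-- On `TS` the differential can be computed with any local smooth extension. -/
theorem IsDiff.tangentMap_eq {S : Set N} {q : S → Q} {p : TangentBundle N.I N}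
    {r : TangentBundle Q.I Q} (hp : p ∈ tangentSet S) (h : IsDiff S q p r) {hS : p.1 ∈ S}
    {f : N → Q}
    (hf : IsLocalExt S q ⟨p.1, hS⟩ f) : tangentMap N.I Q.I f p = r := by
  obtain ⟨_, g, hg, rfl⟩ := h
  refine tangentMap_eq_of_eqOn hp (hf.1.mdifferentiableAt (by simp))
    (hg.1.mdifferentiableAt (by simp)) ?_
  filter_upwards [hf.2, hg.2] with y h1 h2 hy
  rw [h1 hy, h2 hy]

theorem IsLocalExt.isDiff {S : Set N} {q : S → Q} {p : TangentBundle N.I N} {hS : p.1 ∈ S}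
    {f : N → Q} (hf : IsLocalExt S q ⟨p.1, hS⟩ f) : IsDiff S q p (tangentMap N.I Q.I f p) :=
  ⟨hS, f, hf, rfl⟩

theorem IsDiff.unique {S : Set N} {q : S → Q} {p : TangentBundle N.I N}
    {r r' : TangentBundle Q.I Q} (hp : p ∈ tangentSet S) (h : IsDiff S q p r)
    (h' : IsDiff S q p r') : r = r' := by
  obtain ⟨hS, f, hf, rfl⟩ := h
  exact (h'.tangentMap_eq hp hf).symm ▸ rfl

theorem SmoothOnSub.exists_isDiff {S : Set N} {q : S → Q} (hq : SmoothOnSub S q)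
    {p : TangentBundle N.I N} (hp : p.1 ∈ S) : ∃ r, IsDiff S q p r := by
  obtain ⟨f, hf⟩ := hq ⟨p.1, hp⟩
  exact ⟨_, hf.isDiff⟩

theorem IsDiff.proj_eq {S : Set N} {q : S → Q} {p : TangentBundle N.I N}
    {r : TangentBundle Q.I Q} (h : IsDiff S q p r) : ∃ hS : p.1 ∈ S, q ⟨p.1, hS⟩ = r.1 := by
  obtain ⟨hS, f, hf, rfl⟩ := h
  exact ⟨hS, (hf.2.self_of_nhds hS).symm⟩

/-- On a submanifold, a local smooth extension can be chosen smooth near the point, by composing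
with a retraction. -/
theorem SmoothOnSub.exists_smoothNear {S : Set N} (hS : IsSubmanifold S) {q : S → Q}
    (hq : SmoothOnSub S q) (x : S) : ∃ f : N → Q, IsLocalExt S q x f ∧ SmoothNear N.I Q.I f x := by
  obtain ⟨r, hr⟩ := hS.exists_retraction x.2
  obtain ⟨f, hf⟩ := hq x
  have hrx := hr.apply_self x.2
  have hrT : Filter.Tendsto r (𝓝 (x : N)) (𝓝 (x : N)) := by
    have := hr.smooth.tendsto; rwa [hrx] at this
  have hsm : SmoothNear N.I Q.I (f ∘ r) x := by
    filter_upwards [hr.smooth, hr.mem.eventually_nhds, (hrT.eventually hf.2).eventually_nhds]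
      with y h1 h2 h3
    obtain ⟨g, hg⟩ := hq ⟨r y, h2.self_of_nhds⟩
    refine (ContMDiffAt.comp y hg.1 h1).congr_of_eventuallyEq ?_
    filter_upwards [h2, h3, h1.continuousAt.eventually hg.2] with z h4 h5 h6
    simp only [Function.comp_apply]
    rw [h5 h4, h6 h4]
  refine ⟨f ∘ r, ⟨hsm.at, ?_⟩, hsm⟩
  filter_upwards [hf.2, hr.eq] with y h1 h2 hy
  rw [Function.comp_apply, h2 hy, h1 hy]

/-- A surjective submersion `q : S → Q` has local sections through all points of `S`, depending
smoothly on the point. -/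
theorem exists_local_sections {S : Set N} (hS : IsSubmanifold S) {q : S → Q}
    (hq : SmoothOnSub S q) (x : S)
    (hsub : ∀ w : TangentSpace Q.I (q x), ∃ v : TangentSpace N.I (x : N),
      (⟨x, v⟩ : TangentBundle N.I N) ∈ tangentSet S ∧ IsDiff S q ⟨x, v⟩ ⟨q x, w⟩) :
    ∃ σ : Q × N → N, SmoothNear (Q.I.prod N.I) N.I σ (q x, x) ∧
      (∀ᶠ w in 𝓝 (q x, (x : N)), ∃ h : σ w ∈ S, q ⟨σ w, h⟩ = w.1) ∧
      ∀ᶠ y in 𝓝 (x : N), ∀ h : y ∈ S, σ (q ⟨y, h⟩, y) = y := by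
  obtain ⟨r, hr⟩ := hS.exists_retraction x.2
  obtain ⟨f, hf, hfs⟩ := hq.exists_smoothNear hS x
  have hrx := hr.apply_self x.2
  have hfx : f x = q x := hf.2.self_of_nhds x.2
  set e := extChartAt N.I (x : N) with he
  set e' := extChartAt Q.I (q x) with he'
  set a := e x with ha
  have hea : e.symm a = x := e.left_inv (mem_extChartAt_source (x : N))
  have hes := smoothNear_extChartAt (x : N)
  have hes' := smoothNear_extChartAt_symm (x : N)
  have hrT : Filter.Tendsto r (𝓝 (x : N)) (𝓝 (x : N)) := by
    have := hr.smooth.tendsto; rwa [hrx] at this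
  have hfT : Filter.Tendsto f (𝓝 (x : N)) (𝓝 (q x)) := by
    have := hfs.tendsto; rwa [hfx] at this
  have heT : Filter.Tendsto e.symm (𝓝 a) (𝓝 (x : N)) := by
    have := hes'.tendsto; rwa [← he, ← ha, hea] at this
  have hfr : SmoothNear N.I Q.I (f ∘ r) (x : N) := hfs.comp_of_eq hr.smooth hrx
  have hfrx : (f ∘ r) x = q x := by rw [Function.comp_apply, hrx, hfx]
  have hefr : SmoothNear N.I 𝓘(ℝ, Q.E) (e' ∘ (f ∘ r)) (x : N) :=
    (smoothNear_extChartAt (q x)).comp_of_eq hfr hfrx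
  let h : N.E → Q.E := (e' ∘ (f ∘ r)) ∘ e.symm
  have hh : SmoothNear 𝓘(ℝ, N.E) 𝓘(ℝ, Q.E) h a := hefr.comp_of_eq hes' hea
  have hh' : ∀ᶠ y in 𝓝 a, ContDiffAt ℝ ∞ h y := hh.mono fun y hy => hy.contDiffAt
  set h' := fderiv ℝ h a with hh'def
  have hhd : HasFDerivAt h h' a := (hh'.self_of_nhds.differentiableAt (by simp)).hasFDerivAt
  -- the derivative of `q` in the charts is surjective
  have hsurj : Function.Surjective h' := by
    intro w
    obtain ⟨w₀, hw₀⟩ := (isInvertible_mfderiv_extChartAt (I := Q.I)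
      (mem_extChartAt_source (I := Q.I) (q x))).bijective.surjective w
    obtain ⟨v, hv, hd⟩ := hsub w₀
    refine ⟨mfderiv N.I 𝓘(ℝ, N.E) e (x : N) v, ?_⟩
    have h1 := hd.tangentMap_eq hv hf
    have hec : MDifferentiableAt N.I 𝓘(ℝ, N.E) e (x : N) := hes.mdiff
    have hec' : MDifferentiableAt Q.I 𝓘(ℝ, Q.E) e' (f x) := by
      rw [hfx]; exact (smoothNear_extChartAt (q x)).mdiff
    have h2 : tangentMap N.I 𝓘(ℝ, Q.E) (h ∘ e) ⟨x, v⟩ =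
        tangentMap N.I 𝓘(ℝ, Q.E) (e' ∘ f) ⟨x, v⟩ := by
      refine tangentMap_eq_of_eqOn hv ?_ ?_ ?_
      · exact MDifferentiableAt.comp (x : N) hh.mdiff hec
      · exact MDifferentiableAt.comp (x : N) hec' hfs.mdiff
      · filter_upwards [hr.eq, extChartAt_source_mem_nhds (I := N.I) (x : N)] with y h3 h4 hy
        change e' (f (r (e.symm (e y)))) = e' (f y)
        rw [e.left_inv h4, h3 hy]
    rw [tangentMap_comp_at (I' := 𝓘(ℝ, N.E)) (f := e) (g := h) _ hh.mdiff hec,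
      tangentMap_comp_at (f := f) (g := e') _ hec' hfs.mdiff, h1] at h2
    have h3 := (Bundle.TotalSpace.mk.inj h2).2
    have h4 := eq_of_heq h3
    rw [mfderiv_eq_fderiv] at h4
    exact h4.trans hw₀
  obtain ⟨L, hL⟩ := h'.exists_rightInverse_of_surjective (LinearMap.range_eq_top.2 hsurj)
  have hL' : ∀ w, h' (L w) = w := fun w => congrArg (fun A : Q.E →L[ℝ] Q.E => A w) hL
  -- the map `Φ` is invertible near `(0, a)` by the inverse function theorem, as `h' ∘ L = id`
  let Φ : Q.E × N.E → Q.E × N.E := fun z => (h (z.2 + L z.1), z.2)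
  let Φ' : (Q.E × N.E) ≃L[ℝ] (Q.E × N.E) := ContinuousLinearEquiv.equivOfInverse
    ((ContinuousLinearMap.fst ℝ Q.E N.E + h'.comp (ContinuousLinearMap.snd ℝ Q.E N.E)).prod
      (ContinuousLinearMap.snd ℝ Q.E N.E))
    ((ContinuousLinearMap.fst ℝ Q.E N.E - h'.comp (ContinuousLinearMap.snd ℝ Q.E N.E)).prod
      (ContinuousLinearMap.snd ℝ Q.E N.E)) (fun z => by simp) (fun z => by simp)
  have hinner : Filter.Tendsto (fun z : Q.E × N.E => z.2 + L z.1) (𝓝 (0, a)) (𝓝 a) := by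
    have : Continuous fun z : Q.E × N.E => z.2 + L z.1 := by fun_prop
    simpa using this.tendsto (0, a)
  have hΦ : ∀ᶠ z in 𝓝 ((0, a) : Q.E × N.E), ContDiffAt ℝ ∞ Φ z := by
    filter_upwards [hinner.eventually hh'] with z hz
    have h1 : ContDiffAt ℝ ∞ (fun z : Q.E × N.E => z.2 + L z.1) z := by fun_prop
    exact (ContDiffAt.comp z hz h1).prodMk contDiffAt_snd
  have hΦ' : HasFDerivAt Φ (Φ' : (Q.E × N.E) →L[ℝ] (Q.E × N.E)) (0, a) := by
    have h1 : HasFDerivAt (fun z : Q.E × N.E => z.2 + L z.1)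
        (ContinuousLinearMap.snd ℝ Q.E N.E + L.comp (ContinuousLinearMap.fst ℝ Q.E N.E)) (0, a) :=
      hasFDerivAt_snd.add (L.hasFDerivAt.comp _ hasFDerivAt_fst)
    have h2 : HasFDerivAt h h' ((fun z : Q.E × N.E => z.2 + L z.1) (0, a)) := by
      simpa using hhd
    refine ((HasFDerivAt.comp (0, a) h2 h1).prodMk hasFDerivAt_snd).congr_fderiv ?_
    ext z <;> simp [Φ', hL']
  obtain ⟨Θ, h0, -, hΘ, -, hΘs⟩ := exists_openPartialHomeomorph hΦ hΦ' (W := Set.univ) (by simp)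
  have hha : h a = e' (q x) := by
    change e' (f (r (e.symm a))) = e' (q x)
    rw [hea, hrx, hfx]
  have hΦ0 : Φ (0, a) = (e' (q x), a) := by simp [Φ, hha]
  have hΘ0 : Θ.symm (e' (q x), a) = (0, a) := by
    rw [← hΦ0, ← hΘ]; exact Θ.left_inv h0
  have hΘt : ∀ᶠ w in 𝓝 ((e' (q x), a) : Q.E × N.E), w ∈ Θ.target := by
    refine Θ.open_target.mem_nhds ?_
    rw [← hΦ0, ← hΘ]; exact Θ.map_source h0
  have hΘsm : SmoothNear 𝓘(ℝ, Q.E × N.E) 𝓘(ℝ, Q.E × N.E) Θ.symm (e' (q x), a) :=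
    hΘt.mono fun w hw => (hΘs w hw).contMDiffAt
  -- the point `y + L ζ` of the chart, where `(ζ, y)` is the inverse image of `(z, y)`
  let k : Q × N → Q.E × N.E := fun w => (e' w.1, e w.2)
  have hk : SmoothNear (Q.I.prod N.I) 𝓘(ℝ, Q.E × N.E) k (q x, x) := by
    have h1 : ∀ᶠ w : Q × N in 𝓝 (q x, (x : N)), w.1 ∈ (chartAt Q.H (q x)).source :=
      continuousAt_fst.eventually (chart_source_mem_nhds Q.H (q x))
    have h2 : ∀ᶠ w : Q × N in 𝓝 (q x, (x : N)), w.2 ∈ (chartAt N.H (x : N)).source :=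
      continuousAt_snd.eventually (chart_source_mem_nhds N.H (x : N))
    filter_upwards [h1, h2] with w hw1 hw2
    exact (ContMDiffAt.comp w (contMDiffAt_extChartAt' hw1) contMDiffAt_fst).prodMk_space
      (ContMDiffAt.comp w (contMDiffAt_extChartAt' hw2) contMDiffAt_snd)
  have hkx : k (q x, x) = (e' (q x), a) := rfl
  let A : Q.E × N.E → N.E := fun z => z.2 + L z.1
  have hA : ∀ z, SmoothNear 𝓘(ℝ, Q.E × N.E) 𝓘(ℝ, N.E) A z := fun z =>
    Filter.Eventually.of_forall fun z => ContDiffAt.contMDiffAt (by fun_prop)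
  have hΘk : SmoothNear (Q.I.prod N.I) 𝓘(ℝ, Q.E × N.E) (Θ.symm ∘ k) (q x, x) :=
    hΘsm.comp_of_eq hk hkx
  have hΘk0 : (Θ.symm ∘ k) (q x, x) = (0, a) := by rw [Function.comp_apply, hkx, hΘ0]
  have hA0 : A (0, a) = a := by simp [A]
  have hAk : SmoothNear (Q.I.prod N.I) 𝓘(ℝ, N.E) (A ∘ (Θ.symm ∘ k)) (q x, x) :=
    (hA _).comp hΘk
  have hAk0 : (A ∘ (Θ.symm ∘ k)) (q x, x) = a := by
    rw [Function.comp_apply, hΘk0, hA0]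
  have hB : SmoothNear (Q.I.prod N.I) N.I (e.symm ∘ (A ∘ (Θ.symm ∘ k))) (q x, x) :=
    hes'.comp_of_eq hAk hAk0
  have hB0 : (e.symm ∘ (A ∘ (Θ.symm ∘ k))) (q x, x) = x := by
    rw [Function.comp_apply, hAk0, hea]
  have hσ : SmoothNear (Q.I.prod N.I) N.I (r ∘ (e.symm ∘ (A ∘ (Θ.symm ∘ k)))) (q x, x) :=
    hr.smooth.comp_of_eq hB hB0
  have hBT : Filter.Tendsto (e.symm ∘ (A ∘ (Θ.symm ∘ k))) (𝓝 (q x, (x : N))) (𝓝 (x : N)) := by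
    have := hB.tendsto; rwa [hB0] at this
  have hkT : Filter.Tendsto k (𝓝 (q x, (x : N))) (𝓝 (e' (q x), a)) := hk.tendsto
  have hsrc' : ∀ᶠ z in 𝓝 (q x), z ∈ e'.source := extChartAt_source_mem_nhds (I := Q.I) (q x)
  refine ⟨r ∘ (e.symm ∘ (A ∘ (Θ.symm ∘ k))), hσ, ?_, ?_⟩
  · filter_upwards [hBT.eventually hr.mem, (hrT.comp hBT).eventually hf.2, hkT.eventually hΘt,
      ((hfT.comp hrT).comp hBT).eventually hsrc', continuousAt_fst.eventually hsrc']
      with w h1 h2 h3 h4 h5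
    refine ⟨h1, (h2 h1).symm.trans ?_⟩
    refine e'.injOn h4 h5 ?_
    have h6 : Φ (Θ.symm (k w)) = k w := by rw [← hΘ]; exact Θ.right_inv h3
    exact congrArg Prod.fst h6
  · have hcm : Filter.Tendsto (fun y : N => ((0, e y) : Q.E × N.E)) (𝓝 (x : N)) (𝓝 (0, a)) :=
      tendsto_const_nhds.prodMk_nhds hes.tendsto
    filter_upwards [hr.eq, hf.2, extChartAt_source_mem_nhds (I := N.I) (x : N),
      hcm.eventually (Θ.open_source.mem_nhds h0)] with y h1 h2 h3 h4 hy
    have h5 : Θ.symm (k (q ⟨y, hy⟩, y)) = (0, e y) := by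
      have : k (q ⟨y, hy⟩, y) = Φ (0, e y) := by
        simp only [k, Φ, map_zero, add_zero]
        change _ = (e' (f (r (e.symm (e y)))), e y)
        rw [e.left_inv h3, h1 hy, h2 hy]
      rw [this, ← hΘ]; exact Θ.left_inv h4
    change r (e.symm (A (Θ.symm (k (q ⟨y, hy⟩, y))))) = y
    rw [h5]
    simp only [A, map_zero, add_zero]
    rw [e.left_inv h3, h1 hy]

end Mfd

/-! ### Differentials of maps on submanifolds, and images of saturated submanifolds -/

namespace Mfd

variable {N Q Q' M : Mfd.{u}}

theorem exists_eq_mk {p : TangentBundle N.I N} {x : N} (h : p.1 = x) :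
    ∃ v : TangentSpace N.I x, p = ⟨x, v⟩ := by
  subst h
  exact ⟨p.2, rfl⟩

theorem add_smul_mem_tangentSet {S : Set N} (hS : IsSubmanifold S) {x : N}
    {v w : TangentSpace N.I x} (hv : (⟨x, v⟩ : TangentBundle N.I N) ∈ tangentSet S)
    (hw : (⟨x, w⟩ : TangentBundle N.I N) ∈ tangentSet S) (a : ℝ) :
    (⟨x, v + a • w⟩ : TangentBundle N.I N) ∈ tangentSet S := by
  have hx : x ∈ S := mem_of_mem_tangentSet hv
  obtain ⟨r, hr⟩ := hS.exists_retraction hx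
  rw [mem_tangentSet_iff_mfderiv hr hx] at hv hw ⊢
  rw [map_add, map_smul]
  exact congrArg₂ (fun s t : N.E => s + a • t) hv hw

theorem zero_mem_tangentSet {S : Set N} {x : N} (hx : x ∈ S) :
    (⟨x, 0⟩ : TangentBundle N.I N) ∈ tangentSet S := by
  refine ⟨fun _ => x, contMDiffAt_const, Filter.Eventually.of_forall fun _ => hx, ?_⟩
  unfold tangentMap
  rw [mfderiv_const]
  rfl

/-- `IsDiff` at a given point, in terms of the derivative of a fixed local extension. -/
theorem IsDiff.mk_iff {S : Set N} {q : S → Q} {x : N} {hx : x ∈ S} {v : TangentSpace N.I x}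
    (hv : (⟨x, v⟩ : TangentBundle N.I N) ∈ tangentSet S) {f : N → Q}
    (hf : IsLocalExt S q ⟨x, hx⟩ f) {y : Q} {w : TangentSpace Q.I y} :
    IsDiff S q ⟨x, v⟩ ⟨y, w⟩ ↔ q ⟨x, hx⟩ = y ∧ (mfderiv N.I Q.I f x v : Q.E) = w := by
  have hfx : f x = q ⟨x, hx⟩ := hf.2.self_of_nhds hx
  constructor
  · intro h
    have h1 := Bundle.TotalSpace.mk.inj (h.tangentMap_eq hv hf)
    exact ⟨hfx.symm.trans h1.1, eq_of_heq h1.2⟩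
  · rintro ⟨h1, h2⟩
    refine ⟨hx, f, hf, ?_⟩
    unfold tangentMap
    rw [Bundle.TotalSpace.mk.injEq]
    exact ⟨hfx.trans h1, heq_of_eq h2⟩

theorem IsDiff.add_smul {S : Set N} {q : S → Q} (hS : IsSubmanifold S) {x : N}
    {v v' : TangentSpace N.I x} {y : Q} {w w' : TangentSpace Q.I y}
    (hv : (⟨x, v⟩ : TangentBundle N.I N) ∈ tangentSet S)
    (hv' : (⟨x, v'⟩ : TangentBundle N.I N) ∈ tangentSet S)
    (h : IsDiff S q ⟨x, v⟩ ⟨y, w⟩) (h' : IsDiff S q ⟨x, v'⟩ ⟨y, w'⟩) (a : ℝ) :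
    IsDiff S q ⟨x, v + a • v'⟩ ⟨y, w + a • w'⟩ := by
  have h0 := h
  obtain ⟨hx, f, hf, -⟩ := h0
  rw [IsDiff.mk_iff hv hf] at h
  rw [IsDiff.mk_iff hv' hf] at h'
  rw [IsDiff.mk_iff (add_smul_mem_tangentSet hS hv hv' a) hf]
  refine ⟨h.1, ?_⟩
  rw [map_add, map_smul]
  exact congrArg₂ (fun s t : Q.E => s + a • t) h.2 h'.2

theorem IsDiff.zero {S : Set N} {q : S → Q} (hq : SmoothOnSub S q) (x : S) :
    IsDiff S q ⟨x, 0⟩ ⟨q x, 0⟩ := by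
  obtain ⟨f, hf⟩ := hq x
  exact (IsDiff.mk_iff (hx := x.2) (zero_mem_tangentSet x.2) hf).2 ⟨rfl, map_zero _⟩

/-- The differential of `q` at a point, with values in the tangent space at the image point. -/
theorem SmoothOnSub.exists_isDiff_mk {S : Set N} {q : S → Q} (hq : SmoothOnSub S q) (x : S)
    (v : TangentSpace N.I (x : N)) : ∃ w, IsDiff S q ⟨x, v⟩ ⟨q x, w⟩ := by
  obtain ⟨f, hf⟩ := hq x
  obtain ⟨w, hw⟩ := exists_eq_mk (p := tangentMap N.I Q.I f ⟨x, v⟩) (hf.2.self_of_nhds x.2)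
  exact ⟨w, x.2, f, hf, hw⟩

theorem IsDiff.mk_unique {S : Set N} {q : S → Q} {x : N} {v : TangentSpace N.I x}
    (hv : (⟨x, v⟩ : TangentBundle N.I N) ∈ tangentSet S) {y : Q} {w w' : TangentSpace Q.I y}
    (h : IsDiff S q ⟨x, v⟩ ⟨y, w⟩) (h' : IsDiff S q ⟨x, v⟩ ⟨y, w'⟩) : w = w' :=
  eq_of_heq (Bundle.TotalSpace.mk.inj (h.unique hv h')).2

/-- The differential carries `TT` into `TT'` if the map carries `T` into `T'`. -/
theorem IsDiff.mem_tangentSet {S : Set N} {q : S → Q} {T : Set N} {T' : Set Q} (hTS : T ⊆ S)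
    (hT : ∀ x (h : x ∈ T), q ⟨x, hTS h⟩ ∈ T') {p : TangentBundle N.I N} {r : TangentBundle Q.I Q}
    (hp : p ∈ tangentSet T) (h : IsDiff S q p r) : r ∈ tangentSet T' := by
  obtain ⟨hx, f, hf, rfl⟩ := h
  refine tangentMap_mem_tangentSet hp hf.1 ?_
  filter_upwards [hf.2] with y hy hyT
  rw [hy (hTS hyT)]
  exact hT y hyT

/-- The chain rule for maps on submanifolds. -/
theorem IsDiff.comp {S : Set N} {q : S → Q} {T : Set N} {T' : Set Q} (hTS : T ⊆ S)
    (hT : ∀ x (h : x ∈ T), q ⟨x, hTS h⟩ ∈ T') {g : T → Q'} {g' : T' → Q'}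
    (hg : ∀ x (h : x ∈ T), g' ⟨q ⟨x, hTS h⟩, hT x h⟩ = g ⟨x, h⟩)
    {p : TangentBundle N.I N} {r : TangentBundle Q.I Q} {s : TangentBundle Q'.I Q'}
    (hp : p ∈ tangentSet T) (h : IsDiff S q p r) (h' : IsDiff T' g' r s) : IsDiff T g p s := by
  have hpT : p.1 ∈ T := mem_of_mem_tangentSet hp
  obtain ⟨hx, f, hf, rfl⟩ := h
  obtain ⟨hy, F, hF, rfl⟩ := h'
  have hfx : f p.1 = q ⟨p.1, hx⟩ := hf.2.self_of_nhds hx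
  have hF1 : ContMDiffAt Q.I Q'.I ∞ F (f p.1) := hF.1
  have hF2 : ∀ᶠ y in 𝓝 (f p.1), ∀ h : y ∈ T', F y = g' ⟨y, h⟩ := hF.2
  refine ⟨hpT, F ∘ f, ⟨ContMDiffAt.comp p.1 hF1 hf.1, ?_⟩, ?_⟩
  · filter_upwards [hf.2, hf.1.continuousAt.eventually hF2] with y h1 h2 hyT
    have h3 := h1 (hTS hyT)
    have h4 : f y ∈ T' := by rw [h3]; exact hT y hyT
    rw [Function.comp_apply, h2 h4, ← hg y hyT]
    congr 2
  · exact tangentMap_comp_at _ (hF1.mdifferentiableAt (by simp)) (hf.1.mdifferentiableAt (by simp))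

/-- The image under `q : S → Q` of the points of `T` in `S`. -/
def qImage {S : Set N} (q : S → Q) (T : Set N) : Set Q := {y | ∃ x : S, (x : N) ∈ T ∧ q x = y}

variable {S T : Set N} {R : S → S → Prop} {q : S → Q}

/-- A regular quotient map has smooth local sections through every point of `S`. -/
theorem IsRegularQuotient.exists_section (hq : IsRegularQuotient S R q) (hS : IsSubmanifold S)
    (x : S) : ∃ σ : Q → N, SmoothNear Q.I N.I σ (q x) ∧ σ (q x) = x ∧
      ∀ᶠ z in 𝓝 (q x), ∃ h : σ z ∈ S, q ⟨σ z, h⟩ = z := by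
  obtain ⟨σ, h1, h2, h3⟩ := exists_local_sections hS hq.smooth x (hq.submersion x)
  have hc : SmoothNear Q.I (Q.I.prod N.I) (fun z : Q => (z, (x : N))) (q x) :=
    Filter.Eventually.of_forall fun z => contMDiffAt_id.prodMk contMDiffAt_const
  refine ⟨σ ∘ fun z => (z, (x : N)), SmoothNear.comp h1 hc, h3.self_of_nhds x.2, ?_⟩
  exact hc.tendsto.eventually h2

/-- The map `y ↦ σ (q x, y)` built from local sections `σ` retracts `S` onto the fibre of `q`
through `x`, and fixes the tangent vectors at `x` in the kernel of `dq`. -/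
theorem IsRegularQuotient.exists_fibreRetraction (hq : IsRegularQuotient S R q)
    (hS : IsSubmanifold S) (x : S) : ∃ g : N → N, ContMDiffAt N.I N.I ∞ g x ∧
      (∀ᶠ y in 𝓝 (x : N), ∃ h : g y ∈ S, q ⟨g y, h⟩ = q x) ∧
      ∀ u : TangentSpace N.I (x : N), (⟨x, u⟩ : TangentBundle N.I N) ∈ tangentSet S →
        IsDiff S q ⟨x, u⟩ ⟨q x, 0⟩ → tangentMap N.I N.I g ⟨x, u⟩ = ⟨x, u⟩ := by
  obtain ⟨σ, h1, h2, h3⟩ := exists_local_sections hS hq.smooth x (hq.submersion x)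
  obtain ⟨f, hf⟩ := hq.smooth x
  have hfx : f x = q x := hf.2.self_of_nhds x.2
  have hc : ContMDiffAt N.I (Q.I.prod N.I) ∞ (fun z : N => (q x, z)) x :=
    contMDiffAt_const.prodMk contMDiffAt_id
  have hc' : ContMDiffAt N.I (Q.I.prod N.I) ∞ (fun z : N => (f z, z)) x :=
    hf.1.prodMk contMDiffAt_id
  have hσ' : ContMDiffAt (Q.I.prod N.I) N.I ∞ σ (f x, (x : N)) := by rw [hfx]; exact h1.at
  refine ⟨σ ∘ fun z => (q x, z), ContMDiffAt.comp (x : N) h1.at hc,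
    hc.continuousAt.eventually h2, ?_⟩
  intro u hu hd
  have hd' := ((IsDiff.mk_iff (hx := x.2) hu hf).1 hd).2
  rw [tangentMap_comp_at (f := fun z : N => (q x, z)) (g := σ) _ h1.mdiff
    (hc.mdifferentiableAt (by simp))]
  have h4 : tangentMap N.I (Q.I.prod N.I) (fun z : N => (q x, z)) ⟨x, u⟩ =
      tangentMap N.I (Q.I.prod N.I) (fun z : N => (f z, z)) ⟨x, u⟩ := by
    unfold tangentMap
    rw [Bundle.TotalSpace.mk.injEq]
    refine ⟨by simp [hfx], heq_of_eq ?_⟩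
    have e1 : mfderiv N.I (Q.I.prod N.I) (fun z : N => (q x, z)) (x : N) =
      (mfderiv N.I Q.I (fun _ : N => q x) (x : N)).prod
        (mfderiv N.I N.I (fun z : N => z) (x : N)) :=
      mfderiv_prodMk mdifferentiableAt_const mdifferentiableAt_id
    have e2 : mfderiv N.I (Q.I.prod N.I) (fun z : N => (f z, z)) (x : N) =
      (mfderiv N.I Q.I f (x : N)).prod (mfderiv N.I N.I (fun z : N => z) (x : N)) :=
      mfderiv_prodMk (hf.1.mdifferentiableAt (by simp)) mdifferentiableAt_id
    change mfderiv N.I (Q.I.prod N.I) (fun z : N => (q x, z)) (x : N) u =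
      mfderiv N.I (Q.I.prod N.I) (fun z : N => (f z, z)) (x : N) u
    rw [e1, e2, mfderiv_const]
    refine Prod.ext ?_ rfl
    exact hd'.symm
  rw [h4, ← tangentMap_comp_at (f := fun z : N => (f z, z)) (g := σ) _
    (hσ'.mdifferentiableAt (by simp)) (hc'.mdifferentiableAt (by simp))]
  rw [tangentMap_eq_of_eqOn (g := id) hu, tangentMap_id]
  · rfl
  · exact (ContMDiffAt.comp (x : N) (f := fun z : N => (f z, z)) hσ' hc').mdifferentiableAt
      (by simp)
  · exact mdifferentiableAt_id
  · filter_upwards [h3, hf.2] with y h5 h6 hy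
    rw [Function.comp_apply, h6 hy, h5 hy]; rfl

/-- The image of a saturated submanifold under a submersion is a submanifold: `q ∘ r ∘ σ` is a
retraction onto it, for a local section `σ` of `q` and a retraction `r` onto the submanifold. -/
theorem IsRegularQuotient.isSubmanifold_qImage (hq : IsRegularQuotient S R q)
    (hS : IsSubmanifold S) (hT : IsSubmanifold T) (hTS : T ⊆ S)
    (sat : ∀ x y : S, q x = q y → (x : N) ∈ T → (y : N) ∈ T) : IsSubmanifold (qImage q T) := by
  refine isSubmanifold_of_exists_retraction ?_
  rintro _ ⟨x, hxT, rfl⟩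
  obtain ⟨σ, hσ, hσx, hσS⟩ := hq.exists_section hS x
  obtain ⟨r, hr⟩ := hT.exists_retraction hxT
  obtain ⟨f, hf, hfs⟩ := hq.smooth.exists_smoothNear hS x
  have hrx := hr.apply_self hxT
  have hσT : Filter.Tendsto σ (𝓝 (q x)) (𝓝 (x : N)) := by
    have := hσ.tendsto; rwa [hσx] at this
  have hrT : Filter.Tendsto r (𝓝 (x : N)) (𝓝 (x : N)) := by
    have := hr.smooth.tendsto; rwa [hrx] at this
  have h1 : SmoothNear Q.I N.I (r ∘ σ) (q x) := hr.smooth.comp_of_eq hσ hσx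
  refine ⟨f ∘ (r ∘ σ), hfs.comp_of_eq h1 (by rw [Function.comp_apply, hσx, hrx]), ?_, ?_⟩
  · filter_upwards [hσT.eventually hr.mem, (hrT.comp hσT).eventually hf.2] with z h2 h3
    exact ⟨⟨r (σ z), hTS h2⟩, h2, (h3 (hTS h2)).symm⟩
  · filter_upwards [hσS, hσT.eventually hr.eq, (hrT.comp hσT).eventually hf.2]
      with z ⟨h2, h2'⟩ h3 h4 ⟨y, hyT, hyz⟩
    have h5 : σ z ∈ T := sat y ⟨σ z, h2⟩ (hyz.trans h2'.symm) hyT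
    have h6 : r (σ z) = σ z := h3 h5
    change f (r (σ z)) = z
    have h7 : r (σ z) ∈ S := by rw [h6]; exact h2
    have h8 : (⟨r (σ z), h7⟩ : S) = ⟨σ z, h2⟩ := Subtype.ext h6
    exact (h4 h7).trans ((congrArg q h8).trans h2')

/-- A map which descends to the image of a saturated submanifold is smooth there. -/
theorem IsRegularQuotient.smoothOnSub_desc (hq : IsRegularQuotient S R q)
    (hS : IsSubmanifold S) (hTS : T ⊆ S)
    (sat : ∀ x y : S, q x = q y → (x : N) ∈ T → (y : N) ∈ T) {g : T → Q'} (hg : SmoothOnSub T g)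
    {g' : qImage q T → Q'}
    (hgg : ∀ x (h : x ∈ T), g' ⟨q ⟨x, hTS h⟩, ⟨x, hTS h⟩, h, rfl⟩ = g ⟨x, h⟩) :
    SmoothOnSub (qImage q T) g' := by
  rintro ⟨_, x, hxT, rfl⟩
  obtain ⟨σ, hσ, hσx, hσS⟩ := hq.exists_section hS x
  obtain ⟨f, hf1, hf2⟩ := hg ⟨x, hxT⟩
  have hσT : Filter.Tendsto σ (𝓝 (q x)) (𝓝 (x : N)) := by
    have := hσ.tendsto; rwa [hσx] at this
  have hf1' : ContMDiffAt N.I Q'.I ∞ f (σ (q x)) := by rw [hσx]; exact hf1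
  refine ⟨f ∘ σ, ContMDiffAt.comp (q x) hf1' hσ.at, ?_⟩
  filter_upwards [hσS, hσT.eventually hf2] with z ⟨h2, h2'⟩ h3 hz
  have h5 : σ z ∈ T := by
    obtain ⟨y, hyT, hyz⟩ := hz
    exact sat y ⟨σ z, h2⟩ (hyz.trans h2'.symm) hyT
  rw [Function.comp_apply, h3 h5, ← hgg _ h5]
  congr 2

/-- For a saturated subset `T` of `S`, the vectors in `TS` which `dq` maps into the tangent bundle
of the image of `T` are tangent to `T`. -/
theorem IsRegularQuotient.mem_tangentSet_of_isDiff (hq : IsRegularQuotient S R q)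
    (hS : IsSubmanifold S) (hT : IsSubmanifold T) (hTS : T ⊆ S)
    (sat : ∀ x y : S, q x = q y → (x : N) ∈ T → (y : N) ∈ T)
    {p : TangentBundle N.I N} {r : TangentBundle Q.I Q} (hp : p ∈ tangentSet S) (hpT : p.1 ∈ T)
    (h : IsDiff S q p r) (hr : r ∈ tangentSet (qImage q T)) : p ∈ tangentSet T := by
  obtain ⟨x, v⟩ := p
  obtain ⟨y, w⟩ := r
  change x ∈ T at hpT
  obtain ⟨hxS, hqx⟩ := h.proj_eq
  change x ∈ S at hxS
  change q ⟨x, hxS⟩ = y at hqx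
  subst hqx
  obtain ⟨σ, hσ, hσx, hσS⟩ := hq.exists_section hS ⟨x, hxS⟩
  change σ (q ⟨x, hxS⟩) = x at hσx
  -- the lift by a section differs from the given vector by one in the kernel of `dq`
  have h1 : tangentMap Q.I N.I σ ⟨q ⟨x, hxS⟩, w⟩ ∈ tangentSet T := by
    refine tangentMap_mem_tangentSet hr hσ.at ?_
    filter_upwards [hσS] with z ⟨h2, h2'⟩ ⟨y, hyT, hyz⟩
    exact sat y ⟨σ z, h2⟩ (hyz.trans h2'.symm) hyT
  obtain ⟨v', hv'⟩ := exists_eq_mk (p := tangentMap Q.I N.I σ ⟨q ⟨x, hxS⟩, w⟩) hσx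
  rw [hv'] at h1
  have h1S := tangentSet_mono hTS h1
  have hd' : IsDiff S q ⟨x, v'⟩ ⟨q ⟨x, hxS⟩, w⟩ := by
    obtain ⟨f, hf⟩ := hq.smooth ⟨x, hxS⟩
    have hf1 : ContMDiffAt N.I Q.I ∞ f (σ (q ⟨x, hxS⟩)) := by rw [hσx]; exact hf.1
    refine ⟨hxS, f, hf, ?_⟩
    rw [← hv', ← tangentMap_comp_at (f := σ) (g := f) _ (hf1.mdifferentiableAt (by simp)) hσ.mdiff]
    rw [tangentMap_congr_of_eventuallyEq (g := id), tangentMap_id]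
    · rfl
    · have hσT : Filter.Tendsto σ (𝓝 (q ⟨x, hxS⟩)) (𝓝 x) := by
        have := hσ.tendsto; rwa [hσx] at this
      filter_upwards [hσS, hσT.eventually hf.2] with z ⟨h2, h2'⟩ h3
      rw [Function.comp_apply, h3 h2, h2']; rfl
  have h3 : IsDiff S q ⟨x, v + (-1 : ℝ) • v'⟩ ⟨q ⟨x, hxS⟩, 0⟩ := by
    have := IsDiff.add_smul hS hp h1S h hd' (-1)
    simpa using this
  have h4 := add_smul_mem_tangentSet hS hp h1S (-1)
  obtain ⟨g, hg, hgm, hgt⟩ := hq.exists_fibreRetraction hS ⟨x, hxS⟩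
  have h5 : (⟨x, v + (-1 : ℝ) • v'⟩ : TangentBundle N.I N) ∈ tangentSet T := by
    have := tangentMap_mem_tangentSet (S' := T) h4 hg (by
      filter_upwards [hgm] with y ⟨h6, h7⟩ _
      exact sat ⟨x, hxS⟩ ⟨g y, h6⟩ h7.symm hpT)
    rwa [hgt _ h4 h3] at this
  have h6 := add_smul_mem_tangentSet hT h5 h1 1
  have h7 : v + (-1 : ℝ) • v' + (1 : ℝ) • v' = v := by simp
  rwa [h7] at h6

end Mfd

/-! ### Integral curves in submanifolds -/

namespace Mfd

variable {N Q Q' M : Mfd.{u}}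

/-- A `C¹` vector field which is tangent to a submanifold has integral curves in the submanifold:
in slice coordinates, a solution for the field composed with projections to the slice stays in
the slice. -/
theorem IsSubmanifold.exists_integralCurve {P : Set N} (hP : IsSubmanifold P) {x : N} (hx : x ∈ P)
    {V : (m : N) → TangentSpace N.I m}
    (hV : ContMDiffAt N.I N.I.tangent 1 (fun m => (⟨m, V m⟩ : TangentBundle N.I N)) x)
    (ht : ∀ᶠ m in 𝓝 x, m ∈ P → (⟨m, V m⟩ : TangentBundle N.I N) ∈ tangentSet P) :
    ∃ γ : ℝ → N, γ 0 = x ∧ ∀ᶠ t in 𝓝 (0 : ℝ), γ t ∈ P ∧ MDifferentiableAt 𝓘(ℝ, ℝ) N.I γ t ∧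
      tangentMap 𝓘(ℝ, ℝ) N.I γ ⟨t, (1 : ℝ)⟩ = ⟨γ t, V (γ t)⟩ := by
  obtain ⟨e, e', F, he, he', hee, hee', hF⟩ := hP.exists_slice hx
  obtain ⟨G, hG⟩ := F.exists_isCompl
  let p : N.E →L[ℝ] N.E := LinearMap.toContinuousLinearMap (F.projection G hG)
  have hpF : ∀ v, p v ∈ F := fun v => by
    simp [p]
  have hpid : ∀ v ∈ F, p v = v := fun v hv => (Submodule.projection_eq_self_iff hG v).2 hv
  set a := e x with ha
  have hea : e' a = x := hee.self_of_nhds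
  have heT : Filter.Tendsto e' (𝓝 a) (𝓝 x) := by
    have := he'.tendsto; rwa [hea] at this
  -- the vector field in the slice coordinates
  let W : N.E → N.E := VectorField.mpullback 𝓘(ℝ, N.E) N.I e' V
  have hinv : ∀ᶠ u in 𝓝 a, (mfderiv 𝓘(ℝ, N.E) N.I e' u).IsInvertible ∧
      ∀ w : N.E, mfderiv N.I 𝓘(ℝ, N.E) e (e' u) (mfderiv 𝓘(ℝ, N.E) N.I e' u w) = w := by
    filter_upwards [hee'.eventually_nhds, (heT.eventually hee.eventually_nhds), he',
      heT.eventually he] with u h1 h2 h3 h4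
    have h3' := h3.mdifferentiableAt (n := ∞) (by simp)
    have h4' := h4.mdifferentiableAt (n := ∞) (by simp)
    have h5 : (mfderiv N.I 𝓘(ℝ, N.E) e (e' u)).comp (mfderiv 𝓘(ℝ, N.E) N.I e' u) =
        ContinuousLinearMap.id ℝ N.E := by
      rw [← mfderiv_comp u h4' h3']
      have : (e ∘ e') =ᶠ[𝓝 u] id := h1
      rw [this.mfderiv_eq, mfderiv_id]; rfl
    have h5' : ∀ w : N.E, mfderiv N.I 𝓘(ℝ, N.E) e (e' u) (mfderiv 𝓘(ℝ, N.E) N.I e' u w) = w :=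
      fun w => congrArg (fun A : N.E →L[ℝ] N.E => A w) h5
    refine ⟨?_, h5'⟩
    have hinj : Function.Injective (mfderiv 𝓘(ℝ, N.E) N.I e' u) :=
      Function.LeftInverse.injective h5'
    let A : N.E →ₗ[ℝ] N.E := (mfderiv 𝓘(ℝ, N.E) N.I e' u).toLinearMap
    exact ⟨(LinearEquiv.ofInjectiveEndo A hinj).toContinuousLinearEquiv, by ext; rfl⟩
  have hW : ContDiffAt ℝ 1 W a := by
    refine contMDiffAt_vectorSpace_iff_contDiffAt.1 ?_
    refine ContMDiffAt.mpullback_vectorField_preimage (n := ∞) ?_ he'.at hinv.self_of_nhds.1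
      (WithTop.coe_le_coe.2 (le_top : (1 + 1 : ℕ∞) ≤ ⊤))
    rw [hea]; exact hV
  have hWV : ∀ᶠ u in 𝓝 a, mfderiv 𝓘(ℝ, N.E) N.I e' u (W u) = V (e' u) := by
    filter_upwards [hinv] with u hu
    exact (hu.1.inverse_apply_eq.1 rfl).symm
  -- it is tangent to the slice
  have hWF : ∀ᶠ u in 𝓝 a, u - a ∈ F → W u ∈ F := by
    filter_upwards [heT.eventually ht, heT.eventually hF.eventually_nhds, hee', hWV, hinv,
      heT.eventually he] with u h1 h2 h3 h4 h5 h6 hu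
    have hPu : e' u ∈ P := h2.self_of_nhds.2 (by rw [h3]; exact hu)
    let c : N.E → N.E := fun z => (z - a) - p (z - a)
    have hc : ContMDiff 𝓘(ℝ, N.E) 𝓘(ℝ, N.E) ∞ c := by
      apply ContDiff.contMDiff; fun_prop
    have h6' := h6.mdifferentiableAt (n := ∞) (by simp)
    have hc' : MDifferentiableAt 𝓘(ℝ, N.E) 𝓘(ℝ, N.E) c (e (e' u)) := hc.mdifferentiable (by simp) _
    have h7 := tangentMap_eq_of_eqOn (f := c ∘ e) (g := fun _ => (0 : N.E)) (h1 hPu)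
      (hc'.comp (e' u) h6') mdifferentiableAt_const (by
        filter_upwards [h2] with y hy hyP
        have := hy.1 hyP
        simp only [c, Function.comp_apply]
        rw [hpid _ this, sub_self])
    rw [tangentMap_comp_at (f := e) (g := c) _ hc' h6'] at h7
    have h8 := eq_of_heq (Bundle.TotalSpace.mk.inj h7).2
    have h9 : mfderiv 𝓘(ℝ, N.E) 𝓘(ℝ, N.E) c (e (e' u)) (mfderiv N.I 𝓘(ℝ, N.E) e (e' u) (V (e' u))) =
      (0 : N.E) := by
      refine h8.trans ?_
      simp only [mfderiv_const]
      rfl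
    rw [← h4, h5.2, mfderiv_eq_fderiv] at h9
    have h10 : HasFDerivAt c (ContinuousLinearMap.id ℝ N.E - p.comp (ContinuousLinearMap.id ℝ N.E))
        (e (e' u)) := by
      have h11 : HasFDerivAt (fun z : N.E => z - a) (ContinuousLinearMap.id ℝ N.E) (e (e' u)) :=
        (hasFDerivAt_id _).sub_const a
      exact h11.sub (p.hasFDerivAt.comp _ h11)
    rw [h10.fderiv] at h9
    have h12 : W u - p (W u) = 0 := h9
    rw [sub_eq_zero.1 h12]
    exact hpF _
  -- the field projected to the slice
  let W' : N.E → N.E := fun u => p (W (a + p (u - a)))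
  have hW' : ContDiffAt ℝ 1 W' a := by
    have h1 : ContDiffAt ℝ 1 (fun u => a + p (u - a)) a := by fun_prop
    have h2 : ContDiffAt ℝ 1 W (a + p (a - a)) := by simpa using hW
    exact ContDiffAt.comp (g := p) a p.contDiff.contDiffAt
      (ContDiffAt.comp (g := W) (f := fun u => a + p (u - a)) a h2 h1)
  obtain ⟨c, hc0, ε, hε, hc⟩ :=
    hW'.exists_forall_mem_closedBall_exists_eq_forall_mem_Ioo_hasDerivAt₀ 0
  -- the component of the solution transverse to the slice is constant
  have hcF : ∀ t ∈ Set.Ioo (0 - ε) (0 + ε), c t - a ∈ F := by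
    intro t ht
    have h1 : ∀ s ∈ Set.Ioo (0 - ε) (0 + ε),
        HasDerivAt (fun s => (c s - a) - p (c s - a)) 0 s := by
      intro s hs
      have h2 : HasDerivAt (fun s => c s - a) (W' (c s)) s := (hc s hs).sub_const a
      have h3 := h2.sub (p.hasFDerivAt.comp_hasDerivAt s h2)
      refine h3.congr_deriv ?_
      rw [hpid _ (hpF _), sub_self]
    have h4 : (c t - a) - p (c t - a) = (c 0 - a) - p (c 0 - a) := by
      refine (convex_Ioo (0 - ε) (0 + ε)).is_const_of_fderivWithin_eq_zero (𝕜 := ℝ)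
        (f := fun s => (c s - a) - p (c s - a))
        (fun s hs => (h1 s hs).differentiableAt.differentiableWithinAt) ?_ ht (by simp [hε])
      intro s hs
      rw [fderivWithin_of_isOpen isOpen_Ioo hs]
      ext
      simpa using (h1 s hs).deriv
    rw [hc0, sub_self, map_zero, sub_zero, sub_eq_zero] at h4
    rw [h4]; exact hpF _
  have hcT : Filter.Tendsto c (𝓝 0) (𝓝 a) := by
    have := (hc 0 (by simp [hε])).continuousAt.tendsto
    rwa [hc0] at this
  have hIoo : ∀ᶠ t in 𝓝 (0 : ℝ), t ∈ Set.Ioo (0 - ε) (0 + ε) :=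
    Ioo_mem_nhds (by linarith) (by linarith)
  refine ⟨e' ∘ c, by rw [Function.comp_apply, hc0, hea], ?_⟩
  filter_upwards [hIoo, hcT.eventually hWF, hcT.eventually hWV, hcT.eventually hee',
    hcT.eventually he', hcT.eventually (heT.eventually hF)] with t h1 h2 h3 h4 h5 h6
  have hd : HasDerivAt c (W (c t)) t := by
    have h7 := hc t h1
    have h8 : W' (c t) = W (c t) := by
      have h9 : a + p (c t - a) = c t := by rw [hpid _ (hcF t h1)]; abel
      simp only [W']
      rw [h9, hpid _ (h2 (hcF t h1))]
    rwa [h8] at h7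
  have hdm : MDifferentiableAt 𝓘(ℝ, ℝ) 𝓘(ℝ, N.E) c t := hd.differentiableAt.mdifferentiableAt
  have h5' := h5.mdifferentiableAt (n := ∞) (by simp)
  refine ⟨h6.2 (by rw [h4]; exact hcF t h1), h5'.comp t hdm, ?_⟩
  rw [tangentMap_comp_at (f := c) (g := e') _ h5' hdm]
  have h7 : tangentMap 𝓘(ℝ, ℝ) 𝓘(ℝ, N.E) c ⟨t, (1 : ℝ)⟩ = ⟨c t, W (c t)⟩ := by
    have : mfderiv 𝓘(ℝ, ℝ) 𝓘(ℝ, N.E) c t (1 : ℝ) = W (c t) := by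
      rw [mfderiv_eq_fderiv]
      exact hd.deriv
    unfold tangentMap
    rw [this]
  rw [h7]
  unfold tangentMap
  simp only [Function.comp_apply]
  rw [h3]

/-- A map which is constant along the integral curves of a field in `P` is annihilated by it. -/
theorem IsSubmanifold.isDiff_zero_of_flow {P : Set N} (hP : IsSubmanifold P) {q : P → Q}
    (hq : SmoothOnSub P q) {W : Set (TangentBundle N.I N)}
    (hW : ∀ x y : P, FlowStep W P x y → q x = q y) (x : P) {V : (m : N) → TangentSpace N.I m}
    (hV : ContMDiffAt N.I N.I.tangent 1 (fun m => (⟨m, V m⟩ : TangentBundle N.I N)) (x : N))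
    (ht : ∀ᶠ m in 𝓝 (x : N), m ∈ P → (⟨m, V m⟩ : TangentBundle N.I N) ∈ tangentSet P)
    (hVW : ∀ m, m ∈ P → (⟨m, V m⟩ : TangentBundle N.I N) ∈ W) :
    IsDiff P q ⟨x, V x⟩ ⟨q x, 0⟩ := by
  obtain ⟨γ, hγ0, hγ⟩ := hP.exists_integralCurve x.2 hV ht
  obtain ⟨f, hf⟩ := hq x
  obtain ⟨ε, hε, hγ'⟩ := Metric.eventually_nhds_iff_ball.1 hγ
  have hγc : Filter.Tendsto γ (𝓝 0) (𝓝 (x : N)) := by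
    have := hγ.self_of_nhds.2.1.continuousAt.tendsto; rwa [hγ0] at this
  have hconst : (f ∘ γ) =ᶠ[𝓝 0] fun _ => q x := by
    filter_upwards [hγc.eventually hf.2, Metric.ball_mem_nhds (0 : ℝ) hε] with t h1 h2
    have hPt := (hγ' t h2).1
    rw [Function.comp_apply, h1 hPt]
    have hball : ∀ s, |s| ≤ |t| → s ∈ Metric.ball (0 : ℝ) ε := by
      intro s hs
      rw [Metric.mem_ball, Real.dist_eq, sub_zero] at h2 ⊢
      exact hs.trans_lt h2
    rcases le_total 0 t with h | h
    · refine (hW x ⟨γ t, hPt⟩ ⟨γ, 0, t, h, hγ0, rfl, fun s hs => ?_⟩).symm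
      have h3 := hγ' s (hball s (by rw [abs_of_nonneg hs.1, abs_of_nonneg h]; exact hs.2))
      exact ⟨h3.1, h3.2.1, by rw [h3.2.2]; exact hVW _ h3.1⟩
    · refine hW ⟨γ t, hPt⟩ x ⟨γ, t, 0, h, rfl, hγ0, fun s hs => ?_⟩
      have h3 := hγ' s (hball s (by
        rw [abs_of_nonpos hs.2, abs_of_nonpos h]; exact neg_le_neg hs.1))
      exact ⟨h3.1, h3.2.1, by rw [h3.2.2]; exact hVW _ h3.1⟩
  have h0 := hγ.self_of_nhds
  refine ⟨x.2, f, hf, ?_⟩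
  have hf' : MDifferentiableAt N.I Q.I f (γ 0) := by
    rw [hγ0]; exact hf.1.mdifferentiableAt (by simp)
  have h4 : tangentMap 𝓘(ℝ, ℝ) N.I γ ⟨0, (1 : ℝ)⟩ = ⟨x, V x⟩ := by
    rw [h0.2.2, hγ0]
  rw [← h4, ← tangentMap_comp_at (f := γ) (g := f) _ hf' h0.2.1,
    tangentMap_congr_of_eventuallyEq hconst]
  unfold tangentMap
  rw [mfderiv_const]
  rfl

/-- Two differentiable curves which agree on an interval have the same velocities there, including
at its end points. -/
theorem tangentMap_eq_of_eventually_Icc {a b t : ℝ} (hab : a < b) (ht : t ∈ Set.Icc a b)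
    {f g : ℝ → N} (hf : MDifferentiableAt 𝓘(ℝ, ℝ) N.I f t)
    (hg : MDifferentiableAt 𝓘(ℝ, ℝ) N.I g t) (h : ∀ᶠ s in 𝓝 t, s ∈ Set.Icc a b → f s = g s) :
    tangentMap 𝓘(ℝ, ℝ) N.I f ⟨t, (1 : ℝ)⟩ = tangentMap 𝓘(ℝ, ℝ) N.I g ⟨t, (1 : ℝ)⟩ := by
  have hu : UniqueMDiffWithinAt 𝓘(ℝ, ℝ) (Set.Icc a b) t :=
    (uniqueDiffOn_Icc hab t ht).uniqueMDiffWithinAt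
  rw [← tangentMapWithin_eq_tangentMap (p := ⟨t, (1 : ℝ)⟩) hu hf,
    ← tangentMapWithin_eq_tangentMap (p := ⟨t, (1 : ℝ)⟩) hu hg]
  have h1 : f =ᶠ[𝓝[Set.Icc a b] t] g := by
    filter_upwards [mem_nhdsWithin_of_mem_nhds h, self_mem_nhdsWithin] with s h1 h2 using h1 h2
  have h2 : f t = g t := h.self_of_nhds ht
  have h3 := h1.mfderivWithin_eq (I := 𝓘(ℝ, ℝ)) (I' := N.I) h2
  unfold tangentMapWithin
  rw [h3]
  congr 1

/-- The velocities of a differentiable curve in a submanifold are tangent to it. -/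
theorem IsSubmanifold.velocity_mem {P : Set N} (hP : IsSubmanifold P) {γ : ℝ → N} {a b : ℝ}
    (hab : a < b) (h : ∀ t ∈ Set.Icc a b, γ t ∈ P ∧ MDifferentiableAt 𝓘(ℝ, ℝ) N.I γ t) {t : ℝ}
    (ht : t ∈ Set.Icc a b) : tangentMap 𝓘(ℝ, ℝ) N.I γ ⟨t, (1 : ℝ)⟩ ∈ tangentSet P := by
  obtain ⟨r, hr⟩ := hP.exists_retraction (h t ht).1
  rw [mem_tangentSet_iff (r := r) hr,
    ← tangentMap_comp_at (f := γ) (g := r) _ hr.smooth.mdiff (h t ht).2]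
  refine tangentMap_eq_of_eventually_Icc hab ht (hr.smooth.mdiff.comp t (h t ht).2) (h t ht).2 ?_
  have hc : Filter.Tendsto γ (𝓝 t) (𝓝 (γ t)) := (h t ht).2.continuousAt
  filter_upwards [hc.eventually hr.eq] with s h1 h2
  exact h1 (h s h2).1

/-- A locally constant map on an interval takes the same value at both ends. -/
theorem eq_of_eventually_Icc {α : Type*} {a b : ℝ} (hab : a ≤ b) {g : Set.Icc a b → α}
    (h : ∀ t, ∀ᶠ s in 𝓝 t, g s = g t) :
    g ⟨a, Set.left_mem_Icc.2 hab⟩ = g ⟨b, Set.right_mem_Icc.2 hab⟩ := by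
  have : PreconnectedSpace (Set.Icc a b) := Subtype.preconnectedSpace isPreconnected_Icc
  exact ((IsLocallyConstant.iff_eventually_eq g).2 h).apply_eq_of_preconnectedSpace _ _

theorem eventually_Icc_of_forall {a b : ℝ} {p : ℝ → Prop} (t : Set.Icc a b)
    (h : ∀ᶠ s in 𝓝 (t : ℝ), p s) : ∃ U : Set ℝ, U ∈ 𝓝 (t : ℝ) ∧ U.OrdConnected ∧ ∀ s ∈ U, p s := by
  obtain ⟨ε, hε, h⟩ := Metric.eventually_nhds_iff_ball.1 h
  refine ⟨Metric.ball (t : ℝ) ε, Metric.ball_mem_nhds _ hε, ?_, h⟩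
  exact (convex_ball (t : ℝ) ε).ordConnected

/-- A curve in a manifold with zero velocity on an interval is constant there. -/
theorem eq_of_velocity_eq_zero {γ : ℝ → N} {a b : ℝ} (hab : a ≤ b)
    (h : ∀ t ∈ Set.Icc a b, MDifferentiableAt 𝓘(ℝ, ℝ) N.I γ t ∧
      mfderiv 𝓘(ℝ, ℝ) N.I γ t (1 : ℝ) = 0) : γ a = γ b := by
  refine eq_of_eventually_Icc hab (g := fun t => γ t) fun t => ?_
  set e := extChartAt N.I (γ t)
  have hc : Filter.Tendsto γ (𝓝 (t : ℝ)) (𝓝 (γ t)) := (h t t.2).1.continuousAt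
  obtain ⟨U, hU, hUo, hUe⟩ := eventually_Icc_of_forall t
    (hc.eventually (chart_source_mem_nhds N.H (γ t)))
  filter_upwards [continuousAt_subtype_val hU] with s hs
  have hsU : (s : ℝ) ∈ U := hs
  have htU : (t : ℝ) ∈ U := mem_of_mem_nhds hU
  have h1 : ∀ τ ∈ U ∩ Set.Icc a b, HasDerivAt (e ∘ γ) 0 τ := by
    rintro τ ⟨h2, h3⟩
    have h4 : MDifferentiableAt N.I 𝓘(ℝ, N.E) e (γ τ) := mdifferentiableAt_extChartAt (hUe τ h2)
    have h5 : MDifferentiableAt 𝓘(ℝ, ℝ) 𝓘(ℝ, N.E) (e ∘ γ) τ := h4.comp τ (h τ h3).1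
    have h6 : fderiv ℝ (e ∘ γ) τ 1 = 0 := by
      rw [← mfderiv_eq_fderiv, mfderiv_comp τ h4 (h τ h3).1]
      exact (congrArg (mfderiv N.I 𝓘(ℝ, N.E) e (γ τ)) (h τ h3).2).trans
        (map_zero (mfderiv N.I 𝓘(ℝ, N.E) e (γ τ)))
    have h7 := h5.differentiableAt.hasDerivAt
    rwa [show deriv (e ∘ γ) τ = 0 from h6] at h7
  have h8 : (e ∘ γ) s = (e ∘ γ) t := by
    have hconv : Convex ℝ (U ∩ Set.Icc a b) := hUo.convex.inter (convex_Icc a b)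
    rcases le_total (s : ℝ) t with hst | hst
    · have hsub : Set.Icc (s : ℝ) t ⊆ U ∩ Set.Icc a b :=
        (hUo.inter Set.ordConnected_Icc).out ⟨hsU, s.2⟩ ⟨htU, t.2⟩
      exact (constant_of_has_deriv_right_zero
        (fun τ hτ => (h1 τ (hsub hτ)).continuousAt.continuousWithinAt)
        (fun τ hτ => (h1 τ (hsub ⟨hτ.1, hτ.2.le⟩)).hasDerivWithinAt) t ⟨hst, le_rfl⟩).symm
    · have hsub : Set.Icc (t : ℝ) s ⊆ U ∩ Set.Icc a b :=
        (hUo.inter Set.ordConnected_Icc).out ⟨htU, t.2⟩ ⟨hsU, s.2⟩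
      exact constant_of_has_deriv_right_zero
        (fun τ hτ => (h1 τ (hsub hτ)).continuousAt.continuousWithinAt)
        (fun τ hτ => (h1 τ (hsub ⟨hτ.1, hτ.2.le⟩)).hasDerivWithinAt) s ⟨hst, le_rfl⟩
  refine e.injOn ?_ ?_ h8
  · rw [extChartAt_source]; exact hUe s hsU
  · rw [extChartAt_source]; exact hUe t htU

/-- Near a time `t` in the interval, the composition of a curve in `P` with a map on `P` is given by
a differentiable curve, namely the composition with a smooth extension of the map. -/
theorem IsSubmanifold.exists_comp_curve {P : Set N} (hP : IsSubmanifold P) {q : P → Q}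
    (hq : SmoothOnSub P q) {γ : ℝ → N} {a b : ℝ}
    (h : ∀ t ∈ Set.Icc a b, γ t ∈ P ∧ MDifferentiableAt 𝓘(ℝ, ℝ) N.I γ t) (t : Set.Icc a b) :
    ∃ (f : N → Q) (U : Set ℝ), U ∈ 𝓝 (t : ℝ) ∧ U.OrdConnected ∧
      ∀ s ∈ U, ∀ hs : s ∈ Set.Icc a b, f (γ s) = q ⟨γ s, (h s hs).1⟩ ∧
        MDifferentiableAt 𝓘(ℝ, ℝ) Q.I (f ∘ γ) s ∧
        IsDiff P q (tangentMap 𝓘(ℝ, ℝ) N.I γ ⟨s, (1 : ℝ)⟩)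
          (tangentMap 𝓘(ℝ, ℝ) Q.I (f ∘ γ) ⟨s, (1 : ℝ)⟩) := by
  obtain ⟨f, hf, hfs⟩ := hq.exists_smoothNear hP ⟨γ t, (h t t.2).1⟩
  have hc : Filter.Tendsto γ (𝓝 (t : ℝ)) (𝓝 (γ t)) := (h t t.2).2.continuousAt
  obtain ⟨U, hU, hUo, hUf⟩ := eventually_Icc_of_forall t
    (hc.eventually (hf.2.eventually_nhds.and hfs))
  refine ⟨f, U, hU, hUo, fun s hs hsab => ?_⟩
  obtain ⟨h1, h2⟩ := hUf s hs
  have h2' : MDifferentiableAt N.I Q.I f (γ s) := h2.mdifferentiableAt (by simp)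
  refine ⟨h1.self_of_nhds _, h2'.comp s (h s hsab).2, ?_⟩
  rw [tangentMap_comp_at (f := γ) (g := f) _ h2' (h s hsab).2]
  exact ⟨(h s hsab).1, f, ⟨h2, h1⟩, rfl⟩

/-- Integral curves in `P` of a field with values in `V` are mapped to classes of integral curves
in `P'` of a field with values in `V'`, if the differential of the map carries `V` into `V'`. -/
theorem IsSubmanifold.eqvGen_flowStep_map {P : Set N} (hP : IsSubmanifold P) {q : P → Q}
    (hq : SmoothOnSub P q) {V : Set (TangentBundle N.I N)} {V' : Set (TangentBundle Q.I Q)}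
    {P' : Set Q} (hP' : ∀ x, q x ∈ P')
    (hV : ∀ p r, p ∈ V → p ∈ tangentSet P → IsDiff P q p r → r ∈ V') {x y : P}
    (h : FlowStep V P x y) :
    Relation.EqvGen (FlowStep V' P') ⟨q x, hP' x⟩ ⟨q y, hP' y⟩ := by
  obtain ⟨γ, a, b, hab, ha, hb, hγ⟩ := h
  rcases hab.eq_or_lt with rfl | hlt
  · have : x = y := Subtype.ext (ha.symm.trans hb)
    rw [this]; exact Relation.EqvGen.refl _
  have hγ' : ∀ t ∈ Set.Icc a b, γ t ∈ P ∧ MDifferentiableAt 𝓘(ℝ, ℝ) N.I γ t :=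
    fun t ht => ⟨(hγ t ht).1, (hγ t ht).2.1⟩
  have key : ∀ t : Set.Icc a b, ∀ᶠ s : Set.Icc a b in 𝓝 t,
      Quot.mk (FlowStep V' P') ⟨q ⟨γ s, (hγ s s.2).1⟩, hP' _⟩ =
        Quot.mk (FlowStep V' P') ⟨q ⟨γ t, (hγ t t.2).1⟩, hP' _⟩ := by
    intro t
    obtain ⟨f, U, hU, hUo, hf⟩ := hP.exists_comp_curve hq hγ' t
    have step : ∀ s s' : Set.Icc a b, (s : ℝ) ∈ U → (s' : ℝ) ∈ U → (s : ℝ) ≤ s' →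
        FlowStep V' P' ⟨q ⟨γ s, (hγ s s.2).1⟩, hP' _⟩ ⟨q ⟨γ s', (hγ s' s'.2).1⟩, hP' _⟩ := by
      intro s s' hs hs' hss
      refine ⟨f ∘ γ, s, s', hss, (hf s hs s.2).1, (hf s' hs' s'.2).1, fun τ hτ => ?_⟩
      have h1 := hUo.out hs hs' hτ
      have h2 : τ ∈ Set.Icc a b := Set.ordConnected_Icc.out s.2 s'.2 hτ
      obtain ⟨h3, h4, h5⟩ := hf τ h1 h2
      refine ⟨?_, h4, hV _ _ (hγ τ h2).2.2 (hP.velocity_mem hlt hγ' h2) h5⟩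
      rw [Function.comp_apply, h3]; exact hP' _
    filter_upwards [continuousAt_subtype_val hU] with s hs
    rcases le_total (s : ℝ) t with hst | hst
    · exact Quot.sound (step s t hs (mem_of_mem_nhds hU) hst)
    · exact (Quot.sound (step t s (mem_of_mem_nhds hU) hs hst)).symm
  have h1 := Quot.eqvGen_exact (eq_of_eventually_Icc hab
    (g := fun t => Quot.mk (FlowStep V' P') ⟨q ⟨γ t, (hγ t t.2).1⟩, hP' _⟩) key)
  have hx : (⟨γ a, (hγ a (Set.left_mem_Icc.2 hab)).1⟩ : P) = x := Subtype.ext ha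
  have hy : (⟨γ b, (hγ b (Set.right_mem_Icc.2 hab)).1⟩ : P) = y := Subtype.ext hb
  subst hx hy
  exact h1

/-- A map on a submanifold is constant along integral curves of a field annihilated by its
differential. -/
theorem IsSubmanifold.eq_of_flowStep {P : Set N} (hP : IsSubmanifold P) {q : P → Q}
    (hq : SmoothOnSub P q) {V : Set (TangentBundle N.I N)}
    (hV : ∀ p r, p ∈ V → p ∈ tangentSet P → IsDiff P q p r → r.2 = 0) {x y : P}
    (h : FlowStep V P x y) : q x = q y := by
  have h1 := hP.eqvGen_flowStep_map hq (V' := {r | r.2 = 0}) (P' := Set.univ) (fun _ => trivial)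
    hV h
  have h2 : ∀ u v : (Set.univ : Set Q), FlowStep {r | r.2 = 0} Set.univ u v → (u : Q) = v := by
    rintro u v ⟨γ, a, b, hab, ha, hb, hγ⟩
    rw [← ha, ← hb]
    exact eq_of_velocity_eq_zero hab fun t ht => ⟨(hγ t ht).2.1, (hγ t ht).2.2⟩
  have h3 : ∀ u v : (Set.univ : Set Q), Relation.EqvGen (FlowStep {r | r.2 = 0} Set.univ) u v →
      (u : Q) = v := by
    intro u v huv
    induction huv with
    | rel _ _ h => exact h2 _ _ h
    | refl _ => rfl
    | symm _ _ _ ih => exact ih.symm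
    | trans _ _ _ _ _ ih1 ih2 => exact ih1.trans ih2
  exact h3 _ _ h1

end Mfd

/-! ### Brackets of vector fields and flows -/

namespace Mfd

variable {N Q Q' M : Mfd.{u}}

/-- The bracket of two vector fields is the commutator of derivations, on a vector space. -/
theorem fderiv_lieBracket {E E' : Type*} [NormedAddCommGroup E] [NormedSpace ℝ E]
    [NormedAddCommGroup E'] [NormedSpace ℝ E'] {G : E → E'} {V W : E → E} {a : E}
    (hG : ContDiffAt ℝ ∞ G a) (hV : DifferentiableAt ℝ V a) (hW : DifferentiableAt ℝ W a) :
    DifferentiableAt ℝ (fun u => fderiv ℝ G u (V u)) a ∧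
    DifferentiableAt ℝ (fun u => fderiv ℝ G u (W u)) a ∧
    fderiv ℝ G a (VectorField.lieBracket ℝ V W a) =
      fderiv ℝ (fun u => fderiv ℝ G u (W u)) a (V a) -
        fderiv ℝ (fun u => fderiv ℝ G u (V u)) a (W a) := by
  have h1 : DifferentiableAt ℝ (fderiv ℝ G) a :=
    (hG.fderiv_right (m := 1) (WithTop.coe_le_coe.2 (le_top : (1 + 1 : ℕ∞) ≤ ⊤))).differentiableAt
      (by simp)
  refine ⟨h1.clm_apply hV, h1.clm_apply hW, ?_⟩
  have hs : IsSymmSndFDerivAt ℝ G a := hG.isSymmSndFDerivAt (by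
    rw [minSmoothness_of_isRCLikeNormedField]
    exact WithTop.coe_le_coe.2 (le_top : (2 : ℕ∞) ≤ ⊤))
  rw [fderiv_clm_apply h1 hV, fderiv_clm_apply h1 hW]
  simp only [VectorField.lieBracket_eq, map_sub, add_apply, ContinuousLinearMap.comp_apply,
    ContinuousLinearMap.flip_apply]
  rw [hs.eq (V a) (W a)]
  abel

instance (N : Mfd.{u}) : IsManifold N.I (minSmoothness ℝ 2) N :=
  IsManifold.of_le (n := ∞) (by
    rw [minSmoothness_of_isRCLikeNormedField]
    exact WithTop.coe_le_coe.2 (le_top : (2 : ℕ∞) ≤ ⊤))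

/-- The derivative of a vector-valued function along a vector field. -/
def derivAlong {E' : Type*} [NormedAddCommGroup E'] [NormedSpace ℝ E'] (F : N → E')
    (V : (y : N) → TangentSpace N.I y) (y : N) : E' := mfderiv N.I 𝓘(ℝ, E') F y (V y)

/-- The bracket of two vector fields on a manifold is the commutator of derivations. -/
theorem derivAlong_mlieBracket {E' : Type*} [NormedAddCommGroup E'] [NormedSpace ℝ E'] {F : N → E'}
    {x : N} (hF : SmoothNear N.I 𝓘(ℝ, E') F x) {V W : (y : N) → TangentSpace N.I y}
    (hV : ContMDiff N.I N.I.tangent ∞ (fun m => (⟨m, V m⟩ : TangentBundle N.I N)))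
    (hW : ContMDiff N.I N.I.tangent ∞ (fun m => (⟨m, W m⟩ : TangentBundle N.I N))) :
    MDifferentiableAt N.I 𝓘(ℝ, E') (derivAlong F V) x ∧
    derivAlong F (VectorField.mlieBracket N.I V W) x =
      derivAlong (derivAlong F W) V x - derivAlong (derivAlong F V) W x := by
  set e := extChartAt N.I x with he
  set a := e x with ha
  have hea : e.symm a = x := e.left_inv (mem_extChartAt_source x)
  have hes := smoothNear_extChartAt x
  have hes' := smoothNear_extChartAt_symm x
  have heT : Filter.Tendsto e.symm (𝓝 a) (𝓝 x) := by
    have := hes'.tendsto; rwa [← he, ← ha, hea] at this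
  let G : N.E → E' := F ∘ e.symm
  have hG : SmoothNear 𝓘(ℝ, N.E) 𝓘(ℝ, E') G a := hF.comp_of_eq hes' hea
  have hinv : ∀ u ∈ e.target, (mfderiv 𝓘(ℝ, N.E) N.I e.symm u).IsInvertible := by
    intro u hu
    have := isInvertible_mfderivWithin_extChartAt_symm (I := N.I) hu
    rwa [N.I.range_eq_univ, mfderivWithin_univ] at this
  have htar : ∀ᶠ u in 𝓝 a, u ∈ e.target := extChartAt_target_mem_nhds (I := N.I) x
  have hmem : a ∈ e.target := htar.self_of_nhds
  let pull : ((y : N) → TangentSpace N.I y) → N.E → N.E := fun V =>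
    VectorField.mpullback 𝓘(ℝ, N.E) N.I e.symm V
  have hpull : ∀ (V : (y : N) → TangentSpace N.I y), ∀ u ∈ e.target,
      mfderiv 𝓘(ℝ, N.E) N.I e.symm u (pull V u) = V (e.symm u) := fun V u hu =>
    ((hinv u hu).inverse_apply_eq.1 rfl).symm
  -- derivatives along a field at a point of the chart
  have hder : ∀ (F : N → E') (V : (y : N) → TangentSpace N.I y), ∀ u ∈ e.target,
      ContMDiffAt 𝓘(ℝ, N.E) N.I ∞ e.symm u → MDifferentiableAt N.I 𝓘(ℝ, E') F (e.symm u) →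
      derivAlong F V (e.symm u) = fderiv ℝ (F ∘ e.symm) u (pull V u) := by
    intro F V u hu h1 h2
    rw [← mfderiv_eq_fderiv, mfderiv_comp u h2 (h1.mdifferentiableAt (by simp))]
    exact congrArg (mfderiv N.I 𝓘(ℝ, E') F (e.symm u)) (hpull V u hu).symm
  have key : ∀ V : (y : N) → TangentSpace N.I y,
      ContMDiff N.I N.I.tangent ∞ (fun m => (⟨m, V m⟩ : TangentBundle N.I N)) →
      DifferentiableAt ℝ (pull V) a ∧
      (derivAlong F V ∘ e.symm) =ᶠ[𝓝 a] fun u => fderiv ℝ G u (pull V u) := by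
    intro V hV
    constructor
    · refine ContDiffAt.differentiableAt (n := 1) ?_ (by simp)
      refine contMDiffAt_vectorSpace_iff_contDiffAt.1 ?_
      refine ContMDiffAt.mpullback_vectorField_preimage (n := ∞) ?_ hes'.at
        (hinv a hmem) (WithTop.coe_le_coe.2 (le_top : (1 + 1 : ℕ∞) ≤ ⊤))
      exact (hV _).of_le (by simp)
    · filter_upwards [htar, hes', heT.eventually hF] with u hu h2 h3
      exact hder F V u hu h2 (h3.mdifferentiableAt (by simp))
  obtain ⟨hV1, hV2⟩ := key V hV
  obtain ⟨hW1, hW2⟩ := key W hW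
  obtain ⟨hdV, hdW, hbr⟩ := fderiv_lieBracket hG.at.contDiffAt hV1 hW1
  have hdiff : ∀ V : (y : N) → TangentSpace N.I y,
      DifferentiableAt ℝ (fun u => fderiv ℝ G u (pull V u)) a →
      ((derivAlong F V ∘ e.symm) =ᶠ[𝓝 a] fun u => fderiv ℝ G u (pull V u)) →
      MDifferentiableAt N.I 𝓘(ℝ, E') (derivAlong F V) x := by
    intro V hd hV
    have h2 : MDifferentiableAt N.I 𝓘(ℝ, E') ((fun u => fderiv ℝ G u (pull V u)) ∘ e) x :=
      hd.mdifferentiableAt.comp x hes.mdiff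
    refine h2.congr_of_eventuallyEq ?_
    filter_upwards [hes.tendsto.eventually hV, extChartAt_source_mem_nhds (I := N.I) x] with y h3 h4
    rw [Function.comp_apply, ← h3, Function.comp_apply, e.left_inv h4]
  have hV3 := hdiff V hdV hV2
  have hW3 := hdiff W hdW hW2
  refine ⟨hV3, ?_⟩
  have hbr2 : pull (VectorField.mlieBracket N.I V W) a =
      VectorField.lieBracket ℝ (pull V) (pull W) a := by
    have h1 := VectorField.mpullback_mlieBracket (I := 𝓘(ℝ, N.E)) (I' := N.I) (V := V) (W := W)
      (f := e.symm) (x₀ := a) (n := ∞) ((hV _).mdifferentiableAt (by simp))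
      ((hW _).mdifferentiableAt (by simp)) hes'.at (by
        rw [minSmoothness_of_isRCLikeNormedField]
        exact WithTop.coe_le_coe.2 (le_top : (2 : ℕ∞) ≤ ⊤))
    rw [← VectorField.mlieBracketWithin_univ (I := 𝓘(ℝ, N.E)),
      VectorField.mlieBracketWithin_eq_lieBracketWithin] at h1
    exact h1.trans (congrFun (VectorField.lieBracketWithin_univ (V := pull V) (W := pull W)) a)
  rw [← hea] at hV3 hW3
  have e1 := hder F (VectorField.mlieBracket N.I V W) a hmem hes'.at (by rw [hea]; exact hF.mdiff)
  have e2 := hder (derivAlong F W) V a hmem hes'.at hW3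
  have e3 := hder (derivAlong F V) W a hmem hes'.at hV3
  rw [hW2.fderiv_eq] at e2
  rw [hV2.fderiv_eq] at e3
  rw [hbr2] at e1
  rw [← hea, e1, e2, e3]
  exact hbr

/-- The differential of `q` on a vector field `V` is constant along an integral curve of a field `W`
in the kernel of `dq`, if `[W, V]` is in the kernel of `dq` as well. -/
theorem isDiff_iff_of_flow {S : Set N} (hS : IsSubmanifold S) {q : S → Q} (hq : SmoothOnSub S q)
    {V W : (y : N) → TangentSpace N.I y}
    (hV : ContMDiff N.I N.I.tangent ∞ (fun m => (⟨m, V m⟩ : TangentBundle N.I N)))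
    (hW : ContMDiff N.I N.I.tangent ∞ (fun m => (⟨m, W m⟩ : TangentBundle N.I N)))
    (hVS : ∀ x ∈ S, (⟨x, V x⟩ : TangentBundle N.I N) ∈ tangentSet S)
    (hWS : ∀ x ∈ S, (⟨x, W x⟩ : TangentBundle N.I N) ∈ tangentSet S)
    (hWq : ∀ x : S, IsDiff S q ⟨x, W x⟩ ⟨q x, 0⟩)
    (hbS : ∀ x ∈ S, (⟨x, VectorField.mlieBracket N.I W V x⟩ : TangentBundle N.I N) ∈ tangentSet S)
    (hbq : ∀ x : S, IsDiff S q ⟨x, VectorField.mlieBracket N.I W V x⟩ ⟨q x, 0⟩)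
    {x y : S} (h : FlowStep {p | p.2 = W p.1} S x y) (r : TangentBundle Q.I Q) :
    IsDiff S q ⟨x, V x⟩ r ↔ IsDiff S q ⟨y, V y⟩ r := by
  obtain ⟨γ, a, b, hab, ha, hb, hγ⟩ := h
  have hγ' : ∀ t ∈ Set.Icc a b, γ t ∈ S ∧ MDifferentiableAt 𝓘(ℝ, ℝ) N.I γ t :=
    fun t ht => ⟨(hγ t ht).1, (hγ t ht).2.1⟩
  have hγq : ∀ s t, s ∈ Set.Icc a b → ∀ ht : t ∈ Set.Icc a b, ∀ hs : s ∈ Set.Icc a b,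
      q ⟨γ s, (hγ s hs).1⟩ = q ⟨γ t, (hγ t ht).1⟩ := by
    have h1 : ∀ s t, s ≤ t → ∀ (hs : s ∈ Set.Icc a b) (ht : t ∈ Set.Icc a b),
        q ⟨γ s, (hγ s hs).1⟩ = q ⟨γ t, (hγ t ht).1⟩ := by
      intro s t hst hs ht
      refine hS.eq_of_flowStep hq (V := {p | p.2 = W p.1}) ?_ ⟨γ, s, t, hst, rfl, rfl, fun τ hτ =>
        hγ τ (Set.ordConnected_Icc.out hs ht hτ)⟩
      rintro ⟨z, v⟩ r hv hz hr
      change v = W z at hv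
      subst hv
      have := hr.unique hz (hWq ⟨z, mem_of_mem_tangentSet hz⟩)
      rw [this]
    intro s t _ ht hs
    rcases le_total s t with h | h
    · exact h1 s t h hs ht
    · exact (h1 t s h ht hs).symm
  have key : ∀ t : Set.Icc a b, ∀ᶠ s : Set.Icc a b in 𝓝 t,
      {r | IsDiff S q ⟨γ s, V (γ s)⟩ r} = {r | IsDiff S q ⟨γ t, V (γ t)⟩ r} := by
    intro t
    obtain ⟨f, hf, hfs⟩ := hq.exists_smoothNear hS ⟨γ t, (hγ t t.2).1⟩
    have hfx : f (γ t) = q ⟨γ t, (hγ t t.2).1⟩ := hf.2.self_of_nhds (hγ t t.2).1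
    set e := extChartAt Q.I (f (γ t)) with he
    have hes : SmoothNear Q.I 𝓘(ℝ, Q.E) e (f (γ t)) := smoothNear_extChartAt _
    let F : N → Q.E := e ∘ f
    have hF : SmoothNear N.I 𝓘(ℝ, Q.E) F (γ t) := hes.comp hfs
    have hc : Filter.Tendsto γ (𝓝 (t : ℝ)) (𝓝 (γ t)) := (hγ t t.2).2.1.continuousAt
    -- derivatives of `F` along fields in the kernel of `dq`
    have hker : ∀ᶠ z in 𝓝 (γ t), ∀ hz : z ∈ S, ∀ v : TangentSpace N.I z,
        (⟨z, v⟩ : TangentBundle N.I N) ∈ tangentSet S → IsDiff S q ⟨z, v⟩ ⟨q ⟨z, hz⟩, 0⟩ →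
        mfderiv N.I 𝓘(ℝ, Q.E) F z v = 0 := by
      filter_upwards [hf.2.eventually_nhds, hfs, hfs.tendsto.eventually hes]
        with z h1 h2 h3 hz v hv hd
      have h2' := h2.mdifferentiableAt (n := ∞) (by simp)
      have h4 : IsLocalExt S q ⟨z, hz⟩ f := ⟨h2, h1⟩
      have h5 := ((IsDiff.mk_iff hv h4).1 hd).2
      rw [mfderiv_comp z (h3.mdifferentiableAt (by simp)) h2']
      exact (congrArg (mfderiv Q.I 𝓘(ℝ, Q.E) e (f z)) h5).trans (map_zero _)
    obtain ⟨U, hU, hUo, hUf⟩ := eventually_Icc_of_forall t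
      (hc.eventually (hker.eventually_nhds.and (hF.eventually_nhds.and
        (hfs.and (hf.2.eventually_nhds)))))
    have hh : ∀ τ ∈ U ∩ Set.Icc a b, HasDerivAt (derivAlong F V ∘ γ) 0 τ := by
      rintro τ ⟨h1, h2⟩
      obtain ⟨h3, h4, -⟩ := hUf τ h1
      have hτS : γ τ ∈ S := (hγ τ h2).1
      obtain ⟨h5, -⟩ := derivAlong_mlieBracket h4 hV hW
      obtain ⟨h5', h6⟩ := derivAlong_mlieBracket h4 hW hV
      -- `W(V(F)) = [W, V](F) + V(W(F))`; both terms vanish on `S`, the second one because `W(F)` is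
      -- zero on `S` and `V` is tangent to `S`
      have h7 : derivAlong F (VectorField.mlieBracket N.I W V) (γ τ) = 0 :=
        h3.self_of_nhds hτS _ (hbS _ hτS) (hbq ⟨γ τ, hτS⟩)
      have h8 : derivAlong (derivAlong F W) V (γ τ) = 0 := by
        have h9 := tangentMap_eq_of_eqOn (f := derivAlong F W) (g := fun _ => (0 : Q.E)) (hVS _ hτS)
          h5' mdifferentiableAt_const (by
            filter_upwards [h3] with z hz hzS
            exact hz hzS _ (hWS z hzS) (hWq ⟨z, hzS⟩))
        have h10 := eq_of_heq (Bundle.TotalSpace.mk.inj h9).2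
        refine h10.trans ?_
        simp only [mfderiv_const]
        rfl
      rw [h7, h8, sub_zero] at h6
      have h11 : MDifferentiableAt 𝓘(ℝ, ℝ) 𝓘(ℝ, Q.E) (derivAlong F V ∘ γ) τ :=
        h5.comp τ (hγ τ h2).2.1
      have h12 : fderiv ℝ (derivAlong F V ∘ γ) τ 1 = 0 := by
        rw [← mfderiv_eq_fderiv, mfderiv_comp τ h5 (hγ τ h2).2.1]
        have h13 : mfderiv 𝓘(ℝ, ℝ) N.I γ τ (1 : ℝ) = W (γ τ) := (hγ τ h2).2.2
        exact (congrArg (mfderiv N.I 𝓘(ℝ, Q.E) (derivAlong F V) (γ τ)) h13).trans h6.symm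
      have h14 := h11.differentiableAt.hasDerivAt
      rwa [show deriv (derivAlong F V ∘ γ) τ = 0 from h12] at h14
    filter_upwards [continuousAt_subtype_val hU] with s hs
    have hsU : (s : ℝ) ∈ U := hs
    have htU : (t : ℝ) ∈ U := mem_of_mem_nhds hU
    have h8 : derivAlong F V (γ s) = derivAlong F V (γ t) := by
      rcases le_total (s : ℝ) t with hst | hst
      · have hsub : Set.Icc (s : ℝ) t ⊆ U ∩ Set.Icc a b :=
          (hUo.inter Set.ordConnected_Icc).out ⟨hsU, s.2⟩ ⟨htU, t.2⟩
        exact (constant_of_has_deriv_right_zero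
          (fun τ hτ => (hh τ (hsub hτ)).continuousAt.continuousWithinAt)
          (fun τ hτ => (hh τ (hsub ⟨hτ.1, hτ.2.le⟩)).hasDerivWithinAt) t ⟨hst, le_rfl⟩).symm
      · have hsub : Set.Icc (t : ℝ) s ⊆ U ∩ Set.Icc a b :=
          (hUo.inter Set.ordConnected_Icc).out ⟨htU, t.2⟩ ⟨hsU, s.2⟩
        exact constant_of_has_deriv_right_zero
          (fun τ hτ => (hh τ (hsub hτ)).continuousAt.continuousWithinAt)
          (fun τ hτ => (hh τ (hsub ⟨hτ.1, hτ.2.le⟩)).hasDerivWithinAt) s ⟨hst, le_rfl⟩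
    have h9 : f (γ s) = f (γ t) := by
      rw [hfx, (hUf s hsU).2.2.2.self_of_nhds (hγ s s.2).1]
      exact hγq s t s.2 t.2 s.2
    have hfs' : MDifferentiableAt N.I Q.I f (γ s) :=
      (hUf s hsU).2.2.1.mdifferentiableAt (by simp)
    have hes' : MDifferentiableAt Q.I 𝓘(ℝ, Q.E) e (f (γ s)) := by rw [h9]; exact hes.mdiff
    have h10 : tangentMap N.I Q.I f ⟨γ s, V (γ s)⟩ = tangentMap N.I Q.I f ⟨γ t, V (γ t)⟩ := by
      obtain ⟨w, hw⟩ := exists_eq_mk (p := tangentMap N.I Q.I f ⟨γ s, V (γ s)⟩) h9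
      have h11 : tangentMap Q.I 𝓘(ℝ, Q.E) e (tangentMap N.I Q.I f ⟨γ s, V (γ s)⟩) =
          tangentMap Q.I 𝓘(ℝ, Q.E) e (tangentMap N.I Q.I f ⟨γ t, V (γ t)⟩) := by
        rw [← tangentMap_comp_at (f := f) (g := e) _ hes' hfs',
          ← tangentMap_comp_at (f := f) (g := e) _ hes.mdiff hfs.mdiff]
        unfold tangentMap
        rw [Bundle.TotalSpace.mk.injEq]
        exact ⟨congrArg e h9, heq_of_eq h8⟩
      rw [hw] at h11 ⊢
      have h12 := eq_of_heq (Bundle.TotalSpace.mk.inj h11).2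
      have hinj := (isInvertible_mfderiv_extChartAt (I := Q.I)
        (mem_extChartAt_source (I := Q.I) (f (γ t)))).bijective.injective h12
      rw [show w = mfderiv N.I Q.I f (γ t) (V (γ t)) from hinj]
      rfl
    have hls : IsLocalExt S q ⟨γ s, (hγ s s.2).1⟩ f :=
      ⟨(hUf s hsU).2.2.1, (hUf s hsU).2.2.2⟩
    have h13 : ∀ (τ : ℝ) (hτ : γ τ ∈ S), IsLocalExt S q ⟨γ τ, hτ⟩ f → ∀ r,
        (IsDiff S q ⟨γ τ, V (γ τ)⟩ r ↔ tangentMap N.I Q.I f ⟨γ τ, V (γ τ)⟩ = r) := by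
      intro τ hτ hfτ r
      exact ⟨fun hr => hr.tangentMap_eq (hVS _ hτ) hfτ, fun hr => ⟨hτ, f, hfτ, hr⟩⟩
    ext r
    change IsDiff S q ⟨γ s, V (γ s)⟩ r ↔ IsDiff S q ⟨γ t, V (γ t)⟩ r
    rw [h13 s _ hls, h13 t _ hf, h10]
  have h1 := eq_of_eventually_Icc hab (g := fun t => {r | IsDiff S q ⟨γ t, V (γ t)⟩ r}) key
  rw [← ha, ← hb]
  exact Set.ext_iff.1 h1 r

end Mfd

/-! ### Compatibility of Courant morphisms with the anchors -/

theorem ActionSpace.IsCourant.ρ_zero {A : ActionSpace.{u}} (hA : A.IsCourant) (x : A.N) :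
    A.ρ 0 x = 0 := by
  simpa using hA.smul 0 0 x

namespace AmbSection

variable {A : ActionSpace.{u}} {M : Mfd.{u}}

theorem contMDiff_smul_X {N : Mfd.{u}} {f : N × M → ℝ} (hf : ContMDiff (N.I.prod M.I) 𝓘(ℝ, ℝ) ∞ f)
    {X : (p : N × M) → TangentSpace M.I p.2}
    (hX : ContMDiff (N.I.prod M.I) M.I.tangent ∞ fun p => (⟨p.2, X p⟩ : TangentBundle M.I M)) :
    ContMDiff (N.I.prod M.I) M.I.tangent ∞ fun p => (⟨p.2, f p • X p⟩ : TangentBundle M.I M) := by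
  intro p
  have h := (Bundle.contMDiffAt_totalSpace.1 (hX p))
  refine Bundle.contMDiffAt_totalSpace.2 ⟨h.1, ?_⟩
  refine ((hf p).smul h.2).congr_of_eventuallyEq ?_
  have hb := (trivializationAt M.E (TangentSpace M.I) p.2).open_baseSet.mem_nhds
    (mem_baseSet_trivializationAt M.E (TangentSpace M.I) p.2)
  filter_upwards [continuousAt_snd.eventually hb] with y hy
  exact ((trivializationAt M.E (TangentSpace M.I) p.2).linear ℝ hy).2 _ _

theorem contMDiff_smul_α {N : Mfd.{u}} {f : N × M → ℝ} (hf : ContMDiff (N.I.prod M.I) 𝓘(ℝ, ℝ) ∞ f)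
    {α : (p : N × M) → (TangentSpace M.I p.2 →L[ℝ] ℝ)}
    (hα : ContMDiff (N.I.prod M.I) (M.I.prod 𝓘(ℝ, M.E →L[ℝ] ℝ)) ∞
      fun p => Bundle.TotalSpace.mk' (M.E →L[ℝ] ℝ)
        (E := fun x : M => TangentSpace M.I x →L[ℝ] Bundle.Trivial M ℝ x) p.2 (α p)) :
    ContMDiff (N.I.prod M.I) (M.I.prod 𝓘(ℝ, M.E →L[ℝ] ℝ)) ∞
      fun p => Bundle.TotalSpace.mk' (M.E →L[ℝ] ℝ)
        (E := fun x : M => TangentSpace M.I x →L[ℝ] Bundle.Trivial M ℝ x) p.2 (f p • α p) := by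
  intro p
  have h := (Bundle.contMDiffAt_totalSpace.1 (hα p))
  refine Bundle.contMDiffAt_totalSpace.2 ⟨h.1, ?_⟩
  refine ((hf p).smul h.2).congr_of_eventuallyEq ?_
  set t := trivializationAt (M.E →L[ℝ] ℝ)
    (fun x : M => TangentSpace M.I x →L[ℝ] Bundle.Trivial M ℝ x) p.2
  have hb := t.open_baseSet.mem_nhds (mem_baseSet_trivializationAt (M.E →L[ℝ] ℝ)
    (fun x : M => TangentSpace M.I x →L[ℝ] Bundle.Trivial M ℝ x) p.2)
  filter_upwards [continuousAt_snd.eventually hb] with y hy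
  exact (t.linear ℝ hy).2 _ _

theorem contMDiff_α_X {N : Mfd.{u}} {α : (p : N × M) → (TangentSpace M.I p.2 →L[ℝ] ℝ)}
    (hα : ContMDiff (N.I.prod M.I) (M.I.prod 𝓘(ℝ, M.E →L[ℝ] ℝ)) ∞
      fun p => Bundle.TotalSpace.mk' (M.E →L[ℝ] ℝ)
        (E := fun x : M => TangentSpace M.I x →L[ℝ] Bundle.Trivial M ℝ x) p.2 (α p))
    {X : (p : N × M) → TangentSpace M.I p.2}
    (hX : ContMDiff (N.I.prod M.I) M.I.tangent ∞ fun p => (⟨p.2, X p⟩ : TangentBundle M.I M)) :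
    ContMDiff (N.I.prod M.I) 𝓘(ℝ, ℝ) ∞ fun p => α p (X p) := by
  intro p
  have h := ContMDiffAt.clm_bundle_apply (F₁ := M.E) (F₂ := ℝ)
    (E₁ := fun x : M => TangentSpace M.I x)
    (E₂ := Bundle.Trivial M ℝ) (b := fun p : N × M => p.2) (ϕ := α) (v := X) (hα p) (hX p)
  exact (Bundle.contMDiffAt_totalSpace.1 h).2

end AmbSection

/-- Smooth functions separate tangent vectors. -/
theorem Mfd.eq_of_forall_mfderiv_eq {N : Mfd.{u}} {x : N} {v w : TangentSpace N.I x}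
    (h : ∀ g : N → ℝ, ContMDiff N.I 𝓘(ℝ, ℝ) ∞ g →
      mfderiv N.I 𝓘(ℝ, ℝ) g x v = mfderiv N.I 𝓘(ℝ, ℝ) g x w) : v = w := by
  have hinj := (isInvertible_mfderiv_extChartAt (I := N.I)
    (mem_extChartAt_source (I := N.I) x)).injective
  refine hinj ?_
  rw [← sub_eq_zero]
  refine (Module.forall_dual_apply_eq_zero_iff ℝ _).1 fun l => ?_
  let L : N.E →L[ℝ] ℝ := LinearMap.toContinuousLinearMap l
  obtain ⟨b⟩ : Nonempty (SmoothBumpFunction N.I x) := inferInstance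
  have hg : ContMDiff N.I 𝓘(ℝ, N.E) ∞ fun y => b y • extChartAt N.I x y :=
    b.contMDiff_smul (contMDiffOn_extChartAt)
  have h1 := h (fun y => L (b y • extChartAt N.I x y)) (L.contMDiff.comp hg)
  have h2 : (fun y => L (b y • extChartAt N.I x y)) =ᶠ[𝓝 x] L ∘ extChartAt N.I x := by
    filter_upwards [b.eventuallyEq_one] with y hy
    simp [hy]
  have h3 := h2.mfderiv_eq (I := N.I) (I' := 𝓘(ℝ, ℝ))
  have h4 : mfderiv N.I 𝓘(ℝ, ℝ) (L ∘ extChartAt N.I x) x =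
      (mfderiv 𝓘(ℝ, N.E) 𝓘(ℝ, ℝ) L (extChartAt N.I x x)).comp
        (mfderiv N.I 𝓘(ℝ, N.E) (extChartAt N.I x) x) :=
    mfderiv_comp x (L.differentiableAt.mdifferentiableAt)
      (mdifferentiableAt_extChartAt (mem_chart_source N.H x))
  have h5 : mfderiv 𝓘(ℝ, N.E) 𝓘(ℝ, ℝ) L (extChartAt N.I x x) = L := by
    rw [mfderiv_eq_fderiv]
    exact L.fderiv
  have h6 := (congrArg (fun T : N.E →L[ℝ] ℝ => T v) (h3.trans h4)).symm.trans
    (h1.trans (congrArg (fun T : N.E →L[ℝ] ℝ => T w) (h3.trans h4)))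
  have h7 : L (mfderiv N.I 𝓘(ℝ, N.E) (extChartAt N.I x) x v) =
      L (mfderiv N.I 𝓘(ℝ, N.E) (extChartAt N.I x) x w) := by
    have := h6
    simp only [h5] at this
    exact this
  rw [map_sub]
  exact sub_eq_zero.2 h7

namespace QHam

variable {A : ActionSpace.{u}} {X : QHam A} {μ : X.M → A.N}

theorem IsCourantMorphism.rel_zero (hμ : X.IsCourantMorphism μ) (m : X.M) :
    X.Rel m (0, 0, 0) (μ m) := by
  refine (hμ.lagrangian m _).2 fun z' _ => ?_
  simp [AmbSection.pairing]

theorem IsCourantMorphism.rel_add_smul (hμ : X.IsCourantMorphism μ) {m : X.M}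
    {z z' : A.d × TangentSpace X.M.I m × (TangentSpace X.M.I m →L[ℝ] ℝ)}
    (h : X.Rel m z (μ m)) (h' : X.Rel m z' (μ m)) (a : ℝ) : X.Rel m (z + a • z') (μ m) := by
  refine (hμ.lagrangian m _).2 fun w hw => ?_
  have h1 := (hμ.lagrangian m _).1 h w hw
  have h2 := (hμ.lagrangian m _).1 h' w hw
  simp only [AmbSection.pairing, Prod.fst_add, Prod.snd_add, Prod.smul_fst, Prod.smul_snd, map_add,
    map_smul, add_apply, smul_apply, LinearMap.add_apply, LinearMap.smul_apply, smul_eq_mul]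
    at h1 h2 ⊢
  linear_combination h1 + a * h2

/-- A section `f • e` of the ambient bundle with `f = 0` along the graph of `μ` is a section of `R`,
and its bracket with a section `e₁` of `R` is `(a(e₁) f) • e` on the graph. Hence these multiples
of `e` lie in `R`. Case of the factor `T*M`. -/
theorem IsCourantMorphism.rel_der_smul_covector (hA : A.IsCourant)
    (hμ : X.IsCourantMorphism μ) {e₁ e : AmbSection A.d A.N X.M}
    (h₁ : e₁.Smooth) (h₁R : ∀ m, X.Rel m (e₁.val (μ m, m)) (μ m)) (he : e.Smooth)
    {f : A.N × X.M → ℝ} (hf : ContMDiff (A.N.I.prod X.M.I) 𝓘(ℝ, ℝ) ∞ f)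
    (hfμ : ∀ m, f (μ m, m) = 0) (m : X.M) :
    X.Rel m (0, 0, e₁.der f (μ m, m) • e.α (μ m, m)) (μ m) := by
  let e₂ : AmbSection A.d A.N X.M :=
    { ξ := fun _ => 0, X := fun _ => 0, α := fun p => f p • e.α p }
  have h₂ : e₂.Smooth := by
    refine ⟨fun l => ?_, ?_, AmbSection.contMDiff_smul_α hf he.α⟩
    · simpa [e₂] using contMDiff_const
    · have := AmbSection.contMDiff_smul_X (f := fun _ => (0 : ℝ)) contMDiff_const he.X
      simpa only [zero_smul] using this
  have h₂R : ∀ m, X.Rel m (e₂.val (μ m, m)) (μ m) := by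
    intro m
    have : e₂.val (μ m, m) = (0, 0, 0) := by
      simp [AmbSection.val, e₂, hfμ]
    rw [this]
    exact hμ.rel_zero m
  have hanchor : e₂.anchor = 0 := by
    funext p
    exact Prod.ext (hA.ρ_zero p.1) rfl
  have hbr1 : ∀ e' : AmbSection A.d A.N X.M, ∀ p, AmbSection.brM e' e₂ p = 0 := by
    intro e' p
    simp only [AmbSection.brM, hanchor, VectorField.mlieBracket_zero_right]
    rfl
  have hbr2 : ∀ e' : AmbSection A.d A.N X.M, ∀ p, AmbSection.brM e₂ e' p = 0 := by
    intro e' p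
    simp only [AmbSection.brM, hanchor, VectorField.mlieBracket_zero_left]
    rfl
  have hder2 : ∀ g p, e₂.der g p = 0 := by
    intro g p
    simp only [AmbSection.der, hanchor]
    exact map_zero _
  have hderc : ∀ (e' : AmbSection A.d A.N X.M) (c : ℝ) p, e'.der (fun _ => c) p = 0 := by
    intro e' c p
    simp only [AmbSection.der, mfderiv_const]
    rfl
  refine hμ.involutive e₁ e₂ h₁ h₂ h₁R h₂R m _ fun e₃ h₃ => ?_
  have hprod : e₁.der (fun y => e₂.α y (e₃.X y)) (μ m, m) =
      e₁.der f (μ m, m) * e.α (μ m, m) (e₃.X (μ m, m)) := by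
    have hk := AmbSection.contMDiff_α_X he.α h₃.X
    have h1 : (fun y => e₂.α y (e₃.X y)) = fun y => f y * (e.α y (e₃.X y)) := rfl
    rw [h1]
    have h2 : HasMFDerivAt (A.N.I.prod X.M.I) 𝓘(ℝ, ℝ) (f * fun y => e.α y (e₃.X y)) (μ m, m) _ :=
      HasMFDerivAt.mul ((hf.mdifferentiable (by simp)) (μ m, m)).hasMFDerivAt
      ((hk.mdifferentiable (by simp)) (μ m, m)).hasMFDerivAt
    have h3 : (fun y => f y * (e.α y (e₃.X y))) = f * fun y => e.α y (e₃.X y) := rfl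
    simp only [AmbSection.der]
    rw [h3, h2.mfderiv, hfμ]
    have key : ∀ (L L' : (A.N.E × X.M.E) →L[ℝ] ℝ) (v : A.N.E × X.M.E) (c : ℝ),
        ((0 : ℝ) • L + c • L') v = L' v * c := by
      intro L L' v c
      simp [mul_comm]
    exact key _ _ _ _
  simp only [AmbSection.bracketForm, hbr1, hbr2, hder2, hprod, AmbSection.pairing]
  simp [e₂, hfμ, hderc, AmbSection.val]

/-- The bracket of anchors with the anchor of `f • ξ₀` has no component in `TM` where `f` vanishes:
the anchor of `f • ξ₀` is `f` times a field which is tangent to `N`. -/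
theorem brM_smul_eq_zero (hA : A.IsCourant) {M : Mfd.{u}} (e₁ : AmbSection A.d A.N M) (ξ₀ : A.d)
    {f : A.N × M → ℝ} (hf : ContMDiff (A.N.I.prod M.I) 𝓘(ℝ, ℝ) ∞ f) {p : A.N × M} (hfp : f p = 0)
    {e₂ : AmbSection A.d A.N M} (hξ : ∀ y, e₂.ξ y = f y • ξ₀) (hX : ∀ y, e₂.X y = 0) :
    AmbSection.brM e₁ e₂ p = 0 ∧ AmbSection.brM e₂ e₁ p = 0 := by
  let W : (y : A.N × M) → TangentSpace (A.N.I.prod M.I) y := fun y =>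
    ((A.ρ ξ₀ y.1, 0) : A.N.E × M.E)
  have hW : ContMDiff (A.N.I.prod M.I) (A.N.I.prod M.I).tangent ∞
      (fun y => (⟨y, W y⟩ : TangentBundle (A.N.I.prod M.I) (A.N × M))) := by
    have h1 : ContMDiff (A.N.I.prod M.I) (A.N.I.tangent.prod M.I.tangent) ∞
        (fun y : A.N × M => ((⟨y.1, A.ρ ξ₀ y.1⟩ : TangentBundle A.N.I A.N),
          (⟨y.2, 0⟩ : TangentBundle M.I M))) := by
      refine ContMDiff.prodMk ?_ ?_
      · exact (hA.smooth ξ₀).comp contMDiff_fst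
      · exact (Bundle.contMDiff_zeroSection ℝ (TangentSpace M.I)).comp contMDiff_snd
    exact (contMDiff_equivTangentBundleProd_symm (I := A.N.I) (I' := M.I) (M := A.N) (M' := M)).comp
      h1
  have he : e₂.anchor = f • W := by
    funext y
    refine Prod.ext ?_ ?_
    · change A.ρ (e₂.ξ y) y.1 = f y • A.ρ ξ₀ y.1
      rw [hξ, hA.smul]
    · change e₂.X y = f y • (0 : M.E)
      rw [hX, smul_zero]
      rfl
  have hf' := (hf.mdifferentiable (by simp)) p
  have hW' := (hW.mdifferentiable (by simp)) p
  have h1 := VectorField.mlieBracket_smul_right (V := e₁.anchor) hf' hW'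
  have h2 := VectorField.mlieBracket_smul_left (W := e₁.anchor) hf' hW'
  rw [hfp] at h1 h2
  have key : ∀ (c : ℝ) (b : A.N.E × M.E),
      (c • ((A.ρ ξ₀ p.1, 0) : A.N.E × M.E) + (0 : ℝ) • b).2 = 0 := by
    intro c b
    simp
  constructor
  · simp only [AmbSection.brM, he]
    exact (congrArg Prod.snd h1).trans (key _ _)
  · simp only [AmbSection.brM, he]
    exact (congrArg Prod.snd h2).trans (key _ _)

/-- The analogue of `IsCourantMorphism.rel_der_smul_covector` for the factor `d × N`. -/
theorem IsCourantMorphism.rel_der_smul (hA : A.IsCourant)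
    (hμ : X.IsCourantMorphism μ) {e₁ : AmbSection A.d A.N X.M}
    (h₁ : e₁.Smooth) (h₁R : ∀ m, X.Rel m (e₁.val (μ m, m)) (μ m)) (ξ₀ : A.d)
    {f : A.N × X.M → ℝ} (hf : ContMDiff (A.N.I.prod X.M.I) 𝓘(ℝ, ℝ) ∞ f)
    (hfμ : ∀ m, f (μ m, m) = 0) (m : X.M) :
    X.Rel m (e₁.der f (μ m, m) • ξ₀, 0, 0) (μ m) := by
  let e₂ : AmbSection A.d A.N X.M :=
    { ξ := fun p => f p • ξ₀, X := fun _ => 0, α := fun p => 0 }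
  have h₂ : e₂.Smooth := by
    refine ⟨fun l => ?_, ?_, ?_⟩
    · exact (hf.mul (contMDiff_const (c := l ξ₀))).congr fun p => by simp [e₂]
    · have := AmbSection.contMDiff_smul_X (f := fun _ => (0 : ℝ)) contMDiff_const h₁.X
      simpa only [zero_smul] using this
    · have := AmbSection.contMDiff_smul_α (f := fun _ => (0 : ℝ)) contMDiff_const h₁.α
      simpa only [zero_smul] using this
  have h₂R : ∀ m, X.Rel m (e₂.val (μ m, m)) (μ m) := by
    intro m
    have : e₂.val (μ m, m) = (0, 0, 0) := by
      simp [AmbSection.val, e₂, hfμ]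
    rw [this]
    exact hμ.rel_zero m
  have hanchor : e₂.anchor (μ m, m) = 0 := by
    refine Prod.ext ?_ rfl
    change A.ρ (f (μ m, m) • ξ₀) (μ m) = 0
    rw [hfμ, zero_smul, hA.ρ_zero]
  have hbr := fun e' : AmbSection A.d A.N X.M =>
    brM_smul_eq_zero hA e' ξ₀ hf (hfμ m) (e₂ := e₂) (fun _ => rfl) (fun _ => rfl)
  have hder2 : ∀ g, e₂.der g (μ m, m) = 0 := by
    intro g
    simp only [AmbSection.der, hanchor]
    exact map_zero _
  have hderc : ∀ (e' : AmbSection A.d A.N X.M) (c : ℝ) p, e'.der (fun _ => c) p = 0 := by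
    intro e' c p
    simp only [AmbSection.der, mfderiv_const]
    rfl
  refine hμ.involutive e₁ e₂ h₁ h₂ h₁R h₂R m _ fun e₃ h₃ => ?_
  have hprod : e₁.der (fun y => A.d.form (e₂.ξ y) (e₃.ξ (μ m, m))) (μ m, m) =
      e₁.der f (μ m, m) * A.d.form ξ₀ (e₃.ξ (μ m, m)) := by
    have h1 : (fun y => A.d.form (e₂.ξ y) (e₃.ξ (μ m, m))) =
        fun y => f y * A.d.form ξ₀ (e₃.ξ (μ m, m)) := by
      funext y
      simp [e₂]
    rw [h1]
    have h2 := HasMFDerivAt.mul ((hf.mdifferentiable (by simp)) (μ m, m)).hasMFDerivAt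
      (hasMFDerivAt_const (I := A.N.I.prod X.M.I) (I' := 𝓘(ℝ, ℝ))
        (A.d.form ξ₀ (e₃.ξ (μ m, m))) (μ m, m))
    have h3 : (fun y => f y * A.d.form ξ₀ (e₃.ξ (μ m, m))) =
      f * fun y => A.d.form ξ₀ (e₃.ξ (μ m, m)) := rfl
    simp only [AmbSection.der]
    rw [h3, h2.mfderiv, hfμ]
    have key : ∀ (L L' : (A.N.E × X.M.E) →L[ℝ] ℝ) (v : A.N.E × X.M.E) (c : ℝ),
        ((0 : ℝ) • L + c • L') v = L' v * c := by
      intro L L' v c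
      simp [mul_comm]
    exact key _ _ _ _
  simp only [AmbSection.bracketForm, hbr, hder2, hprod, AmbSection.pairing]
  simp [e₂, hfμ, hderc, AmbSection.val]

/-- The relation `R` is compatible with the anchors: `v + α ∼_R ξ` implies `dμ(v) = ρ(ξ)`.
Otherwise some function vanishing on the graph of `μ` has nonzero derivative along `(ρ(ξ), v)`;
then all of `d` and all covectors occurring in `R` are in `R`, so that `d = 0` and `v ∼_R 0`. -/
theorem IsQuasiHamiltonian.mfderiv_eq (hX : X.IsQuasiHamiltonian) (hμ : X.IsCourantMorphism μ)
    {m : X.M} {ξ : A.d} {v : TangentSpace X.M.I m} {α : TangentSpace X.M.I m →L[ℝ] ℝ}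
    (h : X.Rel m (ξ, v, α) (μ m)) : mfderiv X.M.I A.N.I μ m v = A.ρ ξ (μ m) := by
  have hA := hX.action
  obtain ⟨e₁, h₁, h₁R, hval⟩ := hμ.subbundle m _ h
  refine Mfd.eq_of_forall_mfderiv_eq fun g hg => ?_
  let f : A.N × X.M → ℝ := fun p => g (μ p.2) - g p.1
  have hf : ContMDiff (A.N.I.prod X.M.I) 𝓘(ℝ, ℝ) ∞ f :=
    ((hg.comp hμ.smooth_map).comp contMDiff_snd).sub (hg.comp contMDiff_fst)
  have hfμ : ∀ m, f (μ m, m) = 0 := fun m => sub_self _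
  -- the derivative of `f` along the anchor `(ρ(ξ), v)` measures the failure of the claim on `g`
  have hder : e₁.der f (μ m, m) = mfderiv A.N.I 𝓘(ℝ, ℝ) g (μ m) (mfderiv X.M.I A.N.I μ m v) -
      mfderiv A.N.I 𝓘(ℝ, ℝ) g (μ m) (A.ρ ξ (μ m)) := by
    have hg' : MDifferentiableAt A.N.I 𝓘(ℝ, ℝ) g (μ m) := (hg.mdifferentiable (by simp)) _
    have hμ' : MDifferentiableAt X.M.I A.N.I μ m := (hμ.smooth_map.mdifferentiable (by simp)) _
    have h1 : HasMFDerivAt (A.N.I.prod X.M.I) 𝓘(ℝ, ℝ) ((g ∘ μ) ∘ Prod.snd) (μ m, m) _ :=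
      HasMFDerivAt.comp (x := (μ m, m)) (HasMFDerivAt.comp m hg'.hasMFDerivAt hμ'.hasMFDerivAt)
        (hasMFDerivAt_snd (I := A.N.I) (I' := X.M.I) _)
    have h2 : HasMFDerivAt (A.N.I.prod X.M.I) 𝓘(ℝ, ℝ) (g ∘ Prod.fst) (μ m, m) _ :=
      HasMFDerivAt.comp (x := (μ m, m)) hg'.hasMFDerivAt
        (hasMFDerivAt_fst (I := A.N.I) (I' := X.M.I) _)
    have h3 : HasMFDerivAt (A.N.I.prod X.M.I) 𝓘(ℝ, ℝ) f (μ m, m) _ := h1.sub h2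
    have h4 : e₁.anchor (μ m, m) = ((A.ρ ξ (μ m), v) : A.N.E × X.M.E) := by
      have ha : e₁.ξ (μ m, m) = ξ := congrArg Prod.fst hval
      have hb : e₁.X (μ m, m) = v := congrArg (fun z => z.2.1) hval
      simp only [AmbSection.anchor, ha, hb]
      rfl
    simp only [AmbSection.der]
    rw [h3.mfderiv, h4]
    rfl
  refine sub_eq_zero.1 (hder.symm.trans ?_)
  by_contra hD
  have hrel := fun ξ₀ => hμ.rel_der_smul hA h₁ h₁R ξ₀ hf hfμ m
  -- all of `d` lies in the isotropic `R`, so that `d = 0`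
  have hform : ∀ ξ₀ η : A.d, A.d.form ξ₀ η = 0 := by
    intro ξ₀ η
    have h1 := (hμ.lagrangian m _).1 (hrel ξ₀) _ (hrel η)
    simp only [AmbSection.pairing, map_smul, LinearMap.smul_apply, map_zero, smul_eq_mul,
      add_zero, sub_zero, mul_eq_zero] at h1
    exact (h1.resolve_left hD).resolve_left hD
  have hd : ∀ ξ₀ : A.d, ξ₀ = 0 := fun ξ₀ => A.d.form_nondeg _ (hform ξ₀)
  -- all covectors `α` with `w + α ∼_R η` lie in `R`, so that they annihilate `v`
  have hv : v = 0 := by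
    refine hX.m2 m v (μ m) ((hμ.lagrangian m _).2 fun z' hz' => ?_)
    obtain ⟨e, he, heR, heval⟩ := hμ.subbundle m _ hz'
    have h1 := hμ.rel_der_smul_covector hA h₁ h₁R he hf hfμ m
    have h2 := (hμ.lagrangian m _).1 h _ h1
    have h3 : e.α (μ m, m) = z'.2.2 := congrArg (fun z => z.2.2) heval
    rw [h3] at h2
    simp only [AmbSection.pairing, hform, map_zero, smul_apply, smul_eq_mul,
      zero_add, zero_sub, neg_eq_zero, mul_eq_zero] at h2
    have h4 : z'.2.2 v = 0 := h2.resolve_left hD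
    simp [AmbSection.pairing, h4]
  refine hD (hder.trans ?_)
  rw [hv, hd ξ, hA.ρ_zero]
  have : ∀ (L : A.N.E →L[ℝ] ℝ) (L' : X.M.E →L[ℝ] A.N.E), L (L' 0) - L 0 = 0 := by
    intro L L'
    simp
  exact this _ _

end QHam

/-! ### Existence, uniqueness and smoothness of the vector fields generated by `h` -/

/-- `(U₁ ∩ U₂)^⊥ ⊆ U₁^⊥ + U₂^⊥` for a nondegenerate symmetric form in finite dimension. -/
theorem exists_add_of_orthogonal_inf {V : Type*} [AddCommGroup V] [Module ℝ V]
    [FiniteDimensional ℝ V] (B : LinearMap.BilinForm ℝ V) (hs : ∀ x y, B x y = B y x)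
    (hn : ∀ x, (∀ y, B x y = 0) → x = 0) (U₁ U₂ : Submodule ℝ V) {x : V}
    (hx : ∀ y ∈ U₁, y ∈ U₂ → B y x = 0) :
    ∃ x₁ x₂, (∀ y ∈ U₁, B y x₁ = 0) ∧ (∀ y ∈ U₂, B y x₂ = 0) ∧ x₁ + x₂ = x := by
  have hr : B.IsRefl := fun x y h => by rw [hs, h]
  have hN : B.Nondegenerate := (LinearMap.IsRefl.nondegenerate_iff_separatingLeft hr).2 hn
  have h1 : B.orthogonal (B.orthogonal U₁ ⊔ B.orthogonal U₂) ≤ U₁ ⊓ U₂ := by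
    refine le_inf ?_ ?_
    · refine (LinearMap.BilinForm.orthogonal_le le_sup_left).trans ?_
      rw [LinearMap.BilinForm.orthogonal_orthogonal hN hr]
    · refine (LinearMap.BilinForm.orthogonal_le le_sup_right).trans ?_
      rw [LinearMap.BilinForm.orthogonal_orthogonal hN hr]
  have h2 := LinearMap.BilinForm.orthogonal_le (B := B) h1
  rw [LinearMap.BilinForm.orthogonal_orthogonal hN hr] at h2
  have h3 : x ∈ B.orthogonal (U₁ ⊓ U₂) := fun y hy => hx y hy.1 hy.2
  obtain ⟨a, ha, b, hb, hab⟩ := Submodule.mem_sup.1 (h2 h3)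
  exact ⟨a, b, ha, hb, hab⟩

namespace AmbSection

/-- The fibre metric `AmbSection.pairing` as a bilinear form, with `E` for the tangent space. -/
def pairingForm (d : QuadLieAlg.{u}) (E : Type u) [NormedAddCommGroup E] [NormedSpace ℝ E] :
    LinearMap.BilinForm ℝ (d × E × (E →L[ℝ] ℝ)) :=
  LinearMap.mk₂ ℝ (fun a b => d.form a.1 b.1 - (a.2.2 b.2.1 + b.2.2 a.2.1))
    (fun a a' b => by simp; ring) (fun r a b => by simp; ring)
    (fun a b b' => by simp; ring) (fun r a b => by simp; ring)

variable (d : QuadLieAlg.{u}) (E : Type u) [NormedAddCommGroup E] [NormedSpace ℝ E]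

theorem pairingForm_symm (x y : d × E × (E →L[ℝ] ℝ)) :
    pairingForm d E x y = pairingForm d E y x := by
  simp only [pairingForm, LinearMap.mk₂_apply, d.form_symm x.1 y.1]
  ring

theorem pairingForm_nondeg [FiniteDimensional ℝ E] (x : d × E × (E →L[ℝ] ℝ))
    (h : ∀ y, pairingForm d E x y = 0) : x = 0 := by
  simp only [pairingForm, LinearMap.mk₂_apply] at h
  refine Prod.ext (d.form_nondeg _ fun y => ?_) (Prod.ext ?_ ?_)
  · simpa using h (y, 0, 0)
  · refine (Module.forall_dual_apply_eq_zero_iff ℝ _).1 fun l => ?_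
    simpa using h (0, 0, LinearMap.toContinuousLinearMap l)
  · ext v
    simpa using h (0, v, 0)

end AmbSection

namespace QHam

variable {A : ActionSpace.{u}} {X : QHam A} {μ : X.M → A.N}

/-- The fibre of `R` over the point `(μ m, m)` of the graph. -/
def IsCourantMorphism.fibre (hμ : X.IsCourantMorphism μ) (m : X.M) :
    Submodule ℝ (A.d × X.M.E × (X.M.E →L[ℝ] ℝ)) where
  carrier := {z | X.Rel m z (μ m)}
  zero_mem' := hμ.rel_zero m
  add_mem' := by
    intro a b ha hb
    have h : a + (1 : ℝ) • b = a + b := by rw [one_smul]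
    exact h ▸ hμ.rel_add_smul ha hb 1
  smul_mem' := by
    intro r a ha
    have := hμ.rel_add_smul (hμ.rel_zero m) ha r
    have h0 : ((0, 0, 0) : A.d × TangentSpace X.M.I m × (TangentSpace X.M.I m →L[ℝ] ℝ)) = 0 := rfl
    rwa [h0, zero_add] at this

/-- The fibres of `R` are Lagrangian. -/
theorem IsCourantMorphism.mem_fibre_iff (hμ : X.IsCourantMorphism μ) (m : X.M)
    (z : A.d × X.M.E × (X.M.E →L[ℝ] ℝ)) : z ∈ hμ.fibre m ↔
      ∀ z' ∈ hμ.fibre m, AmbSection.pairingForm A.d X.M.E z z' = 0 :=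
  hμ.lagrangian m z

/-- Every `ξ ∈ h` is related to a vector: `R + T M` contains `h + TM = (h + TM)^⊥`, as
`R ∩ (d + TM) ⊆ h + TM`. -/
theorem IsQuasiHamiltonian.exists_rel (hX : X.IsQuasiHamiltonian) (hμ : X.IsCourantMorphism μ)
    {ξ : A.d} (hξ : ξ ∈ X.h) (m : X.M) :
    ∃ v : TangentSpace X.M.I m, X.Rel m (ξ, v, 0) (μ m) := by
  let K : Submodule ℝ (A.d × X.M.E × (X.M.E →L[ℝ] ℝ)) :=
    LinearMap.ker ((LinearMap.snd ℝ X.M.E (X.M.E →L[ℝ] ℝ)).comp (LinearMap.snd ℝ A.d _))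
  obtain ⟨⟨a, b, c⟩, ⟨a', b', c'⟩, h1, h2, h3⟩ := exists_add_of_orthogonal_inf
    (AmbSection.pairingForm A.d X.M.E)
    (AmbSection.pairingForm_symm _ _) (AmbSection.pairingForm_nondeg _ _)
    (hμ.fibre m) K (x := (ξ, 0, 0)) (by
      rintro ⟨ξ', v', α'⟩ hy (hy' : α' = 0)
      subst hy'
      have h1 : ξ' ∈ X.h := hX.m1 m ξ' v' _ hy
      have h2 : ξ' ∈ A.d.perp X.h := by
        rw [hX.lagrangian]
        exact h1
      have h3 : A.d.form ξ' ξ = 0 := h2 ξ hξ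
      simp [AmbSection.pairingForm, h3])
  have ha' : a' = 0 := by
    refine A.d.form_nondeg _ fun y => ?_
    have := h2 (y, 0, 0) rfl
    rw [A.d.form_symm]
    simpa [AmbSection.pairingForm] using this
  have hc' : c' = 0 := by
    ext w
    have := h2 (0, w, 0) rfl
    simpa [AmbSection.pairingForm] using this
  have ha : a = ξ := by
    have := congrArg Prod.fst h3
    simpa [ha'] using this
  have hc : c = 0 := by
    have := congrArg (fun z => z.2.2) h3
    simpa [hc'] using this
  subst ha hc
  refine ⟨b, (hμ.mem_fibre_iff m _).2 fun z' hz' => ?_⟩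
  exact (AmbSection.pairingForm_symm _ _ _ _).trans (h1 z' hz')

theorem IsQuasiHamiltonian.rel_unique (hX : X.IsQuasiHamiltonian) (hμ : X.IsCourantMorphism μ)
    {ξ : A.d} {m : X.M} {v v' : TangentSpace X.M.I m} (h : X.Rel m (ξ, v, 0) (μ m))
    (h' : X.Rel m (ξ, v', 0) (μ m)) : v = v' := by
  have := hμ.rel_add_smul h h' (-1)
  refine sub_eq_zero.1 (hX.m2 m _ (μ m) ?_)
  convert this using 1
  simp [sub_eq_add_neg]

/-- All covectors occur in `R`, since `v ∼_R 0` holds for `v = 0` only. -/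
theorem IsQuasiHamiltonian.exists_rel_covector (hX : X.IsQuasiHamiltonian)
    (hμ : X.IsCourantMorphism μ) (m : X.M) (α : TangentSpace X.M.I m →L[ℝ] ℝ) :
    ∃ ξ v, X.Rel m (ξ, v, α) (μ m) := by
  let K : Submodule ℝ (A.d × X.M.E × (X.M.E →L[ℝ] ℝ)) :=
    LinearMap.ker (LinearMap.fst ℝ A.d (X.M.E × (X.M.E →L[ℝ] ℝ))) ⊓
    LinearMap.ker ((LinearMap.snd ℝ X.M.E (X.M.E →L[ℝ] ℝ)).comp (LinearMap.snd ℝ A.d _))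
  obtain ⟨⟨a, b, c⟩, ⟨a', b', c'⟩, h1, h2, h3⟩ := exists_add_of_orthogonal_inf
    (AmbSection.pairingForm A.d X.M.E)
    (AmbSection.pairingForm_symm _ _) (AmbSection.pairingForm_nondeg _ _)
    (hμ.fibre m) K (x := (0, 0, α)) (by
      rintro ⟨ξ', v', α'⟩ hy ⟨(hξ : ξ' = 0), (hy' : α' = 0)⟩
      subst hy' hξ
      have h1 : v' = 0 := hX.m2 m v' _ hy
      subst h1
      exact LinearMap.congr_fun (map_zero (AmbSection.pairingForm A.d X.M.E)) _)
  have hc' : c' = 0 := by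
    ext w
    have := h2 (0, w, 0) ⟨rfl, rfl⟩
    simpa [AmbSection.pairingForm] using this
  have hc : c = α := by
    have := congrArg (fun z => z.2.2) h3
    simpa [hc'] using this
  subst hc
  refine ⟨a, b, (hμ.mem_fibre_iff m _).2 fun z' hz' => ?_⟩
  exact (AmbSection.pairingForm_symm _ _ _ _).trans (h1 z' hz')

/-- If `v + α ∼_R ξ` and `α` vanishes on `(dμ)⁻¹(F)` for a subspace `F ⊆ TN`, then `α = dμ^*β` with
`β ∈ ann(F)`, and `dμ^*β ∼_R ρ^*β`. So `v` is related to `ξ - ρ^*β`. -/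
theorem IsQuasiHamiltonian.exists_rel_of_annihilates (hX : X.IsQuasiHamiltonian)
    (hμ : X.IsCourantMorphism μ) {m : X.M} {ξ : A.d} {v : TangentSpace X.M.I m}
    {α : TangentSpace X.M.I m →L[ℝ] ℝ} (h : X.Rel m (ξ, v, α) (μ m))
    (F : Submodule ℝ (TangentSpace A.N.I (μ m)))
    (hα : ∀ w, mfderiv X.M.I A.N.I μ m w ∈ F → α w = 0) :
    ∃ ζ : A.d, (∀ η, A.ρ η (μ m) ∈ F → A.d.form ζ η = 0) ∧ X.Rel m (ξ - ζ, v, 0) (μ m) := by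
  have hA := hX.action
  let T : TangentSpace X.M.I m →ₗ[ℝ] (TangentSpace A.N.I (μ m) ⧸ F) :=
    F.mkQ.comp (mfderiv X.M.I A.N.I μ m).toLinearMap
  have h1 : (α : TangentSpace X.M.I m →ₗ[ℝ] ℝ) ∈ LinearMap.range T.dualMap := by
    rw [LinearMap.range_dualMap_eq_dualAnnihilator_ker, Submodule.mem_dualAnnihilator]
    intro w hw
    refine hα w ?_
    have : F.mkQ (mfderiv X.M.I A.N.I μ m w) = 0 := hw
    simpa using this
  obtain ⟨β, hβ⟩ := h1
  let ρβ : Module.Dual ℝ A.d :=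
    { toFun := fun η => β (F.mkQ (A.ρ η (μ m)))
      map_add' := fun a b => by rw [hA.add]; simp
      map_smul' := fun r a => by rw [hA.smul]; simp }
  have hr : A.d.form.IsRefl := fun x y h => by rw [A.d.form_symm, h]
  have hN : A.d.form.Nondegenerate :=
    (LinearMap.IsRefl.nondegenerate_iff_separatingLeft hr).2 A.d.form_nondeg
  let ζ : A.d := (A.d.form.toDual hN).symm ρβ
  have hζ : ∀ η, A.d.form ζ η = β (F.mkQ (A.ρ η (μ m))) := fun η =>
    LinearMap.BilinForm.apply_toDual_symm_apply (hB := hN) _ η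
  have hαβ : ∀ w, α w = β (F.mkQ (mfderiv X.M.I A.N.I μ m w)) := fun w =>
    (LinearMap.congr_fun hβ w).symm
  refine ⟨ζ, fun η hη => ?_, ?_⟩
  · rw [hζ, (Submodule.Quotient.mk_eq_zero F).2 hη |> (fun h => (h : F.mkQ _ = 0)), map_zero]
  · have h2 : X.Rel m (ζ, 0, α) (μ m) := by
      refine (hμ.lagrangian m _).2 fun z' hz' => ?_
      have h3 := hX.mfderiv_eq hμ hz'
      simp only [AmbSection.pairing, hζ, hαβ, h3, map_zero, add_zero, sub_self]
    have h3 := hμ.rel_add_smul h h2 (-1)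
    have h4 : ∀ (x y : A.d) (w : X.M.E) (γ : X.M.E →L[ℝ] ℝ),
        (x, w, γ) + (-1 : ℝ) • (y, (0 : X.M.E), γ) = (x - y, w, 0) := by
      intro x y w γ
      refine Prod.ext (by simp [sub_eq_add_neg]) (Prod.ext (by simp) ?_)
      ext w'
      change γ w' + (-1 : ℝ) * γ w' = 0
      ring
    exact (congrArg (fun z => X.Rel m z (μ m)) (h4 ξ ζ v α)).mp h3

/-- The vector fields generated by `h` are of class `C¹`: in terms of local sections
`(ξᵢ, Xᵢ + αᵢ)` of `R` for which the `αᵢ` are a frame of `T*M`, the field `V` of `ξ` is the solution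
of `αᵢ(V) = ⟨ξ, ξᵢ⟩`. -/
theorem IsQuasiHamiltonian.contMDiffAt_of_rel (hX : X.IsQuasiHamiltonian)
    (hμ : X.IsCourantMorphism μ) {ξ : A.d} {V : (m : X.M) → TangentSpace X.M.I m}
    (hV : ∀ m, X.Rel m (ξ, V m, 0) (μ m)) (m : X.M) :
    ContMDiffAt X.M.I X.M.I.tangent 1 (fun m => (⟨m, V m⟩ : TangentBundle X.M.I X.M)) m := by
  let t := trivializationAt X.M.E (TangentSpace X.M.I) m
  have hm : m ∈ t.baseSet := mem_baseSet_trivializationAt X.M.E (TangentSpace X.M.I) m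
  have hb : ∀ᶠ y in 𝓝 m, y ∈ t.baseSet := t.open_baseSet.mem_nhds hm
  let b := Module.finBasis ℝ X.M.E
  have hsec : ∀ i, ∃ e : AmbSection A.d A.N X.M, e.Smooth ∧
      (∀ m', X.Rel m' (e.val (μ m', m')) (μ m')) ∧ e.α (μ m, m) =
        (LinearMap.toContinuousLinearMap (b.coord i)).comp (t.continuousLinearMapAt ℝ m) := by
    intro i
    obtain ⟨η, v, h⟩ := hX.exists_rel_covector hμ m
      ((LinearMap.toContinuousLinearMap (b.coord i)).comp (t.continuousLinearMapAt ℝ m))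
    obtain ⟨e, he, heR, hval⟩ := hμ.subbundle m _ h
    exact ⟨e, he, heR, congrArg (fun z => z.2.2) hval⟩
  choose e he heR heα using hsec
  have hgr : ContMDiff X.M.I (A.N.I.prod X.M.I) ∞ fun m : X.M => (μ m, m) :=
    hμ.smooth_map.prodMk contMDiff_id
  -- the covectors `αᵢ` read in the trivialization
  let a : Fin (Module.finrank ℝ X.M.E) → X.M → X.M.E →L[ℝ] ℝ := fun i y =>
    ((e i).α (μ y, y)).comp (t.symmL ℝ y)
  have ha : ∀ i, ContMDiffAt X.M.I 𝓘(ℝ, X.M.E →L[ℝ] ℝ) ∞ (a i) m := by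
    intro i
    have h1 := ((he i).α.comp hgr) m
    have h2 := ((contMDiffAt_hom_bundle _).1 h1).2
    refine h2.congr_of_eventuallyEq (Filter.Eventually.of_forall fun y => ?_)
    ext w
    simp only [ContinuousLinearMap.inCoordinates, ContinuousLinearMap.comp_apply]
    exact congrArg (fun L : ℝ →L[ℝ] ℝ => L (a i y w))
      (Bundle.Trivial.continuousLinearMapAt_trivialization ℝ X.M ℝ y).symm
  let T : X.M → X.M.E →L[ℝ] (Fin (Module.finrank ℝ X.M.E) → ℝ) := fun y =>
    ContinuousLinearMap.pi fun i => a i y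
  have hT : ContMDiffAt X.M.I 𝓘(ℝ, X.M.E →L[ℝ] (Fin (Module.finrank ℝ X.M.E) → ℝ)) ∞ T m := by
    let P : (Fin (Module.finrank ℝ X.M.E) → X.M.E →L[ℝ] ℝ) →ₗ[ℝ]
        (X.M.E →L[ℝ] (Fin (Module.finrank ℝ X.M.E) → ℝ)) :=
      { toFun := ContinuousLinearMap.pi, map_add' := fun _ _ => rfl, map_smul' := fun _ _ => rfl }
    exact (LinearMap.toContinuousLinearMap P).contMDiff.contMDiffAt.comp m
      (contMDiffAt_pi_space.2 ha)
  let c : X.M → (Fin (Module.finrank ℝ X.M.E) → ℝ) := fun y i => A.d.form ξ ((e i).ξ (μ y, y))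
  have hc : ContMDiffAt X.M.I 𝓘(ℝ, Fin (Module.finrank ℝ X.M.E) → ℝ) ∞ c m := by
    refine contMDiffAt_pi_space.2 fun i => ?_
    exact (((he i).ξ (A.d.form ξ)).comp hgr) m
  have hsol : ∀ᶠ y in 𝓝 m, T y (t.continuousLinearMapAt ℝ y (V y)) = c y := by
    filter_upwards [hb] with y hy
    funext i
    have h1 := (hμ.lagrangian y _).1 (hV y) _ (heR i y)
    have h2 : t.symmL ℝ y (t.continuousLinearMapAt ℝ y (V y)) = V y :=
      t.symmL_continuousLinearMapAt hy _
    change (e i).α (μ y, y) (t.symmL ℝ y (t.continuousLinearMapAt ℝ y (V y))) = _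
    rw [h2]
    simp only [AmbSection.pairing, AmbSection.val, zero_apply, zero_add] at h1
    exact (sub_eq_zero.1 h1).symm
  let Θ : X.M.E ≃L[ℝ] (Fin (Module.finrank ℝ X.M.E) → ℝ) := b.equivFun.toContinuousLinearEquiv
  have hTm : T m = Θ := by
    ext w i
    change (e i).α (μ m, m) (t.symmL ℝ m w) = b.repr w i
    rw [heα]
    change b.coord i (t.continuousLinearMapAt ℝ m (t.symmL ℝ m w)) = _
    rw [t.continuousLinearMapAt_symmL hm]
    rfl
  have hinv : ∀ᶠ y in 𝓝 m, ∃ Θ' : X.M.E ≃L[ℝ] (Fin (Module.finrank ℝ X.M.E) → ℝ), T y = Θ' := by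
    have h1 := ContinuousLinearEquiv.nhds Θ
    rw [← hTm] at h1
    filter_upwards [hT.continuousAt.eventually h1] with y hy
    obtain ⟨Θ', h⟩ := hy
    exact ⟨Θ', h.symm⟩
  have hVt : ContMDiffAt X.M.I 𝓘(ℝ, X.M.E) ∞
      (fun y => ContinuousLinearMap.inverse (T y) (c y)) m := by
    have h1 : ContMDiffAt X.M.I 𝓘(ℝ, (Fin (Module.finrank ℝ X.M.E) → ℝ) →L[ℝ] X.M.E) ∞
        (fun y => ContinuousLinearMap.inverse (T y)) m := by
      have h2 : ContDiffAt ℝ ∞ ContinuousLinearMap.inverse (T m) := by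
        rw [hTm]
        exact contDiffAt_map_inverse Θ
      exact h2.contMDiffAt.comp m hT
    exact h1.clm_apply hc
  refine (Bundle.contMDiffAt_totalSpace.2 ⟨contMDiffAt_id, ?_⟩ : ContMDiffAt _ _ ∞ _ m).of_le
    (WithTop.coe_le_coe.2 le_top)
  refine hVt.congr_of_eventuallyEq ?_
  filter_upwards [hb, hinv, hsol] with y hy ⟨Θ', hΘ⟩ hs
  rw [← hs, hΘ, ContinuousLinearMap.inverse_equiv]
  refine Eq.trans ?_ (Θ'.symm_apply_apply _).symm
  exact (t.continuousLinearMapAt_apply_of_mem ℝ hy _).symm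

end QHam

/-! ### Graphs and clean intersections -/

namespace Mfd

variable {N M Q : Mfd.{u}}

/-- The graph `{(f m, m)}` of a map `f : M → N`. -/
def graphOf (f : M → N) : Set (N.prod M) := {p | p.1 = f p.2}

/-- The projection of `N × M` onto `N`. -/
def prodFst (p : N.prod M) : N := p.1

/-- The projection of `N × M` onto `M`. -/
def prodSnd (p : N.prod M) : M := p.2

theorem contMDiff_prodFst : ContMDiff (N.prod M).I N.I ∞ (prodFst (N := N) (M := M)) :=
  contMDiff_fst (I := N.I) (J := M.I)

theorem contMDiff_prodSnd : ContMDiff (N.prod M).I M.I ∞ (prodSnd (N := N) (M := M)) :=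
  contMDiff_snd (I := N.I) (J := M.I)

/-- Tangent vectors of a product are determined by their projections. -/
theorem eq_of_tangentMap_fst_snd {p p' : TangentBundle (N.prod M).I (N.prod M)}
    (h₁ : tangentMap (N.prod M).I N.I prodFst p = tangentMap (N.prod M).I N.I prodFst p')
    (h₂ : tangentMap (N.prod M).I M.I prodSnd p = tangentMap (N.prod M).I M.I prodSnd p') :
    p = p' := by
  have e1 : ∀ p, tangentMap (N.prod M).I N.I prodFst p = ⟨p.1.1, p.2.1⟩ := fun p =>
    tangentMap_prodFst (I := N.I) (I' := M.I) (M := N) (M' := M)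
  have e2 : ∀ p, tangentMap (N.prod M).I M.I prodSnd p = ⟨p.1.2, p.2.2⟩ := fun p =>
    tangentMap_prodSnd (I := N.I) (I' := M.I) (M := N) (M' := M)
  exact (equivTangentBundleProd N.I N M.I M).injective
    (Prod.ext ((e1 p).symm.trans (h₁.trans (e1 p'))) ((e2 p).symm.trans (h₂.trans (e2 p'))))

theorem tangentMap_comp_of_contMDiff {f : N → M} {g : M → Q} (hg : ContMDiff M.I Q.I ∞ g)
    (hf : ContMDiff N.I M.I ∞ f) (p : TangentBundle N.I N) :
    tangentMap N.I Q.I (g ∘ f) p = tangentMap M.I Q.I g (tangentMap N.I M.I f p) :=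
  tangentMap_comp_at (f := f) (g := g) p ((hg.mdifferentiable (by simp)) _)
    ((hf.mdifferentiable (by simp)) _)

section Graph

variable {f : M → N}

/-- The map `m ↦ (f m, m)`. -/
def graphMap (f : M → N) (m : M) : N.prod M := (f m, m)

theorem contMDiff_graphMap (hf : ContMDiff M.I N.I ∞ f) :
    ContMDiff M.I (N.prod M).I ∞ (graphMap f) :=
  hf.prodMk (contMDiff_id (I := M.I))

theorem tangentMap_fst_graphMap (hf : ContMDiff M.I N.I ∞ f) (p : TangentBundle M.I M) :
    tangentMap (N.prod M).I N.I prodFst (tangentMap M.I (N.prod M).I (graphMap f) p) =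
      tangentMap M.I N.I f p :=
  (tangentMap_comp_of_contMDiff contMDiff_prodFst (contMDiff_graphMap hf) p).symm

theorem tangentMap_snd_graphMap (hf : ContMDiff M.I N.I ∞ f) (p : TangentBundle M.I M) :
    tangentMap (N.prod M).I M.I prodSnd (tangentMap M.I (N.prod M).I (graphMap f) p) = p := by
  refine (tangentMap_comp_of_contMDiff contMDiff_prodSnd (contMDiff_graphMap hf) p).symm.trans ?_
  have : (prodSnd (N := N) (M := M)) ∘ graphMap f = id := rfl
  rw [this, tangentMap_id]
  rfl

/-- Vectors tangent to the graph are determined by their projections to `TM`. -/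
theorem tangentMap_graphMap_snd (hf : ContMDiff M.I N.I ∞ f)
    {p : TangentBundle (N.prod M).I (N.prod M)} (hp : p ∈ tangentSet (graphOf f)) :
    tangentMap M.I (N.prod M).I (graphMap f) (tangentMap (N.prod M).I M.I prodSnd p) = p := by
  have h1 := tangentMap_comp_of_contMDiff (contMDiff_graphMap hf)
    (contMDiff_prodSnd (N := N) (M := M)) p
  refine h1.symm.trans ?_
  have h2 := tangentMap_eq_of_eqOn (I := (N.prod M).I) (f := graphMap f ∘ prodSnd) (g := id) hp
    ((((contMDiff_graphMap hf).comp contMDiff_prodSnd).mdifferentiable (by simp)) _)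
    mdifferentiableAt_id (Filter.Eventually.of_forall fun y (hy : y.1 = f y.2) =>
      Prod.ext hy.symm rfl)
  refine h2.trans ?_
  rw [tangentMap_id]
  rfl

/-- A preimage `f⁻¹(S)`, where the graph of `f` is clean with respect to `S × M`, is a
submanifold. -/
theorem CleanInter.isSubmanifold_preimage {S : Set N} (hf : ContMDiff M.I N.I ∞ f)
    (h : CleanInter (graphOf f) {p : N.prod M | p.1 ∈ S}) : IsSubmanifold (f ⁻¹' S) := by
  refine isSubmanifold_of_exists_retraction fun m hm => ?_
  obtain ⟨r, hr⟩ := h.1.exists_retraction (x := graphMap f m) ⟨rfl, hm⟩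
  have hg : SmoothNear M.I (N.prod M).I (graphMap f) m :=
    smoothNear_of_contMDiff (contMDiff_graphMap hf) m
  have htend := hg.tendsto
  refine ⟨fun y => (r (graphMap f y)).2, ?_, ?_, ?_⟩
  · exact SmoothNear.comp (smoothNear_of_contMDiff contMDiff_prodSnd _) (hr.smooth.comp hg)
  · filter_upwards [htend.eventually hr.mem] with y hy
    have h1 : (r (graphMap f y)).1 = f (r (graphMap f y)).2 := hy.1
    change f (r (graphMap f y)).2 ∈ S
    rw [← h1]
    exact hy.2
  · filter_upwards [htend.eventually hr.eq] with y hy hyS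
    exact congrArg (prodSnd (N := N) (M := M)) (hy ⟨rfl, hyS⟩)

/-- The tangent bundle of `f⁻¹(S)`, where the graph of `f` is clean with respect to `S × M`. -/
theorem CleanInter.mem_tangentSet_preimage_iff {S : Set N} (hf : ContMDiff M.I N.I ∞ f)
    (h : CleanInter (graphOf f) {p : N.prod M | p.1 ∈ S}) (p : TangentBundle M.I M) :
    p ∈ tangentSet (f ⁻¹' S) ↔ tangentMap M.I N.I f p ∈ tangentSet S := by
  refine ⟨fun hp => tangentMap_mem_tangentSet hp hf.contMDiffAt (Filter.Eventually.of_forall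
    fun y hy => hy), fun hp => ?_⟩
  let P := tangentMap M.I (N.prod M).I (graphMap f) p
  obtain ⟨γ, hγ, hγp⟩ := exists_curve p
  have h1 : P ∈ tangentSet (graphOf f) := by
    refine ⟨graphMap f ∘ γ, (contMDiff_graphMap hf).contMDiffAt.comp _ hγ,
      Filter.Eventually.of_forall fun t => rfl, ?_⟩
    refine (tangentMap_comp_at (f := γ) (g := graphMap f) _
      ((contMDiff_graphMap hf).mdifferentiable (by simp) _)
      (hγ.mdifferentiableAt (by simp))).trans ?_
    rw [hγp]
  have h2 : P ∈ tangentSet {p : N.prod M | p.1 ∈ S} := by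
    obtain ⟨δ, hδ, hδS, hδp⟩ := hp
    let ε : ℝ → N.prod M := fun t => (δ t, γ t)
    have hε : ContMDiffAt 𝓘(ℝ, ℝ) (N.prod M).I ∞ ε 0 := hδ.prodMk hγ
    refine ⟨ε, hε, hδS, ?_⟩
    have hε' := hε.mdifferentiableAt (by simp : (∞ : WithTop ℕ∞) ≠ 0)
    refine eq_of_tangentMap_fst_snd ?_ ?_
    · rw [tangentMap_fst_graphMap hf, ← hδp]
      exact (tangentMap_comp_at (f := ε) (g := (prodFst (N := N) (M := M))) _
        (contMDiff_prodFst.mdifferentiable (by simp) _) hε').symm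
    · rw [tangentMap_snd_graphMap hf, ← hγp]
      exact (tangentMap_comp_at (f := ε) (g := (prodSnd (N := N) (M := M))) _
        (contMDiff_prodSnd.mdifferentiable (by simp) _) hε').symm
  have h3 : P ∈ tangentSet (graphOf f ∩ {p : N.prod M | p.1 ∈ S}) := by
    rw [h.2]
    exact ⟨h1, h2⟩
  have h4 := tangentMap_mem_tangentSet (S' := f ⁻¹' S) h3
    (contMDiff_prodSnd (N := N) (M := M)).contMDiffAt (Filter.Eventually.of_forall
      fun y (hy : y.1 = f y.2 ∧ y.1 ∈ S) => by
        change f y.2 ∈ S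
        rw [← hy.1]
        exact hy.2)
  rwa [tangentMap_snd_graphMap hf] at h4

/-- A criterion for clean intersection of the graph of `f` with `S × M`. -/
theorem cleanInter_graphOf {S : Set N} (hf : ContMDiff M.I N.I ∞ f) (hP : IsSubmanifold (f ⁻¹' S))
    (ht : ∀ p : TangentBundle M.I M, tangentMap M.I N.I f p ∈ tangentSet S →
      p ∈ tangentSet (f ⁻¹' S)) :
    CleanInter (graphOf f) {p : N.prod M | p.1 ∈ S} := by
  refine ⟨isSubmanifold_of_exists_retraction fun x hx => ?_, ?_⟩
  · have hx2 : x.2 ∈ f ⁻¹' S := by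
      change f x.2 ∈ S
      rw [← (hx.1 : x.1 = f x.2)]
      exact hx.2
    obtain ⟨r, hr⟩ := hP.exists_retraction hx2
    have hs : SmoothNear (N.prod M).I M.I prodSnd x := smoothNear_of_contMDiff contMDiff_prodSnd x
    refine ⟨fun y => graphMap f (r y.2), ?_, ?_, ?_⟩
    · exact SmoothNear.comp (smoothNear_of_contMDiff (contMDiff_graphMap hf) _) (hr.smooth.comp hs)
    · filter_upwards [hs.tendsto.eventually hr.mem] with y hy
      exact ⟨rfl, hy⟩
    · filter_upwards [hs.tendsto.eventually hr.eq] with y hy hyS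
      have h1 : r y.2 = y.2 := hy (by
        change f y.2 ∈ S
        rw [← (hyS.1 : y.1 = f y.2)]
        exact hyS.2)
      change graphMap f (r y.2) = y
      rw [h1]
      exact Prod.ext (hyS.1 : y.1 = f y.2).symm rfl
  · refine Set.Subset.antisymm (Set.subset_inter (tangentSet_mono Set.inter_subset_left)
      (tangentSet_mono Set.inter_subset_right)) ?_
    rintro p ⟨hp1, hp2⟩
    have h1 := tangentMap_graphMap_snd hf hp1
    have h2 : tangentMap M.I N.I f (tangentMap (N.prod M).I M.I prodSnd p) ∈ tangentSet S := by
      rw [← tangentMap_fst_graphMap hf, h1]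
      exact tangentMap_mem_tangentSet hp2 contMDiff_prodFst.contMDiffAt
        (Filter.Eventually.of_forall fun y hy => hy)
    rw [← h1]
    exact tangentMap_mem_tangentSet (ht _ h2) (contMDiff_graphMap hf).contMDiffAt
      (Filter.Eventually.of_forall fun y hy => ⟨rfl, hy⟩)

end Graph

end Mfd

/-! ### Descending maps to quotients of submanifolds -/

namespace Mfd

variable {N Q Q' : Mfd.{u}}

/-- Orbits in `S` which stay in `T ⊆ S` are contained in orbits in `T`. -/
theorem SameOrbit.restrict {d : QuadLieAlg.{u}} {V : d → Set (TangentBundle N.I N)}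
    {k k' : Submodule ℝ d} (hk : k ≤ k') {S T : Set N}
    (sat : ∀ x y : S, SameOrbit V k S x y → (x : N) ∈ T → (y : N) ∈ T) {x y : S}
    (h : SameOrbit V k S x y) (hx : (x : N) ∈ T) (hy : (y : N) ∈ T) :
    SameOrbit V k' T ⟨x, hx⟩ ⟨y, hy⟩ := by
  induction h with
  | rel x y h =>
    obtain ⟨ξ, hξ, γ, a, b, hab, ha, hb, hγ⟩ := h
    refine Relation.EqvGen.rel _ _ ⟨ξ, hk hξ, γ, a, b, hab, ha, hb, fun t ht => ⟨?_, (hγ t ht).2⟩⟩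
    have h1 : SameOrbit V k S x ⟨γ t, (hγ t ht).1⟩ :=
      Relation.EqvGen.rel _ _ ⟨ξ, hξ, γ, a, t, ht.1, ha, rfl, fun s hs =>
        hγ s ⟨hs.1, hs.2.trans ht.2⟩⟩
    exact sat _ _ h1 hx
  | refl x => exact Relation.EqvGen.refl _
  | symm x y h ih => exact (ih hy hx).symm
  | trans x y z h₁ h₂ ih₁ ih₂ =>
    have hy' := sat _ _ h₁ hx
    exact (ih₁ hx hy').trans _ _ _ (ih₂ hy' hy)

theorem IsDiff.restrict {S T : Set N} (hTS : T ⊆ S) {q : S → Q} {p : TangentBundle N.I N}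
    {r : TangentBundle Q.I Q} (hp : p.1 ∈ T) (h : IsDiff S q p r) :
    IsDiff T (fun x => q ⟨x, hTS x.2⟩) p r := by
  obtain ⟨hS, f, hf, hr⟩ := h
  exact ⟨hp, f, ⟨hf.1, hf.2.mono fun y hy h => hy (hTS h)⟩, hr⟩

theorem SmoothOnSub.restrict {S T : Set N} (hTS : T ⊆ S) {q : S → Q} (hq : SmoothOnSub S q) :
    SmoothOnSub T (fun x => q ⟨x, hTS x.2⟩) := by
  intro x
  obtain ⟨f, hf⟩ := hq ⟨x, hTS x.2⟩
  exact ⟨f, hf.1, hf.2.mono fun y hy h => hy (hTS h)⟩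

/-- On `TT` the differentials of `q : S → Q` and of its restriction to `T ⊆ S` agree. -/
theorem IsDiff.of_restrict {S T : Set N} (hTS : T ⊆ S) {q : S → Q} (hq : SmoothOnSub S q)
    {p : TangentBundle N.I N} {r : TangentBundle Q.I Q} (hp : p ∈ tangentSet T)
    (h : IsDiff T (fun x => q ⟨x, hTS x.2⟩) p r) : IsDiff S q p r := by
  have hpT := mem_of_mem_tangentSet hp
  obtain ⟨r', hr'⟩ := hq.exists_isDiff (hTS hpT)
  rwa [h.unique hp (hr'.restrict hTS hpT)]

/-- Converse of the chain rule `IsDiff.comp`. -/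
theorem IsDiff.of_comp {S : Set N} {q : S → Q} {T : Set N} {T' : Set Q} (hTS : T ⊆ S)
    (hT : ∀ x (h : x ∈ T), q ⟨x, hTS h⟩ ∈ T') {g : T → Q'} {g' : T' → Q'}
    (hg : ∀ x (h : x ∈ T), g' ⟨q ⟨x, hTS h⟩, hT x h⟩ = g ⟨x, h⟩) (hg' : SmoothOnSub T' g')
    {p : TangentBundle N.I N} {r : TangentBundle Q.I Q} {s : TangentBundle Q'.I Q'}
    (hp : p ∈ tangentSet T) (h : IsDiff S q p r) (h' : IsDiff T g p s) : IsDiff T' g' r s := by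
  obtain ⟨s', hs'⟩ := hg'.exists_isDiff (mem_of_mem_tangentSet (h.mem_tangentSet hTS hT hp))
  rwa [h'.unique hp (h.comp hTS hT hg hp hs')]

theorem IsDiff.map {S : Set N} {q : S → Q} {φ : Q → Q'} (hφ : ContMDiff Q.I Q'.I ∞ φ)
    {g : S → Q'} (hg : ∀ x, φ (q x) = g x) {p : TangentBundle N.I N} {r : TangentBundle Q.I Q}
    (h : IsDiff S q p r) : IsDiff S g p (tangentMap Q.I Q'.I φ r) := by
  obtain ⟨hS, f, hf, hr⟩ := h
  refine ⟨hS, φ ∘ f, ⟨hφ.contMDiffAt.comp _ hf.1, hf.2.mono fun y hy h => ?_⟩, ?_⟩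
  · change φ (f y) = _
    rw [hy h, hg]
  · rw [← hr]
    exact tangentMap_comp_at (f := f) (g := φ) p (hφ.mdifferentiable (by simp) _)
      (hf.1.mdifferentiableAt (by simp))

/-- Chain rule for `q ∘ φ`, with `φ` defined on the ambient manifold. -/
theorem IsDiff.comp_map {S : Set N} {q : S → Q} {φ : Q' → N} (hφ : ContMDiff Q'.I N.I ∞ φ)
    {P : Set Q'} (hP : ∀ x : P, φ x ∈ S) {p : TangentBundle Q'.I Q'} {r : TangentBundle Q.I Q}
    (hp : p.1 ∈ P) (h : IsDiff S q (tangentMap Q'.I N.I φ p) r) :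
    IsDiff P (fun x => q ⟨φ x, hP x⟩) p r := by
  obtain ⟨hS, f, hf, hr⟩ := h
  refine ⟨hp, f ∘ φ, ⟨ContMDiffAt.comp p.1 hf.1 hφ.contMDiffAt, ?_⟩, ?_⟩
  · filter_upwards [hφ.continuous.continuousAt.eventually hf.2] with y hy h
    exact hy _
  · rw [← hr]
    exact tangentMap_comp_at (f := φ) (g := f) p (hf.1.mdifferentiableAt (by simp))
      (hφ.mdifferentiable (by simp) _)

section

variable {S T : Set N} {R : S → S → Prop} {q : S → Q}

/-- Smooth maps constant on the fibres descend to a regular quotient. -/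
theorem IsRegularQuotient.exists_contMDiff_desc (hq : IsRegularQuotient S R q)
    (hS : IsSubmanifold S) {g : S → Q'} (hg : SmoothOnSub S g)
    (hqg : ∀ x y, q x = q y → g x = g y) :
    ∃ φ : Q → Q', ContMDiff Q.I Q'.I ∞ φ ∧ ∀ x, φ (q x) = g x := by
  choose s hs using hq.surjective
  have hφ : ∀ x, g (s (q x)) = g x := fun x => hqg _ _ (hs _)
  refine ⟨fun z => g (s z), fun z => ?_, hφ⟩
  obtain ⟨x, rfl⟩ := hq.surjective z
  obtain ⟨σ, hσ, hσx, hσq⟩ := hq.exists_section hS x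
  obtain ⟨f, hf⟩ := hg x
  have h0 : ContMDiffAt N.I Q'.I ∞ f (σ (q x)) := by
    rw [hσx]
    exact hf.1
  have h1 : ContMDiffAt Q.I Q'.I ∞ (f ∘ σ) (q x) := ContMDiffAt.comp (q x) h0 hσ.at
  refine h1.congr_of_eventuallyEq ?_
  have h2 := hσ.tendsto
  rw [hσx] at h2
  filter_upwards [hσq, h2.eventually hf.2] with w ⟨hw, hwq⟩ hfw
  change g (s w) = f (σ w)
  rw [hfw hw, ← hφ ⟨σ w, hw⟩, hwq]

/-- The space of classes is unique up to diffeomorphism. -/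
theorem IsRegularQuotient.exists_diffeomorph (hq : IsRegularQuotient S R q)
    (hS : IsSubmanifold S) {q' : S → Q'} (hq' : IsRegularQuotient S R q') :
    ∃ φ : Q ≃ₘ⟮Q.I, Q'.I⟯ Q', ∀ x, φ (q x) = q' x := by
  obtain ⟨φ, hφ, h1⟩ := hq.exists_contMDiff_desc hS hq'.smooth
    fun x y h => (hq'.fibres x y).2 ((hq.fibres x y).1 h)
  obtain ⟨ψ, hψ, h2⟩ := hq'.exists_contMDiff_desc hS hq.smooth
    fun x y h => (hq.fibres x y).2 ((hq'.fibres x y).1 h)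
  refine ⟨⟨⟨φ, ψ, fun z => ?_, fun z => ?_⟩, hφ, hψ⟩, h1⟩
  · obtain ⟨x, rfl⟩ := hq.surjective z
    rw [h1, h2]
  · obtain ⟨x, rfl⟩ := hq'.surjective z
    rw [h2, h1]

/-- If `T ⊆ S` is a union of fibres of a regular quotient `q : S → Q`, then a regular quotient
`g : T → Q'` constant on the fibres of `q` descends to a regular quotient of the image of `T`. -/
theorem IsRegularQuotient.exists_desc (hq : IsRegularQuotient S R q) (hS : IsSubmanifold S)
    (hTS : T ⊆ S) (sat : ∀ x y : S, q x = q y → (x : N) ∈ T → (y : N) ∈ T)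
    {R' : T → T → Prop} {g : T → Q'} (hg : IsRegularQuotient T R' g)
    (hqg : ∀ x y (hx : x ∈ T) (hy : y ∈ T), q ⟨x, hTS hx⟩ = q ⟨y, hTS hy⟩ → g ⟨x, hx⟩ = g ⟨y, hy⟩)
    {S' : Set Q} (hS' : S' = qImage q T) (hm : ∀ x (h : x ∈ T), q ⟨x, hTS h⟩ ∈ S') :
    ∃ g' : S' → Q', (∀ x (h : x ∈ T), g' ⟨q ⟨x, hTS h⟩, hm x h⟩ = g ⟨x, h⟩) ∧
      SmoothOnSub S' g' ∧ ∀ R'' : S' → S' → Prop,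
        (∀ x y (hx : x ∈ T) (hy : y ∈ T), g ⟨x, hx⟩ = g ⟨y, hy⟩ ↔
          R'' ⟨q ⟨x, hTS hx⟩, hm x hx⟩ ⟨q ⟨y, hTS hy⟩, hm y hy⟩) →
        IsRegularQuotient S' R'' g' := by
  subst hS'
  choose s hsT hs using fun z : qImage q T => z.2
  have hgg : ∀ x (h : x ∈ T), g ⟨s ⟨q ⟨x, hTS h⟩, hm x h⟩, hsT _⟩ = g ⟨x, h⟩ := fun x h =>
    hqg _ _ _ _ (hs ⟨q ⟨x, hTS h⟩, hm x h⟩)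
  let g' : qImage q T → Q' := fun z => g ⟨s z, hsT z⟩
  have hg' : SmoothOnSub (qImage q T) g' := hq.smoothOnSub_desc hS hTS sat hg.smooth hgg
  have hrep : ∀ z : qImage q T, ∃ x, ∃ h : x ∈ T, z = ⟨q ⟨x, hTS h⟩, hm x h⟩ := by
    rintro ⟨z, x, hx, rfl⟩
    exact ⟨x, hx, rfl⟩
  refine ⟨g', hgg, hg', fun R'' hR => ⟨fun z => ?_, hg', fun z w => ?_, fun z z' => ?_⟩⟩
  · obtain ⟨x, rfl⟩ := hg.surjective z
    exact ⟨⟨q ⟨x, hTS x.2⟩, hm x x.2⟩, hgg x x.2⟩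
  · obtain ⟨x, hx, rfl⟩ := hrep z
    obtain ⟨w', hw'⟩ := exists_eq_mk
      (p := (⟨g' ⟨q ⟨x, hTS hx⟩, hm x hx⟩, w⟩ : TangentBundle Q'.I Q'))
      (hgg x hx)
    obtain ⟨v, hv, hvw⟩ := hg.submersion ⟨x, hx⟩ w'
    obtain ⟨v₁, hv₁⟩ := hq.smooth.exists_isDiff_mk ⟨x, hTS hx⟩ v
    refine ⟨v₁, hv₁.mem_tangentSet hTS hm hv, ?_⟩
    rw [hw']
    exact hv₁.of_comp hTS hm hgg hg' hv hvw
  · obtain ⟨x, hx, rfl⟩ := hrep z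
    obtain ⟨y, hy, rfl⟩ := hrep z'
    rw [← hR x y hx hy, ← hgg x hx, ← hgg y hy]

end

end Mfd

/-! ### One reduction: the reduced action and the reduced map -/

namespace QuadLieAlg

variable {d : QuadLieAlg.{u}} {c : LieSubalgebra ℝ d}

theorem lie_mem_perp {ζ ξ : d} (hζ : ζ ∈ d.perp c) (hξ : ξ ∈ c) : ⁅ζ, ξ⁆ ∈ d.perp c := by
  intro y hy
  rw [d.form_inv]
  exact hζ _ (c.lie_mem hξ hy)

theorem toReduce_surjective : Function.Surjective (d.toReduce c) :=
  Submodule.Quotient.mk_surjective _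

theorem toReduce_eq_zero_iff {x : c} : d.toReduce c x = 0 ↔ (x : d) ∈ d.perp c :=
  Submodule.Quotient.mk_eq_zero _

theorem toReduce_eq_iff {x y : c} :
    d.toReduce c x = d.toReduce c y ↔ (x : d) - (y : d) ∈ d.perp c := by
  rw [← sub_eq_zero, ← map_sub, toReduce_eq_zero_iff]
  rfl

end QuadLieAlg

namespace QHam

variable {A : ActionSpace.{u}} {X : QHam A} {μ : X.M → A.N} {c : LieSubalgebra ℝ A.d} {S : Set A.N}

theorem IsCourantMorphism.graph_eq (hμ : X.IsCourantMorphism μ) : X.graph = graphOf μ := by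
  ext p
  constructor
  · rintro ⟨z, hz⟩
    exact hμ.support _ _ _ hz
  · rintro (hp : p.1 = μ p.2)
    refine ⟨(0, 0, 0), ?_⟩
    rw [hp]
    exact hμ.rel_zero p.2

theorem preim_eq (h : X.graph = graphOf μ) (S : Set A.N) : X.preim S = μ ⁻¹' S := by
  ext m
  constructor
  · rintro ⟨n, hn, hg⟩
    rw [h] at hg
    have : n = μ m := hg
    change μ m ∈ S
    rwa [← this]
  · intro hm
    refine ⟨μ m, hm, ?_⟩
    rw [h]
    rfl

theorem IsCourantMorphism.mem_preim_iff (hμ : X.IsCourantMorphism μ) {m : X.M} :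
    m ∈ X.preim S ↔ μ m ∈ S := by
  rw [preim_eq hμ.graph_eq]
  rfl

theorem IsQuasiHamiltonian.tangentMap_eq (hX : X.IsQuasiHamiltonian) (hμ : X.IsCourantMorphism μ)
    {m : X.M} {ξ : A.d} {v : TangentSpace X.M.I m} {α : TangentSpace X.M.I m →L[ℝ] ℝ}
    (h : X.Rel m (ξ, v, α) (μ m)) :
    tangentMap X.M.I A.N.I μ ⟨m, v⟩ = ⟨μ m, A.ρ ξ (μ m)⟩ := by
  rw [← hX.mfderiv_eq hμ h]
  rfl

/-- `μ` maps integral curves of `ρ_R(ξ)` to integral curves of `ρ(ξ)`. -/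
theorem IsQuasiHamiltonian.sameOrbit_map (hX : X.IsQuasiHamiltonian) (hμ : X.IsCourantMorphism μ)
    {k k' : Submodule ℝ A.d} (hk : k ≤ k') {x y : X.preim S}
    (h : SameOrbit X.field k (X.preim S) x y) :
    SameOrbit A.field k' S ⟨μ x, hμ.mem_preim_iff.1 x.2⟩ ⟨μ y, hμ.mem_preim_iff.1 y.2⟩ := by
  induction h with
  | rel x y h =>
    obtain ⟨ξ, hξ, γ, a, b, hab, ha, hb, hγ⟩ := h
    refine Relation.EqvGen.rel _ _ ⟨ξ, hk hξ, μ ∘ γ, a, b, hab, congrArg μ ha, congrArg μ hb,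
      fun t ht => ?_⟩
    obtain ⟨h1, h2, n, h3⟩ := hγ t ht
    have hμ' : MDifferentiableAt X.M.I A.N.I μ (γ t) := hμ.smooth_map.mdifferentiable (by simp) _
    refine ⟨hμ.mem_preim_iff.1 h1, hμ'.comp t h2, ?_⟩
    have h4 : n = μ (γ t) := hμ.support _ _ _ h3
    subst h4
    have h5 := hX.mfderiv_eq hμ h3
    rw [tangentMap_comp_at (f := γ) (g := μ) _ hμ' h2]
    exact h5
  | refl x => exact Relation.EqvGen.refl _
  | symm x y _ ih => exact ih.symm
  | trans x y z _ _ ih₁ ih₂ => exact ih₁.trans _ _ _ ih₂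

namespace ReductiveData

theorem isSubmanifold_preim (D : X.ReductiveData c S) (hμ : X.IsCourantMorphism μ) :
    IsSubmanifold (X.preim S) := by
  have h := D.clean
  rw [hμ.graph_eq] at h
  rw [preim_eq hμ.graph_eq]
  exact h.isSubmanifold_preimage hμ.smooth_map

theorem mem_tangentSet_preim_iff (D : X.ReductiveData c S) (hμ : X.IsCourantMorphism μ)
    (p : TangentBundle X.M.I X.M) :
    p ∈ tangentSet (X.preim S) ↔ tangentMap X.M.I A.N.I μ p ∈ tangentSet S := by
  have h := D.clean
  rw [hμ.graph_eq] at h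
  rw [preim_eq hμ.graph_eq]
  exact h.mem_tangentSet_preimage_iff hμ.smooth_map p

/-- `q_N` is constant along the flows of `c^⊥`. -/
theorem isDiff_zero (D : X.ReductiveData c S) (hA : A.IsCourant) {ζ : A.d} (hζ : ζ ∈ A.d.perp c)
    (x : S) : IsDiff S D.qN ⟨x, A.ρ ζ x⟩ ⟨D.qN x, 0⟩ :=
  D.submanifold.isDiff_zero_of_flow D.regularN.smooth (W := A.field ζ)
    (fun x y h => (D.regularN.fibres x y).2 (Relation.EqvGen.rel _ _ ⟨ζ, hζ, h⟩)) x
    (V := A.ρ ζ) ((hA.smooth ζ x).of_le (WithTop.coe_le_coe.2 le_top))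
    (Filter.Eventually.of_forall fun m hm => D.invariant ζ (D.coisotropic hζ) m hm)
    (fun _ _ => rfl)

/-- The vector fields of `c` are `q_N`-related to vector fields on `N_{c,S}`: as `[c^⊥, c] ⊆ c^⊥`,
their images do not change along the flows of `c^⊥`. -/
theorem isDiff_iff_of_fibre (D : X.ReductiveData c S) (hA : A.IsCourant) {ξ : A.d} (hξ : ξ ∈ c)
    {x y : S} (h : D.qN x = D.qN y) (r : TangentBundle D.redN.I D.redN) :
    IsDiff S D.qN ⟨x, A.ρ ξ x⟩ r ↔ IsDiff S D.qN ⟨y, A.ρ ξ y⟩ r := by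
  have h1 := (D.regularN.fibres x y).1 h
  clear h
  induction h1 with
  | rel x y h =>
    obtain ⟨ζ, hζ, h⟩ := h
    have hb := QuadLieAlg.lie_mem_perp hζ hξ
    refine isDiff_iff_of_flow (W := A.ρ ζ) D.submanifold D.regularN.smooth (hA.smooth ξ)
      (hA.smooth ζ) (D.invariant ξ hξ) (D.invariant ζ (D.coisotropic hζ)) (D.isDiff_zero hA hζ)
      (fun x hx => ?_) (fun x => ?_) h r
    · rw [← hA.lie]
      exact D.invariant _ (D.coisotropic hb) x hx
    · rw [← hA.lie]
      exact D.isDiff_zero hA hb x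
  | refl x => rfl
  | symm x y _ ih => exact ih.symm
  | trans x y z _ _ ih₁ ih₂ => exact ih₁.trans ih₂

/-- The induced action is well defined: `ρ_c(ξ + c^⊥)` is `q_N`-related to `ρ(ξ)`. -/
theorem isDiff_redAction (D : X.ReductiveData c S) (hA : A.IsCourant) (ξ : c) (x : S) :
    IsDiff S D.qN ⟨x, A.ρ ξ x⟩ ⟨D.qN x, D.redAction.ρ (A.d.toReduce c ξ) (D.qN x)⟩ := by
  obtain ⟨w, hw⟩ := D.regularN.smooth.exists_isDiff_mk x (A.ρ ξ x)
  obtain ⟨x', ξ', hx', hξ', h⟩ := Classical.epsilon_spec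
    (p := fun w : TangentSpace D.redN.I (D.qN x) => ∃ (x' : S) (ξ' : c), D.qN x' = D.qN x ∧
      A.d.toReduce c ξ' = A.d.toReduce c ξ ∧ IsDiff S D.qN ⟨x', A.ρ ξ' x'⟩ ⟨D.qN x, w⟩)
    ⟨w, x, ξ, rfl, rfl, hw⟩
  have h1 := (D.isDiff_iff_of_fibre hA ξ'.2 hx' _).1 h
  have h2 : (ξ : A.d) - ξ' ∈ A.d.perp c := QuadLieAlg.toReduce_eq_iff.1 hξ'.symm
  have h3 := IsDiff.add_smul D.submanifold (D.invariant ξ' ξ'.2 x x.2)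
    (D.invariant _ (D.coisotropic h2) x x.2) h1 (D.isDiff_zero hA h2 x) 1
  rw [one_smul, one_smul, add_zero, ← hA.add, add_sub_cancel] at h3
  exact h3

/-- `q_M` is constant along the flows of `h ∩ c^⊥`. -/
theorem isDiff_zero_M (D : X.ReductiveData c S) (hX : X.IsQuasiHamiltonian)
    (hμ : X.IsCourantMorphism μ) {ξ : A.d} (hξ : ξ ∈ X.h) (hξc : ξ ∈ A.d.perp c) (m : X.preim S)
    {v : TangentSpace X.M.I (m : X.M)} (hv : X.Rel m (ξ, v, 0) (μ m)) :
    IsDiff (X.preim S) D.qM ⟨m, v⟩ ⟨D.qM m, 0⟩ := by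
  choose V hV using fun m => hX.exists_rel hμ hξ m
  have h1 : v = V m := hX.rel_unique hμ hv (hV m)
  subst h1
  refine (D.isSubmanifold_preim hμ).isDiff_zero_of_flow D.regularM.smooth (W := X.field ξ)
    (fun x y h => (D.regularM.fibres x y).2 (Relation.EqvGen.rel _ _ ⟨ξ, ⟨hξ, hξc⟩, h⟩)) m
    (V := V) (hX.contMDiffAt_of_rel hμ hV m)
    (Filter.Eventually.of_forall fun y hy => ?_) (fun y _ => ⟨μ y, hV y⟩)
  rw [D.mem_tangentSet_preim_iff hμ, hX.tangentMap_eq hμ (hV y)]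
  exact D.invariant ξ (D.coisotropic hξc) _ (hμ.mem_preim_iff.1 hy)

theorem qN_eq_of_qM_eq (D : X.ReductiveData c S) (hX : X.IsQuasiHamiltonian)
    (hμ : X.IsCourantMorphism μ) {x y : X.preim S} (h : D.qM x = D.qM y) :
    D.qN ⟨μ x, hμ.mem_preim_iff.1 x.2⟩ = D.qN ⟨μ y, hμ.mem_preim_iff.1 y.2⟩ :=
  (D.regularN.fibres _ _).2 (hX.sameOrbit_map hμ inf_le_right ((D.regularM.fibres x y).1 h))

/-- `μ` descends to a smooth map `M_{c,S} → N_{c,S}`. -/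
theorem exists_redMap (D : X.ReductiveData c S) (hX : X.IsQuasiHamiltonian)
    (hμ : X.IsCourantMorphism μ) : ∃ ν : D.redM → D.redN, ContMDiff D.redM.I D.redN.I ∞ ν ∧
      ∀ m : X.preim S, ν (D.qM m) = D.qN ⟨μ m, hμ.mem_preim_iff.1 m.2⟩ := by
  refine D.regularM.exists_contMDiff_desc (D.isSubmanifold_preim hμ)
    (g := fun m => D.qN ⟨μ m, hμ.mem_preim_iff.1 m.2⟩) (fun m => ?_)
    fun x y h => D.qN_eq_of_qM_eq hX hμ h
  obtain ⟨f, hf⟩ := D.regularN.smooth ⟨μ m, hμ.mem_preim_iff.1 m.2⟩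
  refine ⟨f ∘ μ, ContMDiffAt.comp (m : X.M) hf.1 hμ.smooth_map.contMDiffAt, ?_⟩
  filter_upwards [hμ.smooth_map.continuous.continuousAt.eventually hf.2] with y hy h
  exact hy _

/-- The reduction is supported on the graph of the map induced by `μ`. The inclusion of this graph
in the set of base points holds because `R` contains the zero section. -/
theorem graph_reduction (D : X.ReductiveData c S) (hμ : X.IsCourantMorphism μ)
    {ν : D.redM → D.redN}
    (hν : ∀ m : X.preim S, ν (D.qM m) = D.qN ⟨μ m, hμ.mem_preim_iff.1 m.2⟩) :
    D.reduction.graph = graphOf (N := D.redN) (M := D.redM) ν := by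
  ext p
  constructor
  · rintro ⟨z, b, ⟨a, h1, h2⟩, h3, h4⟩
    obtain ⟨hm, hqm⟩ := h1.2.1.proj_eq
    have h5 : b.2 = μ a.1 := hμ.support a.1 (b.1, a.2.1, a.2.2) b.2 h2
    obtain ⟨hb, hqb⟩ := h4
    change p.1 = ν p.2
    have h6 : D.qM ⟨a.1, hm⟩ = p.2 := hqm
    rw [← h6, hν]
    refine hqb.symm.trans ?_
    congr 1
    exact Subtype.ext h5
  · intro hp
    obtain ⟨m, hm⟩ := D.regularM.surjective p.2
    have hm' := hμ.mem_preim_iff.1 m.2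
    refine ⟨(0, 0, 0), (0, μ m), ⟨⟨m, 0, 0⟩, ⟨zero_mem_tangentSet m.2, ?_, ?_⟩, hμ.rel_zero m⟩,
      ⟨c.zero_mem, ?_⟩, hm', ?_⟩
    · rw [← hm]
      exact IsDiff.zero D.regularM.smooth m
    · intro _ _ _ _
      rfl
    · exact map_zero (A.d.toReduce c)
    · refine (hν m).symm.trans ?_
      rw [hm]
      exact (hp : p.1 = ν p.2).symm

end ReductiveData

end QHam

/-! ### The data of a second reduction -/

namespace QHam

variable {A : ActionSpace.{u}} {X : QHam A} {μ : X.M → A.N} {c₁ c₂ c : LieSubalgebra ℝ A.d}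
  {S₁ S₂ T : Set A.N} {D₁ : X.ReductiveData c₁ S₁} {D : X.ReductiveData c T}

/-- The reductive data `(c, T)` are those of a further reduction by `(c₂, S₂)` after the reduction
by `(c₁, S₁)`: `c = c₁ ∩ c₂`, and `T = S₁ ∩ S₂` is a union of `c₁^⊥`-orbits in `S₁`. -/
structure IsNested (D₁ : X.ReductiveData c₁ S₁) (c₂ : LieSubalgebra ℝ A.d) (S₂ : Set A.N)
    (D : X.ReductiveData c T) : Prop where
  alg : c = c₁ ⊓ c₂
  set : T = S₁ ∩ S₂
  sat : ∀ x y : S₁, SameOrbit A.field (A.d.perp c₁) S₁ x y → (x : A.N) ∈ S₂ → (y : A.N) ∈ S₂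

namespace IsNested

theorem le (h : IsNested D₁ c₂ S₂ D) : c ≤ c₁ := h.alg ▸ inf_le_left

theorem subset (h : IsNested D₁ c₂ S₂ D) : T ⊆ S₁ := h.set ▸ Set.inter_subset_left

theorem preim_subset (h : IsNested D₁ c₂ S₂ D) : X.preim T ⊆ X.preim S₁ :=
  fun _ ⟨n, hn, hg⟩ => ⟨n, h.subset hn, hg⟩

theorem perp_le (h : IsNested D₁ c₂ S₂ D) : A.d.perp c₁ ≤ A.d.perp c :=
  fun _ hx y hy => hx y (h.le hy)

/-- `c` is the preimage of `c₂₁ = R_{c₁} ∘ c₂` in `c₁`, since `c₁^⊥ ⊆ c^⊥ ⊆ c`. -/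
theorem toReduce_mem_iff (h : IsNested D₁ c₂ S₂ D) (x : c₁) :
    A.d.toReduce c₁ x ∈ D₁.inducedAlg c₂ ↔ (x : A.d) ∈ c := by
  constructor
  · rintro ⟨y, hy, hxy⟩
    have h1 : (x : A.d) - y ∈ c :=
      D.coisotropic (h.perp_le (QuadLieAlg.toReduce_eq_iff.1 (hxy : A.d.toReduce c₁ y = _).symm))
    have h2 : (y : A.d) ∈ c := by
      rw [h.alg]
      exact ⟨y.2, hy⟩
    have h3 := c.add_mem h1 h2
    rwa [sub_add_cancel] at h3
  · intro hx
    rw [h.alg] at hx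
    exact ⟨x, hx.2, rfl⟩

/-- `c^⊥` is the preimage of `c₂₁^⊥` in `c₁`. -/
theorem toReduce_mem_perp_iff (h : IsNested D₁ c₂ S₂ D) (x : c₁) :
    A.d.toReduce c₁ x ∈ D₁.redAction.d.perp (D₁.inducedAlg c₂) ↔ (x : A.d) ∈ A.d.perp c := by
  constructor
  · intro hx y hy
    exact hx _ ((h.toReduce_mem_iff ⟨y, h.le hy⟩).2 hy)
  · intro hx y hy
    obtain ⟨y', rfl⟩ := QuadLieAlg.toReduce_surjective y
    exact hx _ ((h.toReduce_mem_iff y').1 hy)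

theorem isCoisotropic (h : IsNested D₁ c₂ S₂ D) :
    D₁.redAction.d.IsCoisotropic (D₁.inducedAlg c₂) := by
  intro x hx
  obtain ⟨x', rfl⟩ := QuadLieAlg.toReduce_surjective x
  exact (h.toReduce_mem_iff x').2 (D.coisotropic ((h.toReduce_mem_perp_iff x').1 hx))

theorem sat_orbit (h : IsNested D₁ c₂ S₂ D) (x y : S₁)
    (hxy : SameOrbit A.field (A.d.perp c₁) S₁ x y) (hx : (x : A.N) ∈ T) : (y : A.N) ∈ T := by
  have h1 := h.set
  subst h1
  exact ⟨y.2, h.sat x y hxy hx.2⟩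

theorem sat_qN (h : IsNested D₁ c₂ S₂ D) (x y : S₁) (hxy : D₁.qN x = D₁.qN y)
    (hx : (x : A.N) ∈ T) : (y : A.N) ∈ T :=
  h.sat_orbit x y ((D₁.regularN.fibres x y).1 hxy) hx

theorem inducedSet_eq (h : IsNested D₁ c₂ S₂ D) : D₁.inducedSet S₂ = qImage D₁.qN T := by
  ext y
  constructor
  · rintro ⟨x, hx, rfl⟩
    exact ⟨x, h.set ▸ ⟨x.2, hx⟩, rfl⟩
  · rintro ⟨x, hx, rfl⟩
    rw [h.set] at hx
    exact ⟨x, hx.2, rfl⟩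

theorem qN_mem (h : IsNested D₁ c₂ S₂ D) (x : A.N) (hx : x ∈ T) :
    D₁.qN ⟨x, h.subset hx⟩ ∈ D₁.inducedSet S₂ :=
  h.inducedSet_eq ▸ ⟨⟨x, h.subset hx⟩, hx, rfl⟩

theorem sat_orbit_M (h : IsNested D₁ c₂ S₂ D) (hX : X.IsQuasiHamiltonian)
    (hμ : X.IsCourantMorphism μ) (x y : X.preim S₁)
    (hxy : SameOrbit X.field (X.h.toSubmodule ⊓ A.d.perp c₁) (X.preim S₁) x y)
    (hx : (x : X.M) ∈ X.preim T) : (y : X.M) ∈ X.preim T :=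
  hμ.mem_preim_iff.2 (h.sat_orbit _ _ (hX.sameOrbit_map hμ inf_le_right hxy)
    (hμ.mem_preim_iff.1 hx))

theorem sat_qM (h : IsNested D₁ c₂ S₂ D) (hX : X.IsQuasiHamiltonian)
    (hμ : X.IsCourantMorphism μ) (x y : X.preim S₁) (hxy : D₁.qM x = D₁.qM y)
    (hx : (x : X.M) ∈ X.preim T) : (y : X.M) ∈ X.preim T :=
  h.sat_orbit_M hX hμ x y ((D₁.regularM.fibres x y).1 hxy) hx

/-- The preimage of `S₂₁` in `M_{c₁,S₁}` is the image of `μ⁻¹(T)`. -/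
theorem preim_inducedSet (h : IsNested D₁ c₂ S₂ D) (hX : X.IsQuasiHamiltonian)
    (hμ : X.IsCourantMorphism μ) :
    D₁.reduction.preim (D₁.inducedSet S₂) = qImage D₁.qM (X.preim T) := by
  obtain ⟨ν, -, hν⟩ := D₁.exists_redMap hX hμ
  rw [preim_eq (X := D₁.reduction) (D₁.graph_reduction hμ hν)]
  ext z
  obtain ⟨m, rfl⟩ := D₁.regularM.surjective z
  change ν (D₁.qM m) ∈ D₁.inducedSet S₂ ↔ _
  rw [hν, h.inducedSet_eq]
  constructor
  · rintro ⟨x, hx, hxm⟩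
    exact ⟨m, hμ.mem_preim_iff.2 (h.sat_qN x _ hxm hx), rfl⟩
  · rintro ⟨m', hm', hmm⟩
    exact ⟨⟨μ m, hμ.mem_preim_iff.1 m.2⟩, hμ.mem_preim_iff.1 (h.sat_qM hX hμ m' m hmm hm'), rfl⟩

theorem qM_mem (h : IsNested D₁ c₂ S₂ D) (hX : X.IsQuasiHamiltonian)
    (hμ : X.IsCourantMorphism μ) (x : X.M) (hx : x ∈ X.preim T) :
    D₁.qM ⟨x, h.preim_subset hx⟩ ∈ D₁.reduction.preim (D₁.inducedSet S₂) :=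
  h.preim_inducedSet hX hμ ▸ ⟨⟨x, h.preim_subset hx⟩, hx, rfl⟩

/-- The map `S₂₁ → N_{c,T}` induced by `q_N`. It is a regular quotient for any relation on `S₂₁`
compatible with its fibres. -/
theorem exists_descN (h : IsNested D₁ c₂ S₂ D) :
    ∃ q : D₁.inducedSet S₂ → D.redN,
      (∀ x (hx : x ∈ T), q ⟨D₁.qN ⟨x, h.subset hx⟩, h.qN_mem x hx⟩ = D.qN ⟨x, hx⟩) ∧
      SmoothOnSub (N := D₁.redN) (D₁.inducedSet S₂) q ∧
      ∀ R' : D₁.inducedSet S₂ → D₁.inducedSet S₂ → Prop,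
        (∀ (x y : A.N) (hx : x ∈ T) (hy : y ∈ T), D.qN ⟨x, hx⟩ = D.qN ⟨y, hy⟩ ↔
          R' ⟨D₁.qN ⟨x, h.subset hx⟩, h.qN_mem x hx⟩ ⟨D₁.qN ⟨y, h.subset hy⟩, h.qN_mem y hy⟩) →
        IsRegularQuotient (N := D₁.redN) (D₁.inducedSet S₂) R' q :=
  D₁.regularN.exists_desc D₁.submanifold h.subset h.sat_qN D.regularN
    (fun _ _ hx hy hxy => (D.regularN.fibres _ _).2
      (SameOrbit.restrict h.perp_le h.sat_orbit ((D₁.regularN.fibres _ _).1 hxy) hx hy))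
    h.inducedSet_eq h.qN_mem

/-- The map to `M_{c,T}` induced by `q_M` on the preimage of `S₂₁` in `M_{c₁,S₁}`. It is a regular
quotient for any relation compatible with its fibres. -/
theorem exists_descM (h : IsNested D₁ c₂ S₂ D) (hX : X.IsQuasiHamiltonian)
    (hμ : X.IsCourantMorphism μ) :
    ∃ q : D₁.reduction.preim (D₁.inducedSet S₂) → D.redM,
      (∀ x (hx : x ∈ X.preim T),
        q ⟨D₁.qM ⟨x, h.preim_subset hx⟩, h.qM_mem hX hμ x hx⟩ = D.qM ⟨x, hx⟩) ∧
      SmoothOnSub (N := D₁.redM) (D₁.reduction.preim (D₁.inducedSet S₂)) q ∧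
      ∀ R' : D₁.reduction.preim (D₁.inducedSet S₂) → D₁.reduction.preim (D₁.inducedSet S₂) → Prop,
        (∀ (x y : X.M) (hx : x ∈ X.preim T) (hy : y ∈ X.preim T), D.qM ⟨x, hx⟩ = D.qM ⟨y, hy⟩ ↔
          R' ⟨D₁.qM ⟨x, h.preim_subset hx⟩, h.qM_mem hX hμ x hx⟩
            ⟨D₁.qM ⟨y, h.preim_subset hy⟩, h.qM_mem hX hμ y hy⟩) →
        IsRegularQuotient (N := D₁.redM) (D₁.reduction.preim (D₁.inducedSet S₂)) R' q :=
  D₁.regularM.exists_desc (D₁.isSubmanifold_preim hμ) h.preim_subset (h.sat_qM hX hμ) D.regularM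
    (fun _ _ hx hy hxy => (D.regularM.fibres _ _).2
      (SameOrbit.restrict (inf_le_inf_left _ h.perp_le) (h.sat_orbit_M hX hμ)
        ((D₁.regularM.fibres _ _).1 hxy) hx hy))
    (h.preim_inducedSet hX hμ) (h.qM_mem hX hμ)

theorem isSubmanifold_inducedSet (h : IsNested D₁ c₂ S₂ D) :
    IsSubmanifold (N := D₁.redN) (D₁.inducedSet S₂) := by
  rw [h.inducedSet_eq]
  exact D₁.regularN.isSubmanifold_qImage D₁.submanifold D.submanifold h.subset h.sat_qN

theorem isSubmanifold_preim_inducedSet (h : IsNested D₁ c₂ S₂ D) (hX : X.IsQuasiHamiltonian)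
    (hμ : X.IsCourantMorphism μ) :
    IsSubmanifold (N := D₁.redM) (D₁.reduction.preim (D₁.inducedSet S₂)) := by
  rw [h.preim_inducedSet hX hμ]
  exact D₁.regularM.isSubmanifold_qImage (D₁.isSubmanifold_preim hμ) (D.isSubmanifold_preim hμ)
    h.preim_subset (h.sat_qM hX hμ)

/-- Vectors tangent to `S₁` at points of `T` whose image is tangent to `S₂₁` are tangent to `T`. -/
theorem mem_tangentSet (h : IsNested D₁ c₂ S₂ D) {p : TangentBundle A.N.I A.N}
    {r : TangentBundle D₁.redN.I D₁.redN} (hp : p ∈ tangentSet S₁) (hpT : p.1 ∈ T)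
    (hd : IsDiff S₁ D₁.qN p r) (hr : r ∈ tangentSet (N := D₁.redN) (D₁.inducedSet S₂)) :
    p ∈ tangentSet T := by
  rw [h.inducedSet_eq] at hr
  exact D₁.regularN.mem_tangentSet_of_isDiff D₁.submanifold D.submanifold h.subset h.sat_qN hp hpT
    hd hr

theorem mem_tangentSet_preim (h : IsNested D₁ c₂ S₂ D) (hX : X.IsQuasiHamiltonian)
    (hμ : X.IsCourantMorphism μ) {p : TangentBundle X.M.I X.M}
    {r : TangentBundle D₁.redM.I D₁.redM} (hp : p ∈ tangentSet (X.preim S₁)) (hpT : p.1 ∈ X.preim T)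
    (hd : IsDiff (X.preim S₁) D₁.qM p r)
    (hr : r ∈ tangentSet (N := D₁.redM) (D₁.reduction.preim (D₁.inducedSet S₂))) :
    p ∈ tangentSet (X.preim T) := by
  rw [h.preim_inducedSet hX hμ] at hr
  exact D₁.regularM.mem_tangentSet_of_isDiff (D₁.isSubmanifold_preim hμ) (D.isSubmanifold_preim hμ)
    h.preim_subset (h.sat_qM hX hμ) hp hpT hd hr

end IsNested

end QHam

/-! ### The induced data are reductive -/

namespace QHam

variable {A : ActionSpace.{u}} {X : QHam A} {μ : X.M → A.N} {c₁ c₂ c : LieSubalgebra ℝ A.d}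
  {S₁ S₂ S T : Set A.N} {D₁ : X.ReductiveData c₁ S₁} {D : X.ReductiveData c T}

/-- The relation `R_{c,S}` in terms of representatives: `w + β ∼ η` at `q_M(m)` if `v + α ∼_R ξ` for
some `v ∈ T(μ⁻¹(S))` over `w`, some `ξ ∈ c` over `η`, and some `α` which is pulled back from `β` on
`T(μ⁻¹(S))`. -/
theorem ReductiveData.rel_reduction_iff (D : X.ReductiveData c S) {z : D.redM}
    {η : A.d.reduce c} {w : TangentSpace D.redM.I z} {β : TangentSpace D.redM.I z →L[ℝ] ℝ}
    {y : D.redN} : D.reduction.Rel z (η, w, β) y ↔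
      ∃ (m : X.M) (v : TangentSpace X.M.I m) (α : TangentSpace X.M.I m →L[ℝ] ℝ) (ξ : c) (n : S),
        X.Rel m (ξ, v, α) n ∧ (⟨m, v⟩ : TangentBundle X.M.I X.M) ∈ tangentSet (X.preim S) ∧
        IsDiff (X.preim S) D.qM ⟨m, v⟩ ⟨z, w⟩ ∧
        (∀ (u : TangentSpace X.M.I m) (w' : TangentSpace D.redM.I z),
          (⟨m, u⟩ : TangentBundle X.M.I X.M) ∈ tangentSet (X.preim S) →
          IsDiff (X.preim S) D.qM ⟨m, u⟩ ⟨z, w'⟩ → α u = β w') ∧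
        A.d.toReduce c ξ = η ∧ D.qN n = y := by
  constructor
  · rintro ⟨⟨ξ, n⟩, ⟨⟨m, v, α⟩, ⟨h1, h2, h3⟩, h4⟩, ⟨h5, h6⟩, h7, h8⟩
    exact ⟨m, v, α, ⟨ξ, h5⟩, ⟨n, h7⟩, h4, h1, h2, h3, h6, h8⟩
  · rintro ⟨m, v, α, ξ, n, h4, h1, h2, h3, h6, h8⟩
    exact ⟨(ξ, n), ⟨⟨m, v, α⟩, ⟨h1, h2, h3⟩, h4⟩, ⟨ξ.2, h6⟩, n.2, h8⟩

namespace IsNested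

/-- The `c^⊥`-orbits in `T` are the preimages of the `c₂₁^⊥`-orbits in `S₂₁`. Integral curves in
`T` are mapped to integral curves in `S₂₁`; conversely the map `S₂₁ → N_{c,T}` is annihilated by
the fields of `c₂₁^⊥`, so that it is constant along their integral curves. -/
theorem qN_eq_iff (h : IsNested D₁ c₂ S₂ D) (hA : A.IsCourant) (x y : A.N) (hx : x ∈ T)
    (hy : y ∈ T) : D.qN ⟨x, hx⟩ = D.qN ⟨y, hy⟩ ↔
      SameOrbit D₁.redAction.field (D₁.redAction.d.perp (D₁.inducedAlg c₂)) (D₁.inducedSet S₂)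
        ⟨D₁.qN ⟨x, h.subset hx⟩, h.qN_mem x hx⟩ ⟨D₁.qN ⟨y, h.subset hy⟩, h.qN_mem y hy⟩ := by
  constructor
  · intro hxy
    have key : ∀ x y : T, SameOrbit A.field (A.d.perp c) T x y →
        SameOrbit D₁.redAction.field (D₁.redAction.d.perp (D₁.inducedAlg c₂)) (D₁.inducedSet S₂)
        ⟨D₁.qN ⟨x, h.subset x.2⟩, h.qN_mem x x.2⟩ ⟨D₁.qN ⟨y, h.subset y.2⟩, h.qN_mem y y.2⟩ := by
      intro x y hxy
      induction hxy with
      | rel x y hxy =>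
        obtain ⟨ζ, hζ, hf⟩ := hxy
        have hζ₁ : ζ ∈ c₁ := h.le (D.coisotropic hζ)
        refine Relation.EqvGen.mono (fun _ _ hs => ⟨A.d.toReduce c₁ ⟨ζ, hζ₁⟩,
          (h.toReduce_mem_perp_iff ⟨ζ, hζ₁⟩).2 hζ, hs⟩) _ _
          (D.submanifold.eqvGen_flowStep_map (D₁.regularN.smooth.restrict h.subset)
            (P' := D₁.inducedSet S₂) (V' := D₁.redAction.field (A.d.toReduce c₁ ⟨ζ, hζ₁⟩))
            (fun x => h.qN_mem x x.2) (fun p r hp hpT hr => ?_) hf)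
        obtain ⟨x, v⟩ := p
        have hv : v = A.ρ ζ x := hp
        subst hv
        have hxS := h.subset (mem_of_mem_tangentSet hpT)
        have h1 := hr.of_restrict h.subset D₁.regularN.smooth hpT
        have h2 := D₁.isDiff_redAction hA ⟨ζ, hζ₁⟩ ⟨x, hxS⟩
        rw [h1.unique (tangentSet_mono h.subset hpT) h2]
        rfl
      | refl x => exact Relation.EqvGen.refl _
      | symm x y _ ih => exact ih.symm
      | trans x y z _ _ ih₁ ih₂ => exact ih₁.trans _ _ _ ih₂
    exact key _ _ ((D.regularN.fibres _ _).1 hxy)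
  · intro hxy
    obtain ⟨q, hq, hqs, -⟩ := h.exists_descN
    rw [← hq x hx, ← hq y hy]
    generalize (⟨D₁.qN ⟨x, h.subset hx⟩, h.qN_mem x hx⟩ : D₁.inducedSet S₂) = z at hxy ⊢
    generalize (⟨D₁.qN ⟨y, h.subset hy⟩, h.qN_mem y hy⟩ : D₁.inducedSet S₂) = z' at hxy ⊢
    induction hxy with
    | rel z z' hz =>
      obtain ⟨η, hη, hf⟩ := hz
      refine h.isSubmanifold_inducedSet.eq_of_flowStep hqs (fun p r hp hpT hr => ?_) hf
      obtain ⟨ζ, rfl⟩ := QuadLieAlg.toReduce_surjective η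
      have hζ := (h.toReduce_mem_perp_iff ζ).1 hη
      obtain ⟨z, w⟩ := p
      have hw : w = D₁.redAction.ρ (A.d.toReduce c₁ ζ) z := hp
      subst hw
      have hz : z ∈ D₁.inducedSet S₂ := mem_of_mem_tangentSet hpT
      rw [h.inducedSet_eq] at hz
      obtain ⟨x, hxT, rfl⟩ := hz
      have h1 := D₁.isDiff_redAction hA ζ x
      have h2 : (⟨x, A.ρ ζ x⟩ : TangentBundle A.N.I A.N) ∈ tangentSet T :=
        D.invariant ζ (D.coisotropic hζ) x hxT
      have h3 := h1.comp h.subset h.qN_mem hq h2 hr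
      rw [h3.unique h2 (D.isDiff_zero hA hζ ⟨x, hxT⟩)]
    | refl x => rfl
    | symm x y _ ih => exact ih.symm
    | trans x y z _ _ ih₁ ih₂ => exact ih₁.trans ih₂

/-- The `h ∩ c^⊥`-orbits in `μ⁻¹(T)` are the preimages of the orbits of the reduced Lagrangian
subalgebra intersected with `c₂₁^⊥`. For the converse direction, a vector generated by an element
of `c₂₁^⊥` in the reduction lifts to a vector `v` with `v + α ∼_R ξ`, where `α` need not vanish;
but it annihilates `T(μ⁻¹(S₁))`, and `ξ` can be changed by an element of `c₁^⊥` to get `v ∼_R ξ`.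
-/
theorem qM_eq_iff (h : IsNested D₁ c₂ S₂ D) (hX : X.IsQuasiHamiltonian)
    (hμ : X.IsCourantMorphism μ) (x y : X.M) (hx : x ∈ X.preim T)
    (hy : y ∈ X.preim T) : D.qM ⟨x, hx⟩ = D.qM ⟨y, hy⟩ ↔
      SameOrbit D₁.reduction.field (D₁.reduction.h.toSubmodule ⊓
          D₁.redAction.d.perp (D₁.inducedAlg c₂)) (D₁.reduction.preim (D₁.inducedSet S₂))
        ⟨D₁.qM ⟨x, h.preim_subset hx⟩, h.qM_mem hX hμ x hx⟩
        ⟨D₁.qM ⟨y, h.preim_subset hy⟩, h.qM_mem hX hμ y hy⟩ := by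
  constructor
  · intro hxy
    have key : ∀ x y : X.preim T,
        SameOrbit X.field (X.h.toSubmodule ⊓ A.d.perp c) (X.preim T) x y →
        SameOrbit D₁.reduction.field (D₁.reduction.h.toSubmodule ⊓
          D₁.redAction.d.perp (D₁.inducedAlg c₂)) (D₁.reduction.preim (D₁.inducedSet S₂))
        ⟨D₁.qM ⟨x, h.preim_subset x.2⟩, h.qM_mem hX hμ x x.2⟩
        ⟨D₁.qM ⟨y, h.preim_subset y.2⟩, h.qM_mem hX hμ y y.2⟩ := by
      intro x y hxy
      induction hxy with
      | rel x y hxy =>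
        obtain ⟨ζ, ⟨hζh, hζ⟩, hf⟩ := hxy
        have hζ₁ : ζ ∈ c₁ := h.le (D.coisotropic hζ)
        refine Relation.EqvGen.mono (fun _ _ hs => ⟨A.d.toReduce c₁ ⟨ζ, hζ₁⟩,
          ⟨⟨⟨ζ, hζ₁⟩, hζh, rfl⟩, (h.toReduce_mem_perp_iff ⟨ζ, hζ₁⟩).2 hζ⟩, hs⟩) _ _
          ((D.isSubmanifold_preim hμ).eqvGen_flowStep_map
            (D₁.regularM.smooth.restrict h.preim_subset)
            (P' := D₁.reduction.preim (D₁.inducedSet S₂))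
            (V' := D₁.reduction.field (A.d.toReduce c₁ ⟨ζ, hζ₁⟩))
            (fun x => h.qM_mem hX hμ x x.2) (fun p r hp hpT hr => ?_) hf)
        obtain ⟨m, v⟩ := p
        obtain ⟨n, hn⟩ := hp
        have hn' : n = μ m := hμ.support _ _ _ hn
        subst hn'
        have hmS := h.preim_subset (mem_of_mem_tangentSet hpT)
        have h1 := hr.of_restrict h.preim_subset D₁.regularM.smooth hpT
        exact ⟨D₁.qN ⟨μ m, hμ.mem_preim_iff.1 hmS⟩, D₁.rel_reduction_iff.2
          ⟨m, v, 0, ⟨ζ, hζ₁⟩, ⟨μ m, hμ.mem_preim_iff.1 hmS⟩, hn,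
            tangentSet_mono h.preim_subset hpT, h1, fun _ _ _ _ => rfl, rfl, rfl⟩⟩
      | refl x => exact Relation.EqvGen.refl _
      | symm x y _ ih => exact ih.symm
      | trans x y z _ _ ih₁ ih₂ => exact ih₁.trans _ _ _ ih₂
    exact key _ _ ((D.regularM.fibres _ _).1 hxy)
  · intro hxy
    obtain ⟨q, hq, hqs, -⟩ := h.exists_descM hX hμ
    rw [← hq x hx, ← hq y hy]
    generalize (⟨D₁.qM ⟨x, h.preim_subset hx⟩, h.qM_mem hX hμ x hx⟩ :
      D₁.reduction.preim (D₁.inducedSet S₂)) = z at hxy ⊢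
    generalize (⟨D₁.qM ⟨y, h.preim_subset hy⟩, h.qM_mem hX hμ y hy⟩ :
      D₁.reduction.preim (D₁.inducedSet S₂)) = z' at hxy ⊢
    induction hxy with
    | rel z z' hz =>
      obtain ⟨η, ⟨-, hη⟩, hf⟩ := hz
      refine (h.isSubmanifold_preim_inducedSet hX hμ).eq_of_flowStep hqs
        (fun p r hp hpT hr => ?_) hf
      obtain ⟨z, w⟩ := p
      obtain ⟨y, hy⟩ := hp
      obtain ⟨m, v, α, ξ, n, hR, hv, hvw, hα, rfl, rfl⟩ := D₁.rel_reduction_iff.1 hy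
      have hn : (n : A.N) = μ m := hμ.support _ _ _ hR
      rw [hn] at hR
      have hξ := (h.toReduce_mem_perp_iff ξ).1 hη
      obtain ⟨hm, hqm⟩ := hvw.proj_eq
      change m ∈ X.preim S₁ at hm
      change D₁.qM ⟨m, hm⟩ = z at hqm
      subst hqm
      have hz : D₁.qM ⟨m, hm⟩ ∈ D₁.reduction.preim (D₁.inducedSet S₂) := mem_of_mem_tangentSet hpT
      rw [h.preim_inducedSet hX hμ] at hz
      obtain ⟨m', hm', hmm⟩ := hz
      have hmT : m ∈ X.preim T := h.sat_qM hX hμ m' ⟨m, hm⟩ hmm hm'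
      have hvT := h.mem_tangentSet_preim hX hμ hv hmT hvw hpT
      -- `α` vanishes on `T(μ⁻¹(S₁))`, so `v` is generated by an element of `h` equal to `ξ`
      -- modulo `c₁^⊥`
      let F : Submodule ℝ (TangentSpace A.N.I (μ m)) :=
        { carrier := {w | (⟨μ m, w⟩ : TangentBundle A.N.I A.N) ∈ tangentSet S₁}
          zero_mem' := zero_mem_tangentSet (hμ.mem_preim_iff.1 hm)
          add_mem' := fun {a b} ha hb => by
            have := add_smul_mem_tangentSet D₁.submanifold ha hb 1
            rwa [one_smul] at this
          smul_mem' := fun r a ha => by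
            have := add_smul_mem_tangentSet D₁.submanifold
              (zero_mem_tangentSet (hμ.mem_preim_iff.1 hm)) ha r
            rwa [zero_add] at this }
      obtain ⟨ζ, hζ, hR'⟩ := hX.exists_rel_of_annihilates hμ hR F (fun u hu => by
        have hu' : (⟨m, u⟩ : TangentBundle X.M.I X.M) ∈ tangentSet (X.preim S₁) :=
          (D₁.mem_tangentSet_preim_iff hμ _).2 hu
        obtain ⟨w', hw'⟩ := D₁.regularM.smooth.exists_isDiff_mk ⟨m, hm⟩ u
        exact hα u w' hu' hw')
      have hζ₁ : ζ ∈ A.d.perp c₁ := fun η hη =>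
        hζ η (D₁.invariant η hη _ (hμ.mem_preim_iff.1 hm))
      have h1 := D.isDiff_zero_M hX hμ (hX.m1 _ _ _ _ hR')
        ((A.d.perp c).sub_mem hξ (h.perp_le hζ₁)) ⟨m, hmT⟩ hR'
      have h3 := hvw.comp h.preim_subset (h.qM_mem hX hμ) hq hvT hr
      rw [h3.unique hvT h1]
    | refl x => rfl
    | symm x y _ ih => exact ih.symm
    | trans x y z _ _ ih₁ ih₂ => exact ih₁.trans ih₂

/-- The data induced by `(c₂, S₂)` on the reduction by `(c₁, S₁)` are reductive, and the quotient
manifolds for `(c, T)` serve as quotient manifolds for them. -/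
theorem inducedReductive (h : IsNested D₁ c₂ S₂ D) (hX : X.IsQuasiHamiltonian) :
    InducedReductive D₁ c₂ S₂ := by
  obtain ⟨μ, hμ⟩ := hX.courant
  obtain ⟨qN, -, -, hqN⟩ := h.exists_descN
  obtain ⟨qM, -, -, hqM⟩ := h.exists_descM hX hμ
  obtain ⟨ν, hνs, hν⟩ := D₁.exists_redMap hX hμ
  have hgr := D₁.graph_reduction hμ hν
  exact ⟨{
    coisotropic := h.isCoisotropic
    submanifold := h.isSubmanifold_inducedSet
    invariant := by
      intro η hη y hy
      obtain ⟨ξ, rfl⟩ := QuadLieAlg.toReduce_surjective η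
      have hξ := (h.toReduce_mem_iff ξ).1 hη
      rw [h.inducedSet_eq] at hy
      obtain ⟨x, hx, rfl⟩ := hy
      exact (D₁.isDiff_redAction hX.action ξ x).mem_tangentSet h.subset h.qN_mem
        (D.invariant ξ hξ x hx)
    redN := D.redN
    qN := qN
    regularN := hqN _ (h.qN_eq_iff hX.action)
    clean := by
      rw [hgr]
      refine cleanInter_graphOf hνs ?_ fun p hp => ?_
      · have := h.isSubmanifold_preim_inducedSet hX hμ
        rwa [preim_eq (X := D₁.reduction) hgr] at this
      · have hpre := preim_eq (X := D₁.reduction) hgr (D₁.inducedSet S₂)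
        refine Eq.mp (congrArg (fun P => p ∈ tangentSet (N := D₁.redM) P) hpre) ?_
        obtain ⟨z, w⟩ := p
        obtain ⟨m, rfl⟩ := D₁.regularM.surjective z
        -- a lift `u` of `w` is tangent to `μ⁻¹(T)`, because `dμ(u)` is tangent to `S₁` and is
        -- mapped into the tangent bundle of `S₂₁`
        obtain ⟨u, hu, huw⟩ := D₁.regularM.submersion m w
        have hmT : (m : X.M) ∈ X.preim T := by
          have h1 : ν (D₁.qM m) ∈ D₁.inducedSet S₂ := mem_of_mem_tangentSet hp
          rw [hν, h.inducedSet_eq] at h1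
          obtain ⟨x, hx, hxm⟩ := h1
          exact hμ.mem_preim_iff.2 (h.sat_qN x _ hxm hx)
        refine huw.mem_tangentSet h.preim_subset (h.qM_mem hX hμ)
          ((D.mem_tangentSet_preim_iff hμ _).2 ?_)
        have h1 := (D₁.mem_tangentSet_preim_iff hμ _).1 hu
        obtain ⟨r, hr⟩ := D₁.regularN.smooth.exists_isDiff (p := tangentMap X.M.I A.N.I μ ⟨m, u⟩)
          (hμ.mem_preim_iff.1 m.2)
        refine h.mem_tangentSet h1 (hμ.mem_preim_iff.1 hmT) hr ?_
        have h2 := hr.comp_map hμ.smooth_map (P := X.preim S₁)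
          (fun x => hμ.mem_preim_iff.1 x.2) m.2
        rw [h2.unique hu (huw.map hνs hν)]
        exact hp
    redM := D.redM
    qM := qM
    regularM := hqM _ (h.qM_eq_iff hX hμ) }⟩

end IsNested

end QHam

/-! ### Reduction in stages -/

/-- Two surjective homomorphisms with the same kernel have isomorphic images. -/
theorem LieHom.exists_equiv_of_ker {L L₁ L₂ : Type*} [LieRing L] [LieAlgebra ℝ L] [LieRing L₁]
    [LieAlgebra ℝ L₁] [LieRing L₂] [LieAlgebra ℝ L₂] (f : L →ₗ⁅ℝ⁆ L₁) (g : L →ₗ⁅ℝ⁆ L₂)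
    (hf : Function.Surjective f) (hg : Function.Surjective g) (h : ∀ x, f x = 0 ↔ g x = 0) :
    ∃ e : L₁ ≃ₗ⁅ℝ⁆ L₂, ∀ x, e (f x) = g x := by
  have h' : ∀ x y, f x = f y ↔ g x = g y := fun x y => by
    rw [← sub_eq_zero, ← map_sub, h, map_sub, sub_eq_zero]
  choose s hs using hf
  choose t ht using hg
  have h1 : ∀ x, g (s (f x)) = g x := fun x => (h' _ _).1 (hs _)
  have h2 : ∀ x, f (t (g x)) = f x := fun x => (h' _ _).2 (ht _)
  refine ⟨{ toFun := fun y => g (s y), invFun := fun y => f (t y), map_add' := fun y y' => ?_,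
            map_smul' := fun r y => ?_, map_lie' := @fun y y' => ?_, left_inv := fun y => ?_,
            right_inv := fun y => ?_ }, h1⟩
  · rw [← map_add]
    exact (h' _ _).1 (by rw [hs, map_add, hs, hs])
  · rw [RingHom.id_apply, ← map_smul]
    exact (h' _ _).1 (by rw [hs, map_smul, hs])
  · rw [← LieHom.map_lie]
    exact (h' _ _).1 (by rw [hs, LieHom.map_lie, hs, hs])
  · exact (h2 _).trans (hs y)
  · exact (h1 _).trans (ht y)

namespace Mfd

variable {N Q : Mfd.{u}} {S : Set N} {R : S → S → Prop} {q : S → Q}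

/-- A covector vanishing on the kernel of `dq : T_x S → TQ` agrees on `T_x S` with the pull-back
of a covector. -/
theorem IsRegularQuotient.exists_covector (hq : IsRegularQuotient S R q) (hS : IsSubmanifold S)
    (x : S) (α : TangentSpace N.I (x : N) →L[ℝ] ℝ)
    (hα : ∀ u : TangentSpace N.I (x : N), (⟨x, u⟩ : TangentBundle N.I N) ∈ tangentSet S →
      IsDiff S q ⟨x, u⟩ ⟨q x, 0⟩ → α u = 0) :
    ∃ β : TangentSpace Q.I (q x) →L[ℝ] ℝ, ∀ (u : TangentSpace N.I (x : N)) w,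
      (⟨x, u⟩ : TangentBundle N.I N) ∈ tangentSet S → IsDiff S q ⟨x, u⟩ ⟨q x, w⟩ → α u = β w := by
  obtain ⟨σ, hσ, hσx, hσS⟩ := hq.exists_section hS x
  let L : TangentSpace Q.I (q x) →L[ℝ] TangentSpace N.I (x : N) :=
    (mfderiv Q.I N.I σ (q x) : Q.E →L[ℝ] N.E)
  have hL : ∀ w, tangentMap Q.I N.I σ ⟨q x, w⟩ = ⟨x, L w⟩ := by
    have h0 : ∀ (y : N) (v : N.E), y = x → (⟨y, v⟩ : TangentBundle N.I N) = ⟨x, v⟩ := by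
      rintro _ v rfl
      rfl
    exact fun w => h0 _ _ hσx
  have h1 : ∀ w, (⟨x, L w⟩ : TangentBundle N.I N) ∈ tangentSet S := by
    intro w
    obtain ⟨γ, hγ, hγw⟩ := exists_curve (⟨q x, w⟩ : TangentBundle Q.I Q)
    have hw : (⟨q x, w⟩ : TangentBundle Q.I Q) ∈ tangentSet Set.univ :=
      ⟨γ, hγ, Filter.univ_mem, hγw⟩
    rw [← hL]
    exact tangentMap_mem_tangentSet hw hσ.at (hσS.mono fun z hz _ => hz.1)
  have h2 : ∀ w, IsDiff S q ⟨x, L w⟩ ⟨q x, w⟩ := by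
    intro w
    obtain ⟨f, hf⟩ := hq.smooth x
    have hf1 : ContMDiffAt N.I Q.I ∞ f (σ (q x)) := by rw [hσx]; exact hf.1
    refine ⟨x.2, f, hf, ?_⟩
    rw [← hL, ← tangentMap_comp_at (f := σ) (g := f) _ (hf1.mdifferentiableAt (by simp)) hσ.mdiff]
    rw [tangentMap_congr_of_eventuallyEq (g := id), tangentMap_id]
    · rfl
    · have hσT : Filter.Tendsto σ (𝓝 (q x)) (𝓝 (x : N)) := by
        have := hσ.tendsto; rwa [hσx] at this
      filter_upwards [hσS, hσT.eventually hf.2] with z ⟨h2, h2'⟩ h3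
      rw [Function.comp_apply, h3 h2, h2']; rfl
  refine ⟨α.comp L, fun u w hu huw => ?_⟩
  have h3 := IsDiff.add_smul hS hu (h1 w) huw (h2 w) (-1)
  have h4 : w + (-1 : ℝ) • w = 0 := by simp
  rw [h4] at h3
  have h5 := hα _ (add_smul_mem_tangentSet hS hu (h1 w) (-1)) h3
  rw [map_add, map_smul, neg_one_smul] at h5
  exact eq_of_sub_eq_zero ((sub_eq_add_neg _ _).trans h5)

end Mfd

namespace QHam

variable {A : ActionSpace.{u}} {X : QHam A} {μ : X.M → A.N} {c₁ c₂ c : LieSubalgebra ℝ A.d}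
  {S₁ S₂ S T : Set A.N} {D₁ : X.ReductiveData c₁ S₁} {D : X.ReductiveData c T}
  {D₂₁ : D₁.reduction.ReductiveData (D₁.inducedAlg c₂) (D₁.inducedSet S₂)}

namespace IsNested

/-- The map `c → (d_{c₁})_{c₂₁}` induced by the identity of `c`. -/
def toReduceTwice (h : IsNested D₁ c₂ S₂ D) :
    c →ₗ⁅ℝ⁆ D₁.redAction.d.reduce (D₁.inducedAlg c₂) where
  toFun x := D₁.redAction.d.toReduce (D₁.inducedAlg c₂)
    ⟨A.d.toReduce c₁ ⟨x, h.le x.2⟩, (h.toReduce_mem_iff ⟨x, h.le x.2⟩).2 x.2⟩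
  map_add' _ _ := rfl
  map_smul' _ _ := rfl
  map_lie' := rfl

theorem toReduceTwice_surjective (h : IsNested D₁ c₂ S₂ D) :
    Function.Surjective h.toReduceTwice := by
  intro y
  obtain ⟨⟨y, hy⟩, rfl⟩ := QuadLieAlg.toReduce_surjective y
  obtain ⟨x, rfl⟩ := QuadLieAlg.toReduce_surjective y
  exact ⟨⟨x, (h.toReduce_mem_iff x).1 hy⟩, rfl⟩

theorem toReduceTwice_eq_zero_iff (h : IsNested D₁ c₂ S₂ D) (x : c) :
    h.toReduceTwice x = 0 ↔ (x : A.d) ∈ A.d.perp c :=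
  QuadLieAlg.toReduce_eq_zero_iff.trans (h.toReduce_mem_perp_iff ⟨x, h.le x.2⟩)

theorem exists_alg (h : IsNested D₁ c₂ S₂ D) :
    ∃ e : D₁.redAction.d.reduce (D₁.inducedAlg c₂) ≃ₗ⁅ℝ⁆ A.d.reduce c,
      ∀ x, e (h.toReduceTwice x) = A.d.toReduce c x :=
  LieHom.exists_equiv_of_ker _ _ h.toReduceTwice_surjective QuadLieAlg.toReduce_surjective
    fun x => (h.toReduceTwice_eq_zero_iff x).trans QuadLieAlg.toReduce_eq_zero_iff.symm

theorem exists_mapN (h : IsNested D₁ c₂ S₂ D) (hA : A.IsCourant)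
    (D₂₁ : D₁.reduction.ReductiveData (D₁.inducedAlg c₂) (D₁.inducedSet S₂)) :
    ∃ φ : D₂₁.redN ≃ₘ⟮D₂₁.redN.I, D.redN.I⟯ D.redN, ∀ x (hx : x ∈ T),
      φ (D₂₁.qN ⟨D₁.qN ⟨x, h.subset hx⟩, h.qN_mem x hx⟩) = D.qN ⟨x, hx⟩ := by
  obtain ⟨q, hq, -, hR⟩ := h.exists_descN
  obtain ⟨φ, hφ⟩ := D₂₁.regularN.exists_diffeomorph h.isSubmanifold_inducedSet
    (hR _ (h.qN_eq_iff hA))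
  exact ⟨φ, fun x hx => (hφ _).trans (hq x hx)⟩

theorem exists_mapM (h : IsNested D₁ c₂ S₂ D) (hX : X.IsQuasiHamiltonian)
    (hμ : X.IsCourantMorphism μ)
    (D₂₁ : D₁.reduction.ReductiveData (D₁.inducedAlg c₂) (D₁.inducedSet S₂)) :
    ∃ φ : D₂₁.redM ≃ₘ⟮D₂₁.redM.I, D.redM.I⟯ D.redM, ∀ x (hx : x ∈ X.preim T),
      φ (D₂₁.qM ⟨D₁.qM ⟨x, h.preim_subset hx⟩, h.qM_mem hX hμ x hx⟩) = D.qM ⟨x, hx⟩ := by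
  obtain ⟨q, hq, -, hR⟩ := h.exists_descM hX hμ
  obtain ⟨φ, hφ⟩ := D₂₁.regularM.exists_diffeomorph (h.isSubmanifold_preim_inducedSet hX hμ)
    (hR _ (h.qM_eq_iff hX hμ))
  exact ⟨φ, fun x hx => (hφ _).trans (hq x hx)⟩

/-- The identification of the reduced base manifolds matches the reduced actions: both
`ρ((ξ + c₁^⊥) + c₂₁^⊥)` and `ρ(ξ + c^⊥)` are the image of `ρ(ξ)`. -/
theorem mfderiv_mapN (h : IsNested D₁ c₂ S₂ D) (hA : A.IsCourant)
    {φ : D₂₁.redN ≃ₘ⟮D₂₁.redN.I, D.redN.I⟯ D.redN}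
    (hφ : ∀ x (hx : x ∈ T),
      φ (D₂₁.qN ⟨D₁.qN ⟨x, h.subset hx⟩, h.qN_mem x hx⟩) = D.qN ⟨x, hx⟩)
    {e : D₁.redAction.d.reduce (D₁.inducedAlg c₂) ≃ₗ⁅ℝ⁆ A.d.reduce c}
    (he : ∀ x, e (h.toReduceTwice x) = A.d.toReduce c x)
    (ξ : D₁.redAction.d.reduce (D₁.inducedAlg c₂)) (n : D₂₁.redN) :
    mfderiv D₂₁.redN.I D.redN.I φ n (D₂₁.redAction.ρ ξ n) = D.redAction.ρ (e ξ) (φ n) := by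
  have hrep : ∀ y : D₁.inducedSet S₂, ∃ x, ∃ hx : x ∈ T,
      y = ⟨D₁.qN ⟨x, h.subset hx⟩, h.qN_mem x hx⟩ := by
    rintro ⟨y, hy⟩
    have hy' := hy
    rw [h.inducedSet_eq] at hy'
    obtain ⟨x, hx, rfl⟩ := hy'
    exact ⟨x, hx, rfl⟩
  have hex : ∃ w : TangentSpace D₂₁.redN.I n, ∃ (y : D₁.inducedSet S₂) (η : D₁.inducedAlg c₂),
      D₂₁.qN y = n ∧ D₁.redAction.d.toReduce _ η = ξ ∧
      IsDiff (N := D₁.redN) (D₁.inducedSet S₂) D₂₁.qN ⟨y.1, D₁.redAction.ρ η y.1⟩ ⟨n, w⟩ := by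
    obtain ⟨y, rfl⟩ := D₂₁.regularN.surjective n
    obtain ⟨η, rfl⟩ := QuadLieAlg.toReduce_surjective ξ
    obtain ⟨w, hw⟩ := D₂₁.regularN.smooth.exists_isDiff_mk y (D₁.redAction.ρ η y.1)
    exact ⟨w, y, η, rfl, rfl, hw⟩
  -- the reduced action of the second step is defined by a choice of representatives; whichever they
  -- are, its value is the image of `ρ(ζ)` for a `ζ ∈ c` representing `ξ`
  obtain ⟨y, η, hy, hη, hd⟩ := Classical.epsilon_spec hex
  change IsDiff (N := D₁.redN) (D₁.inducedSet S₂) D₂₁.qN ⟨y.1, D₁.redAction.ρ η y.1⟩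
    ⟨n, D₂₁.redAction.ρ ξ n⟩ at hd
  obtain ⟨x, hx, rfl⟩ := hrep y
  obtain ⟨η, hηc⟩ := η
  obtain ⟨ζ, rfl⟩ := QuadLieAlg.toReduce_surjective η
  have hζ : (ζ : A.d) ∈ c := (h.toReduce_mem_iff ζ).1 hηc
  have hT : (⟨x, A.ρ ζ x⟩ : TangentBundle A.N.I A.N) ∈ tangentSet T := D.invariant ζ hζ x hx
  have h1 := D₁.isDiff_redAction hA ζ ⟨x, h.subset hx⟩
  have h2 : IsDiff T (fun x => D₂₁.qN ⟨D₁.qN ⟨x, h.subset x.2⟩, h.qN_mem x x.2⟩)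
      ⟨x, A.ρ ζ x⟩ ⟨n, D₂₁.redAction.ρ ξ n⟩ := h1.comp h.subset h.qN_mem (fun _ _ => rfl) hT hd
  have h3 := h2.map φ.contMDiff (g := D.qN) (fun x => hφ x x.2)
  have h4 := D.isDiff_redAction hA ⟨ζ, hζ⟩ ⟨x, hx⟩
  have h5 : e ξ = A.d.toReduce c ⟨ζ, hζ⟩ := by
    rw [← hη, ← he]
    rfl
  subst hy
  rw [h5]
  have h6 := h3.unique hT h4
  rw [← hφ x hx] at h6
  exact eq_of_heq (Bundle.TotalSpace.mk.inj h6).2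

/-- The two-step reduction of `R` is identified with its one-step reduction. The point is that a
covector which on `T(μ⁻¹(T))` is pulled back from `M_{c,T}` is on `T(μ⁻¹(S₁))` pulled back from
`M_{c₁,S₁}`, as the kernel of `dq_M` on `T(μ⁻¹(S₁))` consists of vectors tangent to `μ⁻¹(T)`. -/
theorem rel_iff (h : IsNested D₁ c₂ S₂ D) (hX : X.IsQuasiHamiltonian)
    (hμ : X.IsCourantMorphism μ)
    {φN : D₂₁.redN ≃ₘ⟮D₂₁.redN.I, D.redN.I⟯ D.redN}
    (hφN : ∀ x (hx : x ∈ T),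
      φN (D₂₁.qN ⟨D₁.qN ⟨x, h.subset hx⟩, h.qN_mem x hx⟩) = D.qN ⟨x, hx⟩)
    {φ : D₂₁.redM ≃ₘ⟮D₂₁.redM.I, D.redM.I⟯ D.redM}
    (hφ : ∀ x (hx : x ∈ X.preim T),
      φ (D₂₁.qM ⟨D₁.qM ⟨x, h.preim_subset hx⟩, h.qM_mem hX hμ x hx⟩) = D.qM ⟨x, hx⟩)
    {e : D₁.redAction.d.reduce (D₁.inducedAlg c₂) ≃ₗ⁅ℝ⁆ A.d.reduce c}
    (he : ∀ x, e (h.toReduceTwice x) = A.d.toReduce c x) (z : D₂₁.redM)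
    (v : TangentSpace D₂₁.redM.I z) (β : TangentSpace D.redM.I (φ z) →L[ℝ] ℝ)
    (γ : TangentSpace D₂₁.redM.I z →L[ℝ] ℝ)
    (hγ : ∀ w, γ w = β (mfderiv D₂₁.redM.I D.redM.I φ z w))
    (ξ : D₁.redAction.d.reduce (D₁.inducedAlg c₂)) (n : D₂₁.redN) :
    D₂₁.reduction.Rel z (ξ, v, γ) n ↔
      D.reduction.Rel (φ z) (e ξ, mfderiv D₂₁.redM.I D.redM.I φ z v, β) (φN n) := by
  -- the chain rule for the two quotient maps
  have hchain : ∀ {p : TangentBundle X.M.I X.M} {r : TangentBundle D₁.redM.I D₁.redM}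
      {s : TangentBundle D₂₁.redM.I D₂₁.redM}, p ∈ tangentSet (X.preim T) →
      IsDiff (X.preim S₁) D₁.qM p r →
      IsDiff (N := D₁.redM) (D₁.reduction.preim (D₁.inducedSet S₂)) D₂₁.qM r s →
      IsDiff (X.preim T) D.qM p (tangentMap D₂₁.redM.I D.redM.I φ s) := by
    intro p r s hp hr hs
    have h1 : IsDiff (X.preim T)
        (fun x => D₂₁.qM ⟨D₁.qM ⟨x, h.preim_subset x.2⟩, h.qM_mem hX hμ x x.2⟩) p s :=
      hr.comp h.preim_subset (h.qM_mem hX hμ) (fun _ _ => rfl) hp hs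
    exact h1.map φ.contMDiff (g := D.qM) fun x => hφ x x.2
  have hinj : ∀ {s s' : TangentBundle D₂₁.redM.I D₂₁.redM},
      tangentMap D₂₁.redM.I D.redM.I φ s = tangentMap D₂₁.redM.I D.redM.I φ s' → s = s' := by
    intro s s' hs
    have h1 : ∀ s, tangentMap D.redM.I D₂₁.redM.I φ.symm
        (tangentMap D₂₁.redM.I D.redM.I φ s) = s := by
      intro s
      rw [← tangentMap_comp_of_contMDiff φ.symm.contMDiff φ.contMDiff]
      have h2 : φ.symm ∘ φ = id := funext fun x => φ.symm_apply_apply x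
      rw [h2, tangentMap_id]
      rfl
    rw [← h1 s, hs, h1]
  rw [D.rel_reduction_iff]
  constructor
  · intro hR
    obtain ⟨z₁, v₁, α₁, ⟨ξ₁, hξ₁⟩, ⟨n₁, hn₁⟩, hR₁, hv₁, hd, hα₁, rfl, rfl⟩ :=
      D₂₁.rel_reduction_iff.1 hR
    obtain ⟨m, u, α, ζ, ⟨x, hx⟩, hRm, hu, hd₁, hα, rfl, rfl⟩ := D₁.rel_reduction_iff.1 hR₁
    have hxm : x = μ m := hμ.support _ _ _ hRm
    subst hxm
    obtain ⟨hm, hqm⟩ := hd₁.proj_eq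
    change m ∈ X.preim S₁ at hm
    change D₁.qM ⟨m, hm⟩ = z₁ at hqm
    subst hqm
    obtain ⟨hz, hqz⟩ := hd.proj_eq
    change D₂₁.qM ⟨D₁.qM ⟨m, hm⟩, hz⟩ = z at hqz
    subst hqz
    have hmT : m ∈ X.preim T := by
      have hz' := hz
      rw [h.preim_inducedSet hX hμ] at hz'
      obtain ⟨m', hm', hmm⟩ := hz'
      exact h.sat_qM hX hμ m' ⟨m, hm⟩ hmm hm'
    have hζ : (ζ : A.d) ∈ c := (h.toReduce_mem_iff ζ).1 hξ₁
    have huT := h.mem_tangentSet_preim hX hμ hu hmT hd₁ hv₁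
    refine ⟨m, u, α, ⟨ζ, hζ⟩, ⟨μ m, hμ.mem_preim_iff.1 hmT⟩, hRm, huT, hchain huT hd₁ hd, ?_,
      (he ⟨ζ, hζ⟩).symm, (hφN _ (hμ.mem_preim_iff.1 hmT)).symm⟩
    intro w w' hw hww
    obtain ⟨w₁, hw₁⟩ := D₁.regularM.smooth.exists_isDiff_mk ⟨m, hm⟩ w
    obtain ⟨w₂, hw₂⟩ := D₂₁.regularM.smooth.exists_isDiff_mk ⟨D₁.qM ⟨m, hm⟩, hz⟩ w₁
    have h1 := (hchain hw hw₁ hw₂).mk_unique hw hww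
    rw [← h1]
    exact (hα w w₁ (tangentSet_mono h.preim_subset hw) hw₁).trans
      ((hα₁ w₁ w₂ (hw₁.mem_tangentSet h.preim_subset (h.qM_mem hX hμ) hw) hw₂).trans (hγ w₂))
  · rintro ⟨m, u, α, ⟨ζ, hζ⟩, ⟨x, hx⟩, hRm, huT, hd, hα, hζe, hxn⟩
    have hxm : x = μ m := hμ.support _ _ _ hRm
    subst hxm
    obtain ⟨hmT, hqm⟩ := hd.proj_eq
    change m ∈ X.preim T at hmT
    change D.qM ⟨m, hmT⟩ = φ z at hqm
    have hm := h.preim_subset hmT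
    have hz := h.qM_mem hX hμ m hmT
    have hzq : D₂₁.qM ⟨D₁.qM ⟨m, hm⟩, hz⟩ = z := φ.injective ((hφ m hmT).trans hqm)
    subst hzq
    have hnq : D₂₁.qN ⟨D₁.qN ⟨μ m, h.subset hx⟩, h.qN_mem _ hx⟩ = n :=
      φN.injective ((hφN _ hx).trans hxn)
    have hξ : h.toReduceTwice ⟨ζ, hζ⟩ = ξ := e.injective ((he _).trans hζe)
    obtain ⟨u₁, hu₁⟩ := D₁.regularM.smooth.exists_isDiff_mk ⟨m, hm⟩ u
    have hu₁T := hu₁.mem_tangentSet h.preim_subset (h.qM_mem hX hμ) huT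
    have hlift : ∀ {w : TangentSpace X.M.I m} {w₁ : TangentSpace D₁.redM.I (D₁.qM ⟨m, hm⟩)} {s},
        (⟨m, w⟩ : TangentBundle X.M.I X.M) ∈ tangentSet (X.preim T) →
        IsDiff (X.preim S₁) D₁.qM ⟨m, w⟩ ⟨D₁.qM ⟨m, hm⟩, w₁⟩ →
        IsDiff (X.preim T) D.qM ⟨m, w⟩ (tangentMap D₂₁.redM.I D.redM.I φ s) →
        IsDiff (N := D₁.redM) (D₁.reduction.preim (D₁.inducedSet S₂)) D₂₁.qM
          ⟨D₁.qM ⟨m, hm⟩, w₁⟩ s := by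
      intro w w₁ s hw hw₁ hs
      obtain ⟨s', hs'⟩ := D₂₁.regularM.smooth.exists_isDiff (p := ⟨D₁.qM ⟨m, hm⟩, w₁⟩) hz
      rwa [hinj ((hs.unique hw (hchain hw hw₁ hs')))]
    obtain ⟨α₁, hα₁⟩ := D₁.regularM.exists_covector (D₁.isSubmanifold_preim hμ) ⟨m, hm⟩ α (by
      intro w hw hw0
      have hwT := h.mem_tangentSet_preim hX hμ hw hmT hw0 (zero_mem_tangentSet hz)
      have h1 : IsDiff (X.preim T) D.qM ⟨m, w⟩ (tangentMap D₂₁.redM.I D.redM.I φ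
          ⟨D₂₁.qM ⟨D₁.qM ⟨m, hm⟩, hz⟩, 0⟩) :=
        hchain hwT hw0 (IsDiff.zero D₂₁.regularM.smooth ⟨D₁.qM ⟨m, hm⟩, hz⟩)
      rw [hα w _ hwT h1, map_zero, map_zero])
    refine D₂₁.rel_reduction_iff.2 ⟨D₁.qM ⟨m, hm⟩, u₁, α₁,
      ⟨A.d.toReduce c₁ ⟨ζ, h.le hζ⟩, (h.toReduce_mem_iff ⟨ζ, h.le hζ⟩).2 hζ⟩,
      ⟨D₁.qN ⟨μ m, h.subset hx⟩, h.qN_mem _ hx⟩, ?_, hu₁T, hlift huT hu₁ hd, ?_, hξ, hnq⟩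
    · exact D₁.rel_reduction_iff.2 ⟨m, u, α, ⟨ζ, h.le hζ⟩, ⟨μ m, h.subset hx⟩, hRm,
        tangentSet_mono h.preim_subset huT, hu₁, hα₁, rfl, rfl⟩
    · intro w₁ w₂ hw₁ hw₂
      obtain ⟨w, hw, hww₁⟩ := D₁.regularM.submersion ⟨m, hm⟩ w₁
      have hwT := h.mem_tangentSet_preim hX hμ hw hmT hww₁ hw₁
      exact (hα₁ w w₁ hw hww₁).symm.trans
        ((hα w _ hwT (hchain hwT hww₁ hw₂)).trans (hγ w₂).symm)

/-- Reduction in stages: the identifications of the Lie algebras, of the base manifolds and of the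
reduced spaces fit together to an isomorphism. -/
theorem stagesEq (h : IsNested D₁ c₂ S₂ D) (hX : X.IsQuasiHamiltonian)
    (D₂₁ : D₁.reduction.ReductiveData (D₁.inducedAlg c₂) (D₁.inducedSet S₂)) :
    StagesEq D₁ D₂₁ D := by
  obtain ⟨μ, hμ⟩ := hX.courant
  obtain ⟨e, he⟩ := h.exists_alg
  obtain ⟨φN, hφN⟩ := h.exists_mapN hX.action D₂₁
  obtain ⟨φM, hφM⟩ := h.exists_mapM hX hμ D₂₁
  refine ⟨{
    alg := e
    mapN := φN
    mapM := φM
    alg_form := ?_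
    alg_h := ?_
    map_ρ := h.mfderiv_mapN hX.action hφN he
    map_R := fun z v β ξ n => h.rel_iff hX hμ hφN hφM he z v β _ (fun _ => rfl) ξ n }, ?_, ?_, ?_⟩
  · intro ξ η
    obtain ⟨x, rfl⟩ := h.toReduceTwice_surjective ξ
    obtain ⟨y, rfl⟩ := h.toReduceTwice_surjective η
    exact (congrArg₂ (fun a b => (A.d.reduce c).form a b) (he x) (he y)).trans rfl
  · intro ξ
    constructor
    · rintro ⟨x, hx, hxξ⟩
      have h1 : h.toReduceTwice x = ξ := e.injective ((he x).trans hxξ)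
      rw [← h1]
      exact ⟨⟨A.d.toReduce c₁ ⟨x, h.le x.2⟩, (h.toReduce_mem_iff ⟨x, h.le x.2⟩).2 x.2⟩,
        ⟨⟨x, h.le x.2⟩, hx, rfl⟩, rfl⟩
    · rintro ⟨⟨y, hy⟩, ⟨x, hx, rfl⟩, rfl⟩
      have hxc : (x : A.d) ∈ c := (h.toReduce_mem_iff x).1 hy
      exact ⟨⟨x, hxc⟩, hx, (he ⟨x, hxc⟩).symm⟩
  · intro ξ hξ
    exact ⟨h.le hξ, (h.toReduce_mem_iff ⟨ξ, h.le hξ⟩).2 hξ, he ⟨ξ, hξ⟩⟩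
  · intro x hx
    exact ⟨h.subset hx, h.qN_mem x hx, hφN x hx⟩
  · intro x hx
    exact ⟨h.preim_subset hx, h.qM_mem hX hμ x hx, hφM x hx⟩

end IsNested

end QHam

/-! ### Reductions of distinct factors -/

theorem QuadLieAlg.mem_perp_sumAlg {d d' : QuadLieAlg.{u}} {c : LieSubalgebra ℝ d}
    {c' : LieSubalgebra ℝ d'} {ζ : d.prod d'}
    (h : ζ ∈ (d.prod d').perp (QuadLieAlg.sumAlg c c')) :
    ζ.1 ∈ d.perp c ∧ ζ.2 ∈ d'.perp c' := by
  constructor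
  · intro y hy
    have h1 : d.form ζ.1 y + d'.form ζ.2 0 = 0 := h (y, 0) ⟨hy, c'.zero_mem⟩
    rwa [map_zero, add_zero] at h1
  · intro y hy
    have h1 : d.form ζ.1 0 + d'.form ζ.2 y = 0 := h (0, y) ⟨c.zero_mem, hy⟩
    rwa [map_zero, zero_add] at h1

theorem QuadLieAlg.eq_zero_of_mem_perp_top {d : QuadLieAlg.{u}} {ζ : d} (h : ζ ∈ d.perp ⊤) :
    ζ = 0 :=
  d.form_nondeg ζ fun y => h y (LieSubalgebra.mem_top (R := ℝ) y)

theorem QuadLieAlg.sumAlg_inf {d d' : QuadLieAlg.{u}} (a b : LieSubalgebra ℝ d)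
    (a' b' : LieSubalgebra ℝ d') :
    QuadLieAlg.sumAlg a a' ⊓ QuadLieAlg.sumAlg b b' = QuadLieAlg.sumAlg (a ⊓ b) (a' ⊓ b') :=
  inf_inf_inf_comm _ _ _ _

namespace Mfd

theorem curve_fst {N M : Mfd.{u}} {γ : ℝ → N.prod M} {t : ℝ}
    (h : MDifferentiableAt 𝓘(ℝ, ℝ) (N.prod M).I γ t) :
    MDifferentiableAt 𝓘(ℝ, ℝ) N.I (fun s => (γ s).1) t ∧
      mfderiv 𝓘(ℝ, ℝ) N.I (fun s => (γ s).1) t (1 : ℝ) =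
        (mfderiv 𝓘(ℝ, ℝ) (N.prod M).I γ t (1 : ℝ) : N.E × M.E).1 := by
  have h1 := contMDiff_prodFst.mdifferentiable (by simp) (γ t)
  refine ⟨h1.comp t h, ?_⟩
  have h2 := (tangentMap_comp_at (f := γ) (g := prodFst (N := N) (M := M))
    (⟨t, (1 : ℝ)⟩ : TangentBundle 𝓘(ℝ, ℝ) ℝ) h1 h).trans
    (tangentMap_prodFst (I := N.I) (I' := M.I) (M := N) (M' := M))
  exact Bundle.TotalSpace.mk_inj.1 h2

theorem curve_snd {N M : Mfd.{u}} {γ : ℝ → N.prod M} {t : ℝ}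
    (h : MDifferentiableAt 𝓘(ℝ, ℝ) (N.prod M).I γ t) :
    MDifferentiableAt 𝓘(ℝ, ℝ) M.I (fun s => (γ s).2) t ∧
      mfderiv 𝓘(ℝ, ℝ) M.I (fun s => (γ s).2) t (1 : ℝ) =
        (mfderiv 𝓘(ℝ, ℝ) (N.prod M).I γ t (1 : ℝ) : N.E × M.E).2 := by
  have h1 := contMDiff_prodSnd.mdifferentiable (by simp) (γ t)
  refine ⟨h1.comp t h, ?_⟩
  have h2 := (tangentMap_comp_at (f := γ) (g := prodSnd (N := N) (M := M))
    (⟨t, (1 : ℝ)⟩ : TangentBundle 𝓘(ℝ, ℝ) ℝ) h1 h).trans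
    (tangentMap_prodSnd (I := N.I) (I' := M.I) (M := N) (M' := M))
  exact Bundle.TotalSpace.mk_inj.1 h2

end Mfd

namespace ActionSpace

variable {A B : ActionSpace.{u}}

/-- The components of an integral curve in a product are integral curves. -/
theorem flowStep_prod {ζ : (A.prod B).d} {S : Set (A.prod B).N} {x y : S}
    (h : FlowStep ((A.prod B).field ζ) S x y) :
    FlowStep (A.field ζ.1) Set.univ ⟨x.1.1, trivial⟩ ⟨y.1.1, trivial⟩ ∧
      FlowStep (B.field ζ.2) Set.univ ⟨x.1.2, trivial⟩ ⟨y.1.2, trivial⟩ := by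
  obtain ⟨γ, a, b, hab, ha, hb, hγ⟩ := h
  refine ⟨⟨fun t => (γ t).1, a, b, hab, congrArg Prod.fst ha, congrArg Prod.fst hb,
    fun t ht => ?_⟩, ⟨fun t => (γ t).2, a, b, hab, congrArg Prod.snd ha, congrArg Prod.snd hb,
    fun t ht => ?_⟩⟩
  · obtain ⟨-, h1, h2⟩ := hγ t ht
    obtain ⟨h3, h4⟩ := curve_fst (N := A.N) (M := B.N) h1
    exact ⟨trivial, h3, h4.trans (congrArg Prod.fst h2)⟩
  · obtain ⟨-, h1, h2⟩ := hγ t ht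
    obtain ⟨h3, h4⟩ := curve_snd (N := A.N) (M := B.N) h1
    exact ⟨trivial, h3, h4.trans (congrArg Prod.snd h2)⟩

theorem eq_of_flowStep_zero (h0 : ∀ x, A.ρ 0 x = 0) {S : Set A.N} {x y : S}
    (h : FlowStep (A.field 0) S x y) : (x : A.N) = y := by
  obtain ⟨γ, a, b, hab, ha, hb, hγ⟩ := h
  rw [← ha, ← hb]
  exact eq_of_velocity_eq_zero hab fun t ht => ⟨(hγ t ht).2.1, (hγ t ht).2.2.trans (h0 _)⟩

end ActionSpace

/-- A function which is preserved by the flows of `k` is constant on its orbits. -/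
theorem Mfd.SameOrbit.apply_eq {d : QuadLieAlg.{u}} {N : Mfd.{u}}
    {V : d → Set (TangentBundle N.I N)} {k : Submodule ℝ d} {S : Set N} {α : Type*} (f : N → α)
    (hf : ∀ ξ ∈ k, ∀ x y : S, FlowStep (V ξ) S x y → f x = f y) {x y : S}
    (h : SameOrbit V k S x y) : f x = f y := by
  induction h with
  | rel x y h =>
    obtain ⟨ξ, hξ, h⟩ := h
    exact hf ξ hξ x y h
  | refl x => rfl
  | symm x y _ ih => exact ih.symm
  | trans x y z _ _ ih₁ ih₂ => exact ih₁.trans ih₂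

namespace QHam

variable {A A' A'' : ActionSpace.{u}} {X : QHam (A.prod (A'.prod A''))}

/-- The reduction in the factor `d × N` followed by the one in `d' × N'` is nested: elements of
`(c ⊕ d' ⊕ d'')^⊥` have no component in `d'`, and their flows do not move the component in `N'`. -/
theorem isNested_fst (hX : X.IsQuasiHamiltonian) {c : LieSubalgebra ℝ A.d} {S : Set A.N}
    {c' : LieSubalgebra ℝ A'.d} {S' : Set A'.N}
    (D₁ : X.ReductiveData (QuadLieAlg.sumAlg c (QuadLieAlg.sumAlg ⊤ ⊤))
      (ActionSpace.prodSet S (ActionSpace.prodSet Set.univ Set.univ)))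
    (D : X.ReductiveData (QuadLieAlg.sumAlg c (QuadLieAlg.sumAlg c' ⊤))
      (ActionSpace.prodSet S (ActionSpace.prodSet S' Set.univ))) :
    IsNested D₁ (QuadLieAlg.sumAlg ⊤ (QuadLieAlg.sumAlg c' ⊤))
      (ActionSpace.prodSet Set.univ (ActionSpace.prodSet S' Set.univ)) D where
  alg := by
    refine Eq.trans ?_ (QuadLieAlg.sumAlg_inf _ _ _ _).symm
    rw [inf_top_eq]
    refine congrArg _ (Eq.trans ?_ (QuadLieAlg.sumAlg_inf _ _ _ _).symm)
    rw [top_inf_eq, inf_top_eq]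
  set := by
    ext x
    exact ⟨fun h => ⟨⟨h.1, trivial, trivial⟩, trivial, h.2⟩, fun h => ⟨h.1.1, h.2.2⟩⟩
  sat x y h hx := by
    have h0 : ∀ z : A'.N, A'.ρ 0 z = 0 := fun z =>
      congrArg (fun v : A.N.E × A'.N.E × A''.N.E => v.2.1)
        (hX.action.ρ_zero (x.1.1, z, x.1.2.2))
    have h2 : x.1.2.1 = y.1.2.1 := h.apply_eq (fun z : (A.prod (A'.prod A'')).N => z.2.1) (by
      intro ζ hζ x y hf
      have h3 := (QuadLieAlg.mem_perp_sumAlg (QuadLieAlg.mem_perp_sumAlg hζ).2).1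
      have h4 := (ActionSpace.flowStep_prod (ActionSpace.flowStep_prod hf).2).1
      rw [QuadLieAlg.eq_zero_of_mem_perp_top h3] at h4
      exact ActionSpace.eq_of_flowStep_zero h0 h4)
    refine ⟨trivial, ?_, trivial⟩
    rw [← h2]
    exact hx.2.1

/-- The analogue of `isNested_fst` with the factors `d × N` and `d' × N'` exchanged. -/
theorem isNested_snd (hX : X.IsQuasiHamiltonian) {c : LieSubalgebra ℝ A.d} {S : Set A.N}
    {c' : LieSubalgebra ℝ A'.d} {S' : Set A'.N}
    (D₂ : X.ReductiveData (QuadLieAlg.sumAlg ⊤ (QuadLieAlg.sumAlg c' ⊤))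
      (ActionSpace.prodSet Set.univ (ActionSpace.prodSet S' Set.univ)))
    (D : X.ReductiveData (QuadLieAlg.sumAlg c (QuadLieAlg.sumAlg c' ⊤))
      (ActionSpace.prodSet S (ActionSpace.prodSet S' Set.univ))) :
    IsNested D₂ (QuadLieAlg.sumAlg c (QuadLieAlg.sumAlg ⊤ ⊤))
      (ActionSpace.prodSet S (ActionSpace.prodSet Set.univ Set.univ)) D where
  alg := by
    refine Eq.trans ?_ (QuadLieAlg.sumAlg_inf _ _ _ _).symm
    rw [top_inf_eq]
    refine congrArg _ (Eq.trans ?_ (QuadLieAlg.sumAlg_inf _ _ _ _).symm)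
    rw [inf_top_eq, inf_top_eq]
  set := by
    ext x
    exact ⟨fun h => ⟨⟨trivial, h.2⟩, h.1, trivial, trivial⟩, fun h => ⟨h.2.1, h.1.2⟩⟩
  sat x y h hx := by
    have h0 : ∀ z : A.N, A.ρ 0 z = 0 := fun z =>
      congrArg (fun v : A.N.E × A'.N.E × A''.N.E => v.1) (hX.action.ρ_zero (z, x.1.2))
    have h2 : x.1.1 = y.1.1 := h.apply_eq (fun z : (A.prod (A'.prod A'')).N => z.1) (by
      intro ζ hζ x y hf
      have h3 := (QuadLieAlg.mem_perp_sumAlg hζ).1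
      have h4 := (ActionSpace.flowStep_prod hf).1
      rw [QuadLieAlg.eq_zero_of_mem_perp_top h3] at h4
      exact ActionSpace.eq_of_flowStep_zero h0 h4)
    refine ⟨?_, trivial, trivial⟩
    rw [← h2]
    exact hx.1

/-- Reductions of distinct factors commute. -/
theorem stagesCommute_prod (hX : X.IsQuasiHamiltonian) (c : LieSubalgebra ℝ A.d) (S : Set A.N)
    (c' : LieSubalgebra ℝ A'.d) (S' : Set A'.N)
    (D₁ : X.ReductiveData (QuadLieAlg.sumAlg c (QuadLieAlg.sumAlg ⊤ ⊤))
      (ActionSpace.prodSet S (ActionSpace.prodSet Set.univ Set.univ)))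
    (D₂ : X.ReductiveData (QuadLieAlg.sumAlg ⊤ (QuadLieAlg.sumAlg c' ⊤))
      (ActionSpace.prodSet Set.univ (ActionSpace.prodSet S' Set.univ)))
    (D : X.ReductiveData (QuadLieAlg.sumAlg c (QuadLieAlg.sumAlg c' ⊤))
      (ActionSpace.prodSet S (ActionSpace.prodSet S' Set.univ))) :
    InducedReductive D₁ (QuadLieAlg.sumAlg ⊤ (QuadLieAlg.sumAlg c' ⊤))
      (ActionSpace.prodSet Set.univ (ActionSpace.prodSet S' Set.univ)) ∧
    InducedReductive D₂ (QuadLieAlg.sumAlg c (QuadLieAlg.sumAlg ⊤ ⊤))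
      (ActionSpace.prodSet S (ActionSpace.prodSet Set.univ Set.univ)) ∧
    StagesCommute D₁ D₂ D := by
  have h₁ := isNested_fst hX D₁ D
  have h₂ := isNested_snd hX D₂ D
  exact ⟨h₁.inducedReductive hX, h₂.inducedReductive hX,
    fun D₂₁ D₁₂ => ⟨h₁.stagesEq hX D₂₁, h₂.stagesEq hX D₁₂⟩⟩

end QHam

end

theorem mainTheorem8 :
    (∀ (A : ActionSpace.{u}) (X : QHam A), X.IsQuasiHamiltonian →
      ∀ (c₁ c₂ : LieSubalgebra ℝ A.d) (S₁ S₂ : Set A.N),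
      Mfd.CleanInter S₁ S₂ →
      ∀ (D₁ : X.ReductiveData c₁ S₁) (D₂ : X.ReductiveData c₂ S₂)
        (D : X.ReductiveData (c₁ ⊓ c₂) (S₁ ∩ S₂)),
      (∀ x y : S₁, Mfd.SameOrbit A.field (A.d.perp c₁) S₁ x y →
        (x : A.N) ∈ S₂ → (y : A.N) ∈ S₂) →
      (∀ x y : S₂, Mfd.SameOrbit A.field (A.d.perp c₂) S₂ x y →
        (x : A.N) ∈ S₁ → (y : A.N) ∈ S₁) →
      QHam.InducedReductive D₁ c₂ S₂ → QHam.InducedReductive D₂ c₁ S₁ →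
      QHam.StagesCommute D₁ D₂ D) ∧
    (∀ (A A' A'' : ActionSpace.{u}) (X : QHam (A.prod (A'.prod A''))), X.IsQuasiHamiltonian →
      ∀ (c : LieSubalgebra ℝ A.d) (S : Set A.N) (c' : LieSubalgebra ℝ A'.d) (S' : Set A'.N)
        (D₁ : X.ReductiveData (QuadLieAlg.sumAlg c (QuadLieAlg.sumAlg ⊤ ⊤))
          (ActionSpace.prodSet S (ActionSpace.prodSet Set.univ Set.univ)))
        (D₂ : X.ReductiveData (QuadLieAlg.sumAlg ⊤ (QuadLieAlg.sumAlg c' ⊤))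
          (ActionSpace.prodSet Set.univ (ActionSpace.prodSet S' Set.univ)))
        (D : X.ReductiveData (QuadLieAlg.sumAlg c (QuadLieAlg.sumAlg c' ⊤))
          (ActionSpace.prodSet S (ActionSpace.prodSet S' Set.univ))),
      QHam.InducedReductive D₁ (QuadLieAlg.sumAlg ⊤ (QuadLieAlg.sumAlg c' ⊤))
        (ActionSpace.prodSet Set.univ (ActionSpace.prodSet S' Set.univ)) ∧
      QHam.InducedReductive D₂ (QuadLieAlg.sumAlg c (QuadLieAlg.sumAlg ⊤ ⊤))
        (ActionSpace.prodSet S (ActionSpace.prodSet Set.univ Set.univ)) ∧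
      QHam.StagesCommute D₁ D₂ D) ∧
    (∀ (G G' : MetricLieGroup.{u}) (A'' : ActionSpace.{u})
      (X : QHam ((G.cartan.prod G.cartan).prod ((G'.cartan.prod G'.cartan).prod A''))),
      X.IsQuasiHamiltonian →
      ∀ (D₁ : X.ReductiveData (QuadLieAlg.sumAlg G.sewAlg (QuadLieAlg.sumAlg ⊤ ⊤))
          (ActionSpace.prodSet G.sewSet (ActionSpace.prodSet Set.univ Set.univ)))
        (D₂ : X.ReductiveData (QuadLieAlg.sumAlg ⊤ (QuadLieAlg.sumAlg G'.sewAlg ⊤))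
          (ActionSpace.prodSet Set.univ (ActionSpace.prodSet G'.sewSet Set.univ)))
        (D : X.ReductiveData (QuadLieAlg.sumAlg G.sewAlg (QuadLieAlg.sumAlg G'.sewAlg ⊤))
          (ActionSpace.prodSet G.sewSet (ActionSpace.prodSet G'.sewSet Set.univ))),
      QHam.InducedReductive D₁ (QuadLieAlg.sumAlg ⊤ (QuadLieAlg.sumAlg G'.sewAlg ⊤))
        (ActionSpace.prodSet Set.univ (ActionSpace.prodSet G'.sewSet Set.univ)) ∧
      QHam.InducedReductive D₂ (QuadLieAlg.sumAlg G.sewAlg (QuadLieAlg.sumAlg ⊤ ⊤))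
        (ActionSpace.prodSet G.sewSet (ActionSpace.prodSet Set.univ Set.univ)) ∧
      QHam.StagesCommute D₁ D₂ D) := by
  refine ⟨?_, ?_, ?_⟩
  · intro A X hX c₁ c₂ S₁ S₂ _ D₁ D₂ D sat₁ sat₂ _ _ D₂₁ D₁₂
    have h₁ : QHam.IsNested D₁ c₂ S₂ D := ⟨rfl, rfl, sat₁⟩
    have h₂ : QHam.IsNested D₂ c₁ S₁ D := ⟨inf_comm _ _, Set.inter_comm _ _, sat₂⟩
    exact ⟨h₁.stagesEq hX D₂₁, h₂.stagesEq hX D₁₂⟩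
  · intro A A' A'' X hX c S c' S' D₁ D₂ D
    exact QHam.stagesCommute_prod hX c S c' S' D₁ D₂ D
  · intro G G' A'' X hX D₁ D₂ D
    exact QHam.stagesCommute_prod hX G.sewAlg G.sewSet G'.sewAlg G'.sewSet D₁ D₂ D
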